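/- \textbf{Lemma (killing the $n$-th homotopy group).} Let $n\ge 1$, let $X$ be a simply connected space with base point $x_0$, and let $Y$ be a space with base point $y_0$ such that $\pi_{n-1}(Y,y_0)=0$. Let $\lambda_n\in H^n(Y;\pi_n(X,x_0))$ be a singular cohomology class such that the map $\pi_n(Y,y_0)\to\pi_n(X,x_0)$ induced by $\lambda_n$ (evaluation of $\lambda_n$ on Hurewicz images) is an isomorphism. Let $K=K(\pi_n(X,x_0),n)$ be an Eilenberg--MacLane space, i.e. a path connected space with $\pi_k(K)=0$ for $k\neq n$ together with a class $\iota\in H^n(K;\pi_n(X,x_0))$ inducing an isomorphism $\pi_n(K)\to\pi_n(X,x_0)$, let $g:Y\to K$ be a map representing $\lambda_n$, i.e. $g^*\iota=\lambda_n$, and let $k_0\in K$. Let $$\widehat Y=\{(y,\gamma)\in Y\times K^{[0,1]} : \gamma(0)=k_0,\ \gamma(1)=g(y)\},\qquad q:\widehat Y\to Y,\quad q(y,\gamma)=y,$$ be the homotopy fiber of $\lambda_n$. Then: \begin{enumerate} \item $q$ is a surjective (Hurewicz) fibration. \item For every base point $\widehat y_0\in\widehat Y$ with $q(\widehat y_0)=y_0$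 one has $\pi_n(\widehat Y,\widehat y_0)=0$, and $q_*:\pi_k(\widehat Y,\widehat y_0)\to\pi_k(Y,y_0)$ is an isomorphism for every $k\ge 0$ with $k\neq n$ (an isomorphism of groups for $k\geq 1$, a bijection for $k=0$). \item Let $f:M\to Y$ be a map. If $g\circ f$ is null-homotopic, where $M$ is an arbitrary space, or if $M$ has the homotopy type of a CW complex and $f^*\lambda_n=0$ in $H^n(M;\pi_n(X,x_0))$, then there is a map $\widehat f:M\to\widehat Y$ with $q\circ\widehat f=f$. \end{enumerate} -/

import Mathlib

open scoped Topology unitInterval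

noncomputable section

namespace KillPi

/-! ### Maps induced on homotopy groups -/

/-- Composition of a generalized loop at `x` with a continuous map sending `x` to `y`. -/
def genLoopMap {N X Y : Type*} [TopologicalSpace X] [TopologicalSpace Y] (f : C(X, Y))
    {x : X} {y : Y} (h : f x = y) (p : GenLoop N X x) : GenLoop N Y y :=
  ⟨f.comp p.1, fun t ht => by
    rw [ContinuousMap.comp_apply, p.2 t ht, h]⟩

/-- The map `f_* : π_k(X, x) → π_k(Y, y)` induced by a continuous map with `f x = y`. -/
def piMap {X Y : Type*} [TopologicalSpace X] [TopologicalSpace Y] (k : ℕ) (f : C(X, Y))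
    {x : X} {y : Y} (h : f x = y) : π_ k X x → π_ k Y y :=
  Quotient.map (genLoopMap f h) fun p q hpq => by
    have H : (f.comp p.1).HomotopicRel (f.comp q.1) (Cube.boundary (Fin k)) :=
      ContinuousMap.HomotopicRel.comp_continuousMap hpq f
    exact H

/-! ### The coefficient group -/

/-- The group `π_n(X, x)` of a simply connected space, written additively (for `n ≥ 1`). -/
def PiCoeff (n : ℕ) (X : Type*) [TopologicalSpace X] (x : X) : Type _ :=
  Additive (π_ n X x)

instance instAddCommGroupPiCoeff (n : ℕ) [NeZero n] (X : Type*) [TopologicalSpace X]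
    [SimplyConnectedSpace X] (x : X) : AddCommGroup (PiCoeff n X x) :=
  { (inferInstance : AddGroup (Additive (π_ n X x))) with
    add_comm := by
      intro a b
      obtain ⟨m, rfl⟩ : ∃ m, n = m + 1 := ⟨n - 1, by have := NeZero.ne n; omega⟩
      rcases m with _ | m
      · have : Subsingleton (π_ 1 X x) :=
          (HomotopyGroup.pi1EquivFundamentalGroup (X := X) (x := x)).subsingleton
        exact Subsingleton.elim (α := π_ 1 X x) _ _
      · exact mul_comm (G := π_ (m + 2) X x) (Additive.toMul a) (Additive.toMul b) }

/-! ### Singular cohomology, through normalized singular cubical cochains -/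

/-- Singular `n`-cubes of `W`. -/
abbrev SingularCube (n : ℕ) (W : Type*) [TopologicalSpace W] := C(Fin n → I, W)

/-- The face of a singular cube on which the `i`-th coordinate equals `ε`. -/
def cubeFace {n : ℕ} {W : Type*} [TopologicalSpace W] (i : Fin (n + 1)) (ε : I)
    (τ : SingularCube (n + 1) W) : SingularCube n W :=
  τ.comp ⟨fun t => i.insertNth ε t, by fun_prop⟩

/-- A singular cube is degenerate if it does not depend on one of its coordinates. -/
def IsDegenerate {n : ℕ} {W : Type*} [TopologicalSpace W] (τ : SingularCube n W) : Prop :=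
  ∃ i : Fin n, ∀ s t : Fin n → I, (∀ j, j ≠ i → s j = t j) → τ s = τ t

/-- `A`-valued singular cubical `n`-cochains: functions on the singular `n`-cubes that vanish on
the degenerate ones. -/
def Cochain (n : ℕ) (W : Type*) [TopologicalSpace W] (A : Type*) [AddCommGroup A] :
    AddSubgroup (SingularCube n W → A) where
  carrier := {φ | ∀ τ, IsDegenerate τ → φ τ = 0}
  add_mem' := fun ha hb τ hτ => by simp [ha τ hτ, hb τ hτ]
  zero_mem' := fun _ _ => rfl
  neg_mem' := fun ha τ hτ => by simp [ha τ hτ]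

/-- The coboundary `(δφ)(τ) = ∑ i, (-1) ^ i (φ(τ|_{tᵢ = 1}) - φ(τ|_{tᵢ = 0}))`. -/
def coboundary (n : ℕ) (W : Type*) [TopologicalSpace W] (A : Type*) [AddCommGroup A] :
    Cochain n W A →+ Cochain (n + 1) W A where
  toFun φ := ⟨fun τ => ∑ i : Fin (n + 1),
      (-1 : ℤ) ^ (i : ℕ) • (φ.1 (cubeFace i 1 τ) - φ.1 (cubeFace i 0 τ)), by
    rintro τ ⟨i, hi⟩
    refine Finset.sum_eq_zero fun j _ => ?_
    by_cases hij : j = i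
    · subst hij
      have : cubeFace j 1 τ = cubeFace j 0 τ := by
        ext t
        refine hi _ _ fun k hk => ?_
        obtain ⟨l, rfl⟩ := Fin.exists_succAbove_eq hk
        simp
      rw [this]; simp
    · obtain ⟨l, rfl⟩ := Fin.exists_succAbove_eq (Ne.symm hij)
      have key : ∀ ε : I, IsDegenerate (cubeFace j ε τ) := fun ε => by
        refine ⟨l, fun s t hst => hi _ _ fun k hk => ?_⟩
        rcases eq_or_ne k j with rfl | hkj
        · simp
        · obtain ⟨m, rfl⟩ := Fin.exists_succAbove_eq hkj
          have hml : m ≠ l := fun h => hk (by rw [h])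
          simpa using hst m hml
      rw [φ.2 _ (key 1), φ.2 _ (key 0)]; simp⟩
  map_zero' := by ext τ; simp
  map_add' φ ψ := by
    ext τ
    simp only [AddSubgroup.coe_add, Pi.add_apply, ← Finset.sum_add_distrib, ← smul_add]
    refine Finset.sum_congr rfl fun i _ => ?_
    congr 1
    abel

/-- Cocycles of degree `n`. -/
abbrev Cocycle (n : ℕ) (W : Type*) [TopologicalSpace W] (A : Type*) [AddCommGroup A] :
    AddSubgroup (Cochain n W A) :=
  (coboundary n W A).ker

/-- Coboundaries of degree `n`; there are no nonzero ones in degree `0`. -/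
def Coboundaries (n : ℕ) (W : Type*) [TopologicalSpace W] (A : Type*) [AddCommGroup A] :
    AddSubgroup (Cochain n W A) :=
  match n with
  | 0 => ⊥
  | m + 1 => (coboundary m W A).range

/-- The singular cohomology group `Hⁿ(W; A)`. -/
abbrev Cohomology (n : ℕ) (W : Type*) [TopologicalSpace W] (A : Type*) [AddCommGroup A] :=
  Cocycle n W A ⧸ (Coboundaries n W A).addSubgroupOf (Cocycle n W A)

theorem IsDegenerate.comp {n : ℕ} {V W : Type*} [TopologicalSpace V] [TopologicalSpace W]
    {τ : SingularCube n V} (hτ : IsDegenerate τ) (f : C(V, W)) :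
    IsDegenerate (n := n) (f.comp τ) := by
  obtain ⟨i, hi⟩ := hτ
  exact ⟨i, fun s t h => congrArg f (hi s t h)⟩

/-- Pullback of cochains along `f : V → W`. -/
def cochainPullback (n : ℕ) {V W : Type*} [TopologicalSpace V] [TopologicalSpace W]
    (A : Type*) [AddCommGroup A] (f : C(V, W)) : Cochain n W A →+ Cochain n V A where
  toFun φ := ⟨fun τ => φ.1 (f.comp τ), fun _ hτ => φ.2 _ (hτ.comp f)⟩
  map_zero' := rfl
  map_add' _ _ := rfl

theorem coboundary_pullback (n : ℕ) {V W : Type*} [TopologicalSpace V] [TopologicalSpace W]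
    (A : Type*) [AddCommGroup A] (f : C(V, W)) (φ : Cochain n W A) :
    coboundary n V A (cochainPullback n A f φ)
      = cochainPullback (n + 1) A f (coboundary n W A φ) := rfl

/-- Pullback of cocycles along `f : V → W`. -/
def cocyclePullback (n : ℕ) {V W : Type*} [TopologicalSpace V] [TopologicalSpace W]
    (A : Type*) [AddCommGroup A] (f : C(V, W)) : Cocycle n W A →+ Cocycle n V A :=
  ((cochainPullback n A f).comp (Cocycle n W A).subtype).codRestrict _ fun z => by
    have hz : coboundary n W A z.1 = 0 := z.2
    change coboundary n V A (cochainPullback n A f z.1) = 0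
    rw [coboundary_pullback, hz, map_zero]

/-- The map `f^* : Hⁿ(W; A) → Hⁿ(V; A)` induced by `f : V → W`. -/
def pullback (n : ℕ) {V W : Type*} [TopologicalSpace V] [TopologicalSpace W]
    {A : Type*} [AddCommGroup A] (f : C(V, W)) : Cohomology n W A →+ Cohomology n V A :=
  QuotientAddGroup.map _ _ (cocyclePullback n A f) (by
    intro z hz
    rw [AddSubgroup.mem_addSubgroupOf] at hz
    rw [AddSubgroup.mem_comap, AddSubgroup.mem_addSubgroupOf]
    cases n with
    | zero =>
      have hz' : z.1 = 0 := hz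
      change cochainPullback 0 A f z.1 = 0
      rw [hz', map_zero]
    | succ m =>
      obtain ⟨b, hb⟩ := hz
      refine ⟨cochainPullback m A f b, ?_⟩
      change _ = cochainPullback (m + 1) A f z.1
      rw [coboundary_pullback, hb])

/-! ### Evaluation of a cohomology class on the homotopy group -/

theorem coboundary_genLoop {m : ℕ} {W A : Type*} [TopologicalSpace W] [AddCommGroup A] {w : W}
    (b : Cochain m W A) (p : GenLoop (Fin (m + 1)) W w) : (coboundary m W A b).1 p.1 = 0 := by
  have key : ∀ (i : Fin (m + 1)) (ε : I), ε = 0 ∨ ε = 1 →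
      cubeFace i ε (p.1 : SingularCube (m + 1) W) = ContinuousMap.const _ w := fun i ε hε => by
    ext t
    refine p.2 _ ⟨i, ?_⟩
    simpa using hε
  change ∑ i : Fin (m + 1), (-1 : ℤ) ^ (i : ℕ) •
    (b.1 (cubeFace i 1 p.1) - b.1 (cubeFace i 0 p.1)) = 0
  refine Finset.sum_eq_zero fun i _ => ?_
  rw [key i 1 (Or.inr rfl), key i 0 (Or.inl rfl)]
  simp

theorem cocycle_homotopic {n : ℕ} [NeZero n] {W A : Type*} [TopologicalSpace W] [AddCommGroup A]
    {w : W} (z : Cocycle n W A) (p q : GenLoop (Fin n) W w) (h : GenLoop.Homotopic p q) :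
    z.1.1 p.1 = z.1.1 q.1 := by
  obtain ⟨H⟩ := h
  let τ : SingularCube (n + 1) W :=
    ⟨fun t => H (t 0, fun i => t i.succ), by fun_prop⟩
  have hz : coboundary n W A z.1 = 0 := z.2
  have h0 : (coboundary n W A z.1).1 τ = 0 := by rw [hz]; rfl
  have hside : ∀ (i : Fin n) (ε : I), ε = 0 ∨ ε = 1 →
      z.1.1 (cubeFace i.succ ε τ) = 0 := fun i ε hε => by
    refine z.1.2 _ ?_
    have hc : ∀ t, cubeFace i.succ ε τ t = w := fun t => by
      have hb : (fun j : Fin n => (i.succ.insertNth ε t : Fin (n + 1) → I) j.succ)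
          ∈ Cube.boundary (Fin n) := ⟨i, by simpa using hε⟩
      exact (H.eq_fst _ hb).trans (p.2 _ hb)
    exact ⟨0, fun s t _ => by rw [hc, hc]⟩
  have e0 : cubeFace 0 0 τ = p.1 := by
    ext t
    change H (_, _) = _
    simp
  have e1 : cubeFace 0 1 τ = q.1 := by
    ext t
    change H (_, _) = _
    simp
  change ∑ i : Fin (n + 1), (-1 : ℤ) ^ (i : ℕ) •
    (z.1.1 (cubeFace i 1 τ) - z.1.1 (cubeFace i 0 τ)) = 0 at h0
  rw [Fin.sum_univ_succ, Finset.sum_eq_zero (fun i _ => by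
    rw [hside i 1 (Or.inr rfl), hside i 0 (Or.inl rfl)]; simp), e0, e1] at h0
  simp only [Fin.val_zero, pow_zero, one_smul, add_zero] at h0
  exact (sub_eq_zero.mp h0).symm

/-- The homomorphism `π_n(W, w) → A` induced by a class in `Hⁿ(W; A)`, `n ≥ 1`: the class is
evaluated on the Hurewicz image of the homotopy class, i.e. a representing cocycle is evaluated on
`p : (Iⁿ, ∂Iⁿ) → (W, w)`, which is itself a normalized singular cubical cycle. -/
def evalPi {n : ℕ} [NeZero n] {W A : Type*} [TopologicalSpace W] [AddCommGroup A]
    (c : Cohomology n W A) (w : W) : π_ n W w → A :=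
  Quotient.lift
    (fun p : GenLoop (Fin n) W w =>
      QuotientAddGroup.lift ((Coboundaries n W A).addSubgroupOf (Cocycle n W A))
        ({ toFun := fun z => z.1.1 p.1
           map_zero' := rfl
           map_add' := fun _ _ => rfl } : Cocycle n W A →+ A)
        (fun z hz => by
          rw [AddSubgroup.mem_addSubgroupOf] at hz
          obtain ⟨m, rfl⟩ : ∃ m, n = m + 1 := ⟨n - 1, by have := NeZero.ne n; omega⟩
          obtain ⟨b, hb⟩ := hz
          have hb' : coboundary m W A b = z.1 := hb
          change z.1.1 p.1 = 0
          rw [← hb']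
          exact coboundary_genLoop b p) c)
    (fun p q hpq => by
      induction c using QuotientAddGroup.induction_on with
      | H z => exact cocycle_homotopic z p q hpq)

/-! ### Eilenberg–MacLane spaces, homotopy fibers, fibrations -/

/-- `K` is an Eilenberg–MacLane space `K(A, n)`, `n ≥ 1`, with fundamental class `ι ∈ Hⁿ(K; A)`:
`K` is path connected, its homotopy groups vanish in degrees different from `n`, and `ι` induces
an isomorphism from `π_n` of `K` onto `A`. -/
structure IsEilenbergMacLane (n : ℕ) [NeZero n] {A : Type*} [AddCommGroup A] (K : Type*)
    [TopologicalSpace K] (ι : Cohomology n K A) : Prop where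
  pathConnected : PathConnectedSpace K
  trivial_pi : ∀ (k : ℕ), k ≠ n → ∀ x : K, Subsingleton (π_ k K x)
  bijective_eval : ∀ x : K, Function.Bijective (evalPi ι x)

/-- The homotopy fiber of `g : Y → K` over `k₀`: the pullback of `g` along the evaluation at `1`
of the space of paths in `K` that start at `k₀`. -/
abbrev HomotopyFiber {Y K : Type*} [TopologicalSpace Y] [TopologicalSpace K] (g : C(Y, K))
    (k₀ : K) : Type _ :=
  {e : Y × C(I, K) // e.2 0 = k₀ ∧ e.2 1 = g e.1}

/-- The projection of the homotopy fiber to the source. -/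
def HomotopyFiber.proj {Y K : Type*} [TopologicalSpace Y] [TopologicalSpace K] (g : C(Y, K))
    (k₀ : K) : C(HomotopyFiber g k₀, Y) :=
  ⟨fun e => e.1.1, by fun_prop⟩

/-- `p` is a (Hurewicz) fibration: it has the homotopy lifting property with respect to
all spaces `W`. -/
def IsFibration.{w, u, v} {E : Type u} {B : Type v} [TopologicalSpace E] [TopologicalSpace B]
    (p : C(E, B)) : Prop :=
  ∀ (W : Type w) [TopologicalSpace W] (h : C(W × I, B)) (f : C(W, E)),
    (∀ x, p (f x) = h (x, 0)) →
      ∃ H : C(W × I, E), (∀ x, H (x, 0) = f x) ∧ ∀ y, p (H y) = h y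

/-- `M` has the homotopy type of a CW complex. -/
def HasCWHomotopyType.{u} (M : Type u) [TopologicalSpace M] : Prop :=
  ∃ (Z : Type u) (_ : TopologicalSpace Z) (_ : T2Space Z),
    Nonempty (Topology.CWComplex (Set.univ : Set Z)) ∧
      Nonempty (ContinuousMap.HomotopyEquiv M Z)

end KillPi

end

universe uX uY uK uM uW

noncomputable section

namespace KillPi

open Topology

/-! ### Cubical cochains: algebra -/

section Algebra

variable {V W X A : Type*} [TopologicalSpace V] [TopologicalSpace W] [TopologicalSpace X]
  [AddCommGroup A]

/-! A map from a space M to the homotopy fiber is a map G : M → Y together with a family of paths in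
K from `k₀` to g ∘ G. If M is a k-cube and the data are prescribed on its boundary, such a family is
a (k+1)-cube in K with prescribed boundary, so every lifting problem is an extension problem with an
obstruction in π_k(K). The obstruction vanishes for k ≠ n. For k = n it is measured by a cocycle ζ
representing ι: since ζ is injective on π_n(K), a map on the boundary of an (n+1)-cube extends once
the alternating sum of ζ over the faces is zero (`exists_extension_of_sum_eq_zero`); since ζ is
surjective on π_n(K), a map on an n-cube can be altered in the interior to have any given value
(`exists_map_with_value`).

Homotopy groups: q_* is bijective on π_k when neither k nor k+1 equals n. On π_n it is injective
because π_{n+1}(K) = 0, and λ vanishes on its image (`value_proj_eq_zero`); as λ is injective on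
π_n(Y), π_n of the fiber is zero. In degree n-1 the projections of two loops are homotopic, and the
obstruction to lifting the homotopy is cancelled by altering it so that λ takes the required value,
which is possible as λ is surjective on π_n(Y) (`subsingleton_pi_fiber_pred`). Hence both groups in
degree n-1 are trivial.

Lifts: a null-homotopy of g ∘ f is, up to a path in K, a family of paths and hence a lift. For a CW
complex Z and h : Z → K with h^*ζ = δb, the paths are built over the skeleta. Evaluating ζ on cubes
of paths gives a cochain P with δP = h^*ζ, so P - b is a cocycle. The paths over the (n-1)-cells are
chosen to make P - b a coboundary on the (n-1)-skeleton, and then the obstruction over the n-cells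
is zero (`exists_paths_of_pullback_eq_coboundary`). For n = 1 the coefficient group is trivial, as X
is simply connected, and there is no obstruction at all.

The cohomology this needs is that of a space with cells attached
(`IsCellAttachment.exists_coboundary`). It is derived for cubical cochains from subdivision
(`exists_coboundary_of_small`), Mayer–Vietoris (`exists_coboundary_of_cover`) and the cohomology of
punctured balls, which stand for spheres. -/

theorem alternating_double_sum_eq_zero {n : ℕ} (γ : Fin (n + 2) → Fin (n + 1) → A)
    (h : ∀ i j : Fin (n + 1), i ≤ j → γ i.castSucc j = γ j.succ i) :
    ∑ i : Fin (n + 2), ∑ j : Fin (n + 1), (-1 : ℤ) ^ (i + j : ℕ) • γ i j = 0 := by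
  rw [← Finset.sum_product']
  have hlt : ∀ p : Fin (n + 2) × Fin (n + 1), (p.1 : ℕ) ≤ p.2 → (p.1 : ℕ) < n + 1 :=
    fun p hp => lt_of_le_of_lt hp p.2.2
  -- An index (i, j) with i ≤ j is paired with (j + 1, i): the terms agree by `h` and the parities
  -- of the index sums differ.
  refine Finset.sum_involution
    (fun p _ => if hp : (p.1 : ℕ) ≤ p.2 then (p.2.succ, ⟨p.1, hlt p hp⟩)
      else (p.2.castSucc, p.1.pred (by rintro h; simp [h] at hp))) ?_ ?_ ?_ ?_
  · rintro ⟨i, j⟩ -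
    by_cases hp : (i : ℕ) ≤ j
    · simp only [hp, dif_pos]
      have := h ⟨i, hlt (i, j) hp⟩ j hp
      have e : (⟨i, hlt (i, j) hp⟩ : Fin (n + 1)).castSucc = i := rfl
      rw [e] at this
      rw [this, ← add_smul]
      simp only [Fin.val_succ]
      rw [show (j : ℕ) + 1 + i = (i + j) + 1 by ring, pow_succ]
      simp
    · simp only [hp, dif_neg, not_false_eq_true]
      have hi0 : i ≠ 0 := by rintro rfl; simp at hp
      obtain ⟨i, rfl⟩ := Fin.exists_succ_eq_of_ne_zero hi0
      simp only [Fin.val_succ, not_le, Nat.lt_succ_iff] at hp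
      have := h j i hp
      simp only [Fin.pred_succ]
      rw [this, ← add_smul]
      simp only [Fin.val_succ, Fin.val_castSucc]
      rw [show (i : ℕ) + 1 + j = (j + i) + 1 by ring, pow_succ]
      simp
  · rintro ⟨i, j⟩ - _ heq
    by_cases hp : (i : ℕ) ≤ j
    · simp only [hp, dif_pos, Prod.mk.injEq, Fin.ext_iff, Fin.val_succ] at heq
      omega
    · simp only [hp, dif_neg, not_false_eq_true, Prod.mk.injEq, Fin.ext_iff,
        Fin.val_castSucc] at heq
      omega
  · intro p _
    simp
  · rintro ⟨i, j⟩ -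
    by_cases hp : (i : ℕ) ≤ j
    · have : ¬ ((j : ℕ) + 1 ≤ i) := by omega
      simp only [hp, dif_pos, Fin.val_succ, this, dif_neg, not_false_eq_true, Fin.pred_succ]
      rfl
    · have h2 : (j : ℕ) ≤ (i : ℕ) - 1 := by omega
      simp only [hp, dif_neg, not_false_eq_true, Fin.val_castSucc, Fin.val_pred, h2, dif_pos,
        Fin.succ_pred]

theorem insertNth_insertNth_comm {n : ℕ} {α : Type*} (i j : Fin (n + 1)) (hij : i ≤ j) (a b : α)
    (t : Fin n → α) :
    (i.castSucc.insertNth a (j.insertNth b t : Fin (n + 1) → α) : Fin (n + 2) → α)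
      = j.succ.insertNth b (i.insertNth a t : Fin (n + 1) → α) := by
  have h1 : j.succ.succAbove i = i.castSucc :=
    Fin.succAbove_of_castSucc_lt _ _ (Fin.castSucc_lt_succ_iff.2 hij)
  have h2 : i.castSucc.succAbove j = j.succ :=
    Fin.succAbove_of_le_castSucc _ _ (by simpa using hij)
  have h3 : ∀ q : Fin n, i.castSucc.succAbove (j.succAbove q) = j.succ.succAbove (i.succAbove q) := by
    intro q
    simp only [Fin.succAbove, Fin.lt_def, Fin.le_def] at *
    have := q.2
    split_ifs <;> simp only [Fin.ext_iff, Fin.val_succ, Fin.val_castSucc] at * <;> omega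
  funext l
  rcases eq_or_ne l i.castSucc with rfl | hl
  · rw [Fin.insertNth_apply_same]
    conv_rhs => rw [← h1]
    rw [Fin.insertNth_apply_succAbove, Fin.insertNth_apply_same]
  · obtain ⟨p, rfl⟩ := Fin.exists_succAbove_eq hl
    rw [Fin.insertNth_apply_succAbove]
    rcases eq_or_ne p j with rfl | hp
    · rw [Fin.insertNth_apply_same, h2, Fin.insertNth_apply_same]
    · obtain ⟨q, rfl⟩ := Fin.exists_succAbove_eq hp
      rw [Fin.insertNth_apply_succAbove, h3, Fin.insertNth_apply_succAbove,
        Fin.insertNth_apply_succAbove]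

theorem insertNth_succ_eq_cons {n : ℕ} {α : Type*} (i : Fin (n + 1)) (a : α) (t : Fin (n + 1) → α) :
    (i.succ.insertNth a t : Fin (n + 2) → α)
      = Fin.cons (t 0) (i.insertNth a (fun j => t j.succ) : Fin (n + 1) → α) := by
  conv_lhs => rw [← Fin.cons_self_tail t]
  exact Fin.insertNth_succ_cons i a (t 0) _

theorem coboundary_apply {n : ℕ} (φ : Cochain n W A) (τ : SingularCube (n + 1) W) :
    (coboundary n W A φ).1 τ = ∑ i : Fin (n + 1),
      (-1 : ℤ) ^ (i : ℕ) • (φ.1 (cubeFace i 1 τ) - φ.1 (cubeFace i 0 τ)) := rfl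

/-- The end of the interval with a given name. -/
def endpoint (b : Bool) : I := bif b then 1 else 0

/-- A family of cubes that fits together like the faces of a cube is a cycle. -/
theorem sum_coboundary_family {n : ℕ} (F : Fin (n + 2) → Bool → SingularCube (n + 1) W)
    (hF : ∀ i j : Fin (n + 1), i ≤ j → ∀ ε ε' : Bool,
      cubeFace j (endpoint ε') (F i.castSucc ε) = cubeFace i (endpoint ε) (F j.succ ε'))
    (b : Cochain n W A) :
    ∑ i : Fin (n + 2), (-1 : ℤ) ^ (i : ℕ) •
      ((coboundary n W A b).1 (F i true) - (coboundary n W A b).1 (F i false)) = 0 := by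
  -- Only the agreement of faces of faces is used. The family need not bound a cube, and it does not
  -- in the application to a cube around a puncture.
  rw [← alternating_double_sum_eq_zero (fun i j =>
    (b.1 (cubeFace j (endpoint true) (F i true)) - b.1 (cubeFace j (endpoint false) (F i true)))
      - (b.1 (cubeFace j (endpoint true) (F i false))
        - b.1 (cubeFace j (endpoint false) (F i false))))]
  · refine Finset.sum_congr rfl fun i _ => ?_
    rw [coboundary_apply, coboundary_apply, ← Finset.sum_sub_distrib, Finset.smul_sum]
    refine Finset.sum_congr rfl fun j _ => ?_
    rw [pow_add, mul_smul, ← smul_sub]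
    rfl
  · intro i j hij
    simp only [hF i j hij]
    abel

theorem cubeFace_comm {n : ℕ} (τ : SingularCube (n + 2) W) (i j : Fin (n + 1)) (hij : i ≤ j)
    (ε ε' : I) : cubeFace j ε' (cubeFace i.castSucc ε τ) = cubeFace i ε (cubeFace j.succ ε' τ) := by
  ext t
  exact congrArg τ (insertNth_insertNth_comm i j hij ε ε' t)

theorem coboundary_coboundary {n : ℕ} (b : Cochain n W A) :
    coboundary (n + 1) W A (coboundary n W A b) = 0 := by
  ext τ
  exact sum_coboundary_family (fun i ε => cubeFace i (endpoint ε) τ)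
    (fun i j hij ε ε' => cubeFace_comm τ i j hij _ _) b

theorem cochainPullback_comp {n : ℕ} (f : C(V, W)) (g : C(W, X)) (φ : Cochain n X A) :
    cochainPullback n A f (cochainPullback n A g φ) = cochainPullback n A (g.comp f) φ := rfl

theorem cochainPullback_apply {n : ℕ} (f : C(V, W)) (φ : Cochain n W A) (τ : SingularCube n V) :
    (cochainPullback n A f φ).1 τ = φ.1 (f.comp τ) := rfl

/-- This fails in degree 0, where a cube has no coordinate of which it could be independent. -/
theorem cochain_const {n : ℕ} (φ : Cochain (n + 1) W A) (w : W) :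
    φ.1 (ContinuousMap.const _ w) = 0 :=
  φ.2 _ ⟨0, fun _ _ _ => rfl⟩

/-- Extension of cochains by zero along a map. -/
def extendZero {n : ℕ} (e : C(V, W)) (he : Function.Injective e) (φ : Cochain n V A) :
    Cochain n W A :=
  open Classical in
  ⟨fun τ => if h : ∃ ρ : SingularCube n V, e.comp ρ = τ then φ.1 h.choose else 0, by
    rintro τ ⟨i, hi⟩
    by_cases h : ∃ ρ : SingularCube n V, e.comp ρ = τ
    · simp only [h, dif_pos]
      refine φ.2 _ ⟨i, fun s t hst => he ?_⟩
      have := hi s t hst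
      rwa [← h.choose_spec] at this
    · simp only [h, dif_neg, not_false_eq_true]⟩

/-- Extension by zero splits the restriction of cochains only degreewise: a cube that does not lie
in V can have faces in V, so the extension does not commute with the coboundary. -/
theorem cochainPullback_extendZero {n : ℕ} (e : C(V, W)) (he : Function.Injective e)
    (φ : Cochain n V A) : cochainPullback n A e (extendZero e he φ) = φ := by
  ext τ
  have h : ∃ ρ : SingularCube n V, e.comp ρ = e.comp τ := ⟨τ, rfl⟩
  have h2 : h.choose = τ := by
    ext t
    exact he (DFunLike.congr_fun h.choose_spec t)
  change (extendZero e he φ).1 (e.comp τ) = φ.1 τ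
  simp only [extendZero]
  rw [dif_pos h, h2]

/-- The `(n + 1)`-cube defined by a homotopy parametrized by an `n`-cube; the first coordinate is
the time. -/
def cubeOf {n : ℕ} (F : C((Fin n → I) × I, W)) : SingularCube (n + 1) W :=
  ⟨fun t => F (fun i => t i.succ, t 0), by fun_prop⟩

theorem cubeFace_zero_cubeOf {n : ℕ} (F : C((Fin n → I) × I, W)) (ε : I) (t : Fin n → I) :
    cubeFace 0 ε (cubeOf F) t = F (t, ε) := by
  simp [cubeFace, cubeOf]

theorem cubeFace_succ_cubeOf {n : ℕ} (F : C((Fin (n + 1) → I) × I, W)) (i : Fin (n + 1)) (ε : I) :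
    cubeFace i.succ ε (cubeOf F)
      = cubeOf ⟨fun p => F (i.insertNth ε p.1, p.2), by fun_prop⟩ := by
  ext t
  change F (_, _) = F (_, _)
  simp only [ContinuousMap.coe_mk, insertNth_succ_eq_cons, Fin.cons_succ, Fin.cons_zero]

/-- The prism operator of a homotopy. -/
def prism {n : ℕ} (H : C(V × I, W)) : Cochain (n + 1) W A →+ Cochain n V A where
  toFun φ := ⟨fun τ => φ.1 (cubeOf (H.comp (τ.prodMap (ContinuousMap.id I)))), by
    rintro τ ⟨i, hi⟩
    refine φ.2 _ ⟨i.succ, fun s t hst => ?_⟩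
    change H (τ _, s 0) = H (τ _, t 0)
    rw [hst 0 (Fin.succ_ne_zero i).symm,
      hi _ _ fun j hj => hst j.succ fun h => hj (Fin.succ_injective _ h)]⟩
  map_zero' := rfl
  map_add' _ _ := rfl

theorem prism_apply {n : ℕ} (H : C(V × I, W)) (φ : Cochain (n + 1) W A) (τ : SingularCube n V) :
    (prism H φ).1 τ = φ.1 (cubeOf (H.comp (τ.prodMap (ContinuousMap.id I)))) := rfl

/-- One end of a homotopy. -/
def endMap (H : C(V × I, W)) (ε : I) : C(V, W) := ⟨fun v => H (v, ε), by fun_prop⟩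

theorem coboundary_cubeOf_zero (φ : Cochain 0 W A) (F : C((Fin 0 → I) × I, W)) :
    (coboundary 0 W A φ).1 (cubeOf F) = φ.1 (endMap F 1) - φ.1 (endMap F 0) := by
  rw [coboundary_apply]
  have : ∀ ε, cubeFace 0 ε (cubeOf F) = endMap F ε := fun ε => by
    ext t; exact cubeFace_zero_cubeOf F ε t
  simp [this]

/-- Time is the coordinate of index 0, so the side faces have their index shifted by one; this
produces the minus sign before the sum. -/
theorem coboundary_cubeOf_succ {n : ℕ} (φ : Cochain (n + 1) W A) (F : C((Fin (n + 1) → I) × I, W)) :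
    (coboundary (n + 1) W A φ).1 (cubeOf F) = φ.1 (endMap F 1) - φ.1 (endMap F 0)
      - ∑ i : Fin (n + 1), (-1 : ℤ) ^ (i : ℕ) •
        (φ.1 (cubeOf ⟨fun p => F (i.insertNth 1 p.1, p.2), by fun_prop⟩)
          - φ.1 (cubeOf ⟨fun p => F (i.insertNth 0 p.1, p.2), by fun_prop⟩)) := by
  rw [coboundary_apply]
  have : ∀ ε, cubeFace 0 ε (cubeOf F) = endMap F ε := fun ε => by
    ext t; exact cubeFace_zero_cubeOf F ε t
  rw [Fin.sum_univ_succ, this, this, sub_eq_add_neg _ (∑ i, _), ← Finset.sum_neg_distrib]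
  congr 1
  · simp
  · refine Finset.sum_congr rfl fun i _ => ?_
    rw [cubeFace_succ_cubeOf, cubeFace_succ_cubeOf, Fin.val_succ, pow_succ]
    simp

theorem prism_coboundary_zero (H : C(V × I, W)) (φ : Cochain 0 W A) :
    prism H (coboundary 0 W A φ)
      = cochainPullback 0 A (endMap H 1) φ - cochainPullback 0 A (endMap H 0) φ := by
  ext τ
  rw [prism_apply, coboundary_cubeOf_zero]
  rfl

theorem prism_coboundary_succ {n : ℕ} (H : C(V × I, W)) (φ : Cochain (n + 1) W A) :
    prism H (coboundary (n + 1) W A φ)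
      = cochainPullback (n + 1) A (endMap H 1) φ - cochainPullback (n + 1) A (endMap H 0) φ
        - coboundary n V A (prism H φ) := by
  ext τ
  rw [prism_apply, coboundary_cubeOf_succ]
  rfl

/-- Reduced coboundaries: constants in degree `0`, coboundaries in positive degrees. -/
def IsCob : (n : ℕ) → Cochain n W A → Prop
  | 0, φ => ∃ a, ∀ τ, φ.1 τ = a
  | n + 1, φ => ∃ c : Cochain n W A, coboundary n W A c = φ

theorem IsCob.pullback {n : ℕ} {φ : Cochain n W A} (h : IsCob n φ) (f : C(V, W)) :
    IsCob n (cochainPullback n A f φ) := by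
  cases n with
  | zero =>
    obtain ⟨a, ha⟩ := h
    exact ⟨a, fun τ => ha _⟩
  | succ n =>
    obtain ⟨c, rfl⟩ := h
    exact ⟨cochainPullback n A f c, rfl⟩

theorem IsCob.coboundary_eq_zero {n : ℕ} {φ : Cochain n W A} (h : IsCob n φ) :
    coboundary n W A φ = 0 := by
  cases n with
  | zero =>
    obtain ⟨a, ha⟩ := h
    ext τ
    rw [coboundary_apply]
    simp [ha]
  | succ n =>
    obtain ⟨c, rfl⟩ := h
    exact coboundary_coboundary c

/-- The prism of a cocycle is a primitive of the difference of its restrictions to the two ends. In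
degree 0 there is no prism and the two restrictions coincide. -/
theorem isCob_pullback_of_homotopy {n : ℕ} {ω : Cochain n W A} (hω : coboundary n W A ω = 0)
    (H : C(V × I, W)) (h : IsCob n (cochainPullback n A (endMap H 0) ω)) :
    IsCob n (cochainPullback n A (endMap H 1) ω) := by
  cases n with
  | zero =>
    have := prism_coboundary_zero H ω
    rw [hω, map_zero, eq_comm, sub_eq_zero] at this
    rwa [this]
  | succ n =>
    have := prism_coboundary_succ H ω
    rw [hω, map_zero, eq_comm, sub_eq_zero, sub_eq_iff_eq_add] at this
    obtain ⟨c, hc⟩ := h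
    exact ⟨prism H ω + c, by rw [map_add, hc, this]⟩

theorem isCob_pullback_const {n : ℕ} (ω : Cochain n W A) (w : W) :
    IsCob n (cochainPullback n A (ContinuousMap.const V w) ω) := by
  cases n with
  | zero => exact ⟨ω.1 (ContinuousMap.const _ w), fun τ => rfl⟩
  | succ n =>
    refine ⟨0, ?_⟩
    ext τ
    rw [map_zero]
    exact (cochain_const ω w).symm

theorem isCob_of_contraction {n : ℕ} {ω : Cochain n W A} (hω : coboundary n W A ω = 0)
    (H : C(W × I, W)) (w : W) (h0 : ∀ x, H (x, 0) = w) (h1 : ∀ x, H (x, 1) = x) :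
    IsCob n ω := by
  have e0 : endMap H 0 = ContinuousMap.const W w := by ext x; exact h0 x
  have e1 : endMap H 1 = ContinuousMap.id W := by ext x; exact h1 x
  have := isCob_pullback_of_homotopy hω H (by rw [e0]; exact isCob_pullback_const ω w)
  rw [e1] at this
  exact this

end Algebra

/-! ### Subdivision of cubical cochains -/

section Subdivision

variable {V W X A : Type*} [TopologicalSpace V] [TopologicalSpace W] [TopologicalSpace X]
  [AddCommGroup A]

/-- The map `t ↦ t / 2`. -/
def halfLeft : C(I, I) :=
  ⟨fun t => ⟨t / 2, by have := t.2.1; have := t.2.2; constructor <;> linarith⟩, by fun_prop⟩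

/-- The map `t ↦ (t + 1) / 2`. -/
def halfRight : C(I, I) :=
  ⟨fun t => ⟨(t + 1) / 2, by have := t.2.1; have := t.2.2; constructor <;> linarith⟩, by fun_prop⟩

theorem dist_halfLeft (s t : I) : dist (halfLeft s) (halfLeft t) = 1 / 2 * dist s t := by
  rw [Subtype.dist_eq, Subtype.dist_eq, Real.dist_eq, Real.dist_eq]
  change |(s : ℝ) / 2 - t / 2| = _
  rw [← sub_div, abs_div, abs_two]; ring

theorem dist_halfRight (s t : I) : dist (halfRight s) (halfRight t) = 1 / 2 * dist s t := by
  rw [Subtype.dist_eq, Subtype.dist_eq, Real.dist_eq, Real.dist_eq]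
  change |((s : ℝ) + 1) / 2 - (t + 1) / 2| = _
  rw [← sub_div, abs_div, abs_two, add_sub_add_right_eq_sub]; ring

/-- The product of a self-map of the interval with a map of cubes. -/
def consMap {p n : ℕ} (α : C(I, I)) (ρ : C(Fin p → I, Fin n → I)) :
    C(Fin (p + 1) → I, Fin (n + 1) → I) :=
  ⟨fun t => Fin.cons (α (t 0)) (ρ fun i => t i.succ), by
    refine continuous_pi fun i => ?_
    refine Fin.cases ?_ (fun i => ?_) i
    · simp only [Fin.cons_zero]; fun_prop
    · simp only [Fin.cons_succ]; fun_prop⟩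

/-- The square `(s, t) ↦ s (1 + t) / 2` between an interval and its subdivision, times a cube. -/
def subdivisionPrism (n : ℕ) : C(Fin (n + 2) → I, Fin (n + 1) → I) :=
  ⟨fun t => Fin.cons (⟨t 0 * (1 + t 1) / 2, by
      have h0 := (t 0).2; have h1 := (t 1).2
      constructor <;> nlinarith [h0.1, h0.2, h1.1, h1.2]⟩ : I) fun i => t i.succ.succ, by
    refine continuous_pi fun i => ?_
    refine Fin.cases ?_ (fun i => ?_) i
    · simp only [Fin.cons_zero]; fun_prop
    · simp only [Fin.cons_succ]; fun_prop⟩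

/-- Slices of a cochain on a cube with respect to the first coordinate. -/
def sliceCochain {p n : ℕ} (α : C(I, I)) :
    Cochain (p + 1) (Fin (n + 1) → I) A →+ Cochain p (Fin n → I) A where
  toFun φ := ⟨fun ρ => φ.1 (consMap α ρ), by
    rintro ρ ⟨i, hi⟩
    refine φ.2 _ ⟨i.succ, fun s t hst => ?_⟩
    change (Fin.cons _ _ : Fin (n + 1) → I) = Fin.cons _ _
    rw [hst 0 (Fin.succ_ne_zero i).symm,
      hi _ _ fun j hj => hst j.succ fun h => hj (Fin.succ_injective _ h)]⟩
  map_zero' := rfl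
  map_add' _ _ := rfl

/-- The sum of the values of a cochain on the subcubes of the subdivided standard cube. -/
def subdivisionSum : (n : ℕ) → Cochain n (Fin n → I) A →+ A
  | 0 => ⟨⟨fun φ => φ.1 (ContinuousMap.id _), rfl⟩, fun _ _ => rfl⟩
  | n + 1 => (subdivisionSum n).comp (sliceCochain halfLeft)
      + (subdivisionSum n).comp (sliceCochain halfRight)

/-- The sum of the values of a cochain on the cubes of a chain homotopy between the standard cube
and its subdivision. -/
def subdivisionHomotopySum : (n : ℕ) → Cochain (n + 1) (Fin n → I) A →+ A
  | 0 => 0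
  -- Product rule for the subdivision S of an interval times a cube: the homotopy is D ⊗ 1 + S ⊗ D,
  -- with a sign for moving D past the interval.
  | n + 1 => ⟨⟨fun φ => φ.1 (subdivisionPrism n), rfl⟩, fun _ _ => rfl⟩
      - (subdivisionHomotopySum n).comp (sliceCochain halfLeft)
      - (subdivisionHomotopySum n).comp (sliceCochain halfRight)

theorem subdivisionSum_succ {n : ℕ} (φ : Cochain (n + 1) (Fin (n + 1) → I) A) :
    subdivisionSum (n + 1) φ = subdivisionSum n (sliceCochain halfLeft φ)
      + subdivisionSum n (sliceCochain halfRight φ) := rfl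

theorem subdivisionHomotopySum_succ {n : ℕ} (φ : Cochain (n + 2) (Fin (n + 1) → I) A) :
    subdivisionHomotopySum (n + 1) φ = φ.1 (subdivisionPrism n)
      - subdivisionHomotopySum n (sliceCochain halfLeft φ)
      - subdivisionHomotopySum n (sliceCochain halfRight φ) := rfl

/-- A map of cubes is degenerate off the coordinate `i` of the target if it becomes degenerate
after forgetting that coordinate. -/
def IsDegenerateOff {p n : ℕ} (i : Fin n) (ρ : C(Fin p → I, Fin n → I)) : Prop :=
  ∃ j : Fin p, ∀ s t : Fin p → I, (∀ k, k ≠ j → s k = t k) → ∀ l, l ≠ i → ρ s l = ρ t l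

theorem isDegenerateOff_consMap_zero {p n : ℕ} (α : C(I, I)) (ρ : C(Fin p → I, Fin n → I)) :
    IsDegenerateOff 0 (consMap α ρ) := by
  refine ⟨0, fun s t hst l hl => ?_⟩
  obtain ⟨l, rfl⟩ := Fin.exists_succ_eq_of_ne_zero hl
  exact congrFun (congrArg ρ (funext fun k => hst _ (Fin.succ_ne_zero k))) l

theorem IsDegenerateOff.consMap_succ {p n : ℕ} (α : C(I, I)) {ρ : C(Fin p → I, Fin n → I)}
    {i : Fin n} (h : IsDegenerateOff i ρ) : IsDegenerateOff i.succ (consMap α ρ) := by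
  obtain ⟨j, hj⟩ := h
  refine ⟨j.succ, fun s t hst l hl => ?_⟩
  revert hl
  refine Fin.cases (fun _ => ?_) (fun l hl => ?_) l
  · change α (s 0) = α (t 0)
    rw [hst 0 (Fin.succ_ne_zero j).symm]
  · exact hj _ _ (fun k hk => hst k.succ fun h => hk (Fin.succ_injective _ h)) l
      fun h => hl (congrArg _ h)

/-- This keeps the subdivision of a cochain normalized: if τ does not depend on the coordinate i and
ρ is degenerate off i, then τ ∘ ρ is degenerate. -/
theorem subdivisionSum_eq_zero_of_degenerate {n : ℕ} (i : Fin n) (φ : Cochain n (Fin n → I) A)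
    (h : ∀ ρ, IsDegenerateOff i ρ → φ.1 ρ = 0) : subdivisionSum n φ = 0 := by
  induction n with
  | zero => exact i.elim0
  | succ n ih =>
    rw [subdivisionSum_succ]
    revert h
    refine Fin.cases (fun h => ?_) (fun i h => ?_) i
    · have : ∀ α, sliceCochain α φ = 0 := fun α => by
        ext ρ; exact h _ (isDegenerateOff_consMap_zero α ρ)
      rw [this, this, map_zero, add_zero]
    · rw [ih i _ fun ρ hρ => h _ (hρ.consMap_succ _), ih i _ fun ρ hρ => h _ (hρ.consMap_succ _),
        add_zero]

theorem subdivisionHomotopySum_eq_zero_of_degenerate {n : ℕ} (i : Fin n)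
    (φ : Cochain (n + 1) (Fin n → I) A)
    (h : ∀ ρ, IsDegenerateOff i ρ → φ.1 ρ = 0) : subdivisionHomotopySum n φ = 0 := by
  induction n with
  | zero => exact i.elim0
  | succ n ih =>
    rw [subdivisionHomotopySum_succ]
    have hp : IsDegenerateOff i (subdivisionPrism n) := by
      refine Fin.cases ⟨0, fun s t hst l hl => ?_⟩ (fun i => ⟨i.succ.succ, fun s t hst l hl => ?_⟩) i
      · obtain ⟨l, rfl⟩ := Fin.exists_succ_eq_of_ne_zero hl
        exact hst _ (Fin.succ_ne_zero _)
      · revert hl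
        refine Fin.cases (fun _ => ?_) (fun l hl => ?_) l
        · have h0 : s 0 = t 0 := hst 0 (Fin.succ_ne_zero _).symm
          have h1 : s 1 = t 1 := hst 1 (fun h => by
            rw [← Fin.succ_zero_eq_one] at h
            exact Fin.succ_ne_zero _ (Fin.succ_injective _ h).symm)
          simp [subdivisionPrism, h0, h1]
        · exact hst _ fun h => hl (by rw [Fin.succ_injective _ h])
    rw [h _ hp]
    revert h
    refine Fin.cases (fun h => ?_) (fun i h => ?_) i
    · have : ∀ α, sliceCochain α φ = 0 := fun α => by
        ext ρ; exact h _ (isDegenerateOff_consMap_zero α ρ)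
      rw [this, this, map_zero, sub_zero, sub_zero]
    · rw [ih i _ fun ρ hρ => h _ (hρ.consMap_succ _), ih i _ fun ρ hρ => h _ (hρ.consMap_succ _),
        sub_zero, sub_zero]

theorem dist_consMap_le {p n : ℕ} {α : C(I, I)} {ρ : C(Fin p → I, Fin n → I)} {c : ℝ} (hc : 0 ≤ c)
    (hα : ∀ s t, dist (α s) (α t) ≤ c * dist s t) (hρ : ∀ s t, dist (ρ s) (ρ t) ≤ c * dist s t)
    (s t : Fin (p + 1) → I) : dist (consMap α ρ s) (consMap α ρ t) ≤ c * dist s t := by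
  rw [dist_pi_le_iff (by positivity)]
  intro i
  refine Fin.cases ?_ (fun i => ?_) i
  · exact (hα _ _).trans (mul_le_mul_of_nonneg_left (dist_le_pi_dist s t 0) hc)
  · refine (dist_le_pi_dist (ρ fun i => s i.succ) (ρ fun i => t i.succ) i).trans ?_
    refine (hρ _ _).trans (mul_le_mul_of_nonneg_left ?_ hc)
    rw [dist_pi_le_iff dist_nonneg]
    exact fun j => dist_le_pi_dist s t j.succ

theorem subdivisionSum_eq_zero_of_small {n : ℕ} (φ : Cochain n (Fin n → I) A)
    (h : ∀ ρ : C(Fin n → I, Fin n → I), (∀ s t, dist (ρ s) (ρ t) ≤ 1 / 2 * dist s t) → φ.1 ρ = 0) :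
    subdivisionSum n φ = 0 := by
  induction n with
  | zero =>
    refine h _ fun s t => ?_
    rw [Subsingleton.elim s t]; simp
  | succ n ih =>
    rw [subdivisionSum_succ,
      ih _ fun ρ hρ => h _ (dist_consMap_le (by norm_num) (fun s t => (dist_halfLeft s t).le) hρ),
      ih _ fun ρ hρ => h _ (dist_consMap_le (by norm_num) (fun s t => (dist_halfRight s t).le) hρ),
      add_zero]

theorem sliceCochain_coboundary {p n : ℕ} (α : C(I, I))
    (φ : Cochain (p + 1) (Fin (n + 1) → I) A) :
    sliceCochain α (coboundary (p + 1) _ A φ)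
      = cochainPullback (p + 1) A (cubeFace 0 (α 1) (ContinuousMap.id (Fin (n + 1) → I))) φ
        - cochainPullback (p + 1) A (cubeFace 0 (α 0) (ContinuousMap.id (Fin (n + 1) → I))) φ
        - coboundary p _ A (sliceCochain α φ) := by
  have h0 : ∀ (ρ : C(Fin (p + 1) → I, Fin n → I)) (ε : I), cubeFace 0 ε (consMap α ρ)
      = (cubeFace 0 (α ε) (ContinuousMap.id (Fin (n + 1) → I))).comp ρ := by
    intro ρ ε
    ext t : 1
    simp [cubeFace, consMap]
  have hs : ∀ (ρ : C(Fin (p + 1) → I, Fin n → I)) (i : Fin (p + 1)) (ε : I),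
      cubeFace i.succ ε (consMap α ρ) = consMap α (cubeFace i ε ρ) := by
    intro ρ i ε
    ext t : 1
    change (Fin.cons (α _) (ρ _) : Fin (n + 1) → I) = Fin.cons (α _) (ρ _)
    simp only [ContinuousMap.coe_mk, insertNth_succ_eq_cons, Fin.cons_succ, Fin.cons_zero]
  ext ρ
  change (coboundary (p + 1) _ A φ).1 (consMap α ρ) = _
  rw [coboundary_apply, Fin.sum_univ_succ, h0, h0]
  simp only [AddSubgroup.coe_sub, Pi.sub_apply]
  rw [coboundary_apply, sub_eq_add_neg _ (∑ i, _), ← Finset.sum_neg_distrib]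
  congr 1
  · simp [cochainPullback_apply]
  · refine Finset.sum_congr rfl fun i _ => ?_
    rw [hs, hs, Fin.val_succ, pow_succ]
    simp [sliceCochain]

theorem sliceCochain_cubeFace {q n : ℕ} (α : C(I, I)) (i : Fin (n + 1)) (ε : I)
    (φ : Cochain (q + 1) (Fin (n + 2) → I) A) :
    sliceCochain α
      (cochainPullback (q + 1) A (cubeFace i.succ ε (ContinuousMap.id (Fin (n + 2) → I))) φ)
      = cochainPullback q A (cubeFace i ε (ContinuousMap.id (Fin (n + 1) → I)))
        (sliceCochain α φ) := by
  ext ρ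
  refine congrArg φ.1 (ContinuousMap.ext fun t => ?_)
  change i.succ.insertNth ε (Fin.cons (α (t 0)) (ρ fun i => t i.succ) : Fin (n + 1) → I)
    = (Fin.cons (α (t 0)) (i.insertNth ε (ρ fun i => t i.succ) : Fin (n + 1) → I)
      : Fin (n + 2) → I)
  rw [Fin.insertNth_succ_cons]

/-- The boundary of the standard cube, filled by the chain homotopies of its faces. -/
def subdivisionBoundarySum : (n : ℕ) → Cochain n (Fin n → I) A →+ A
  | 0 => 0
  | n + 1 => ∑ i : Fin (n + 1), (-1 : ℤ) ^ (i : ℕ) •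
      ((subdivisionHomotopySum n).comp
          (cochainPullback (n + 1) A (cubeFace i 1 (ContinuousMap.id (Fin (n + 1) → I))))
        - (subdivisionHomotopySum n).comp
          (cochainPullback (n + 1) A (cubeFace i 0 (ContinuousMap.id (Fin (n + 1) → I)))))

theorem subdivisionBoundarySum_succ {n : ℕ} (φ : Cochain (n + 1) (Fin (n + 1) → I) A) :
    subdivisionBoundarySum (n + 1) φ = ∑ i : Fin (n + 1), (-1 : ℤ) ^ (i : ℕ) •
      (subdivisionHomotopySum n
          (cochainPullback (n + 1) A (cubeFace i 1 (ContinuousMap.id (Fin (n + 1) → I))) φ)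
        - subdivisionHomotopySum n
          (cochainPullback (n + 1) A (cubeFace i 0 (ContinuousMap.id (Fin (n + 1) → I))) φ)) := by
  simp [subdivisionBoundarySum, AddMonoidHom.finsetSum_apply]

/-- In the first two directions the square (s, t) ↦ s (1 + t) / 2 has as faces the right half (s =
1), a point, hence a degenerate cube (s = 0), the whole interval (t = 1) and the left half (t = 0).
-/
theorem coboundary_subdivisionPrism {n : ℕ} (φ : Cochain (n + 1) (Fin (n + 1) → I) A) :
    (coboundary (n + 1) _ A φ).1 (subdivisionPrism n)
      = φ.1 (consMap halfLeft (ContinuousMap.id _)) + φ.1 (consMap halfRight (ContinuousMap.id _))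
        - φ.1 (ContinuousMap.id _)
        + ∑ i : Fin n, (-1 : ℤ) ^ (i : ℕ) • (φ.1 (cubeFace i.succ.succ 1 (subdivisionPrism n))
          - φ.1 (cubeFace i.succ.succ 0 (subdivisionPrism n))) := by
  rw [coboundary_apply, Fin.sum_univ_succ, Fin.sum_univ_succ]
  have h1 : cubeFace 0 1 (subdivisionPrism n) = consMap halfRight (ContinuousMap.id _) := by
    ext t : 1
    simp only [cubeFace, subdivisionPrism, consMap, halfRight, ContinuousMap.comp_apply,
      ContinuousMap.coe_mk, ContinuousMap.id_apply]
    congr 1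
    ext
    change (Fin.insertNth (α := fun _ => I) 0 1 t 0 : I) * (1 + (Fin.insertNth (α := fun _ => I) 0 1 t (Fin.succ 0) : I).1) / 2 = _
    rw [Fin.insertNth_zero', Fin.cons_zero, Fin.cons_succ]
    simp only [Set.Icc.coe_one]
    ring
  have h0 : IsDegenerate (n := n + 1) (cubeFace 0 0 (subdivisionPrism n)) := by
    refine ⟨0, fun s t hst => ?_⟩
    funext l
    refine Fin.cases ?_ (fun l => ?_) l
    · simp [cubeFace, subdivisionPrism]
    · simp only [cubeFace, subdivisionPrism, ContinuousMap.comp_apply,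
        ContinuousMap.coe_mk, Fin.cons_succ, Fin.insertNth_zero']
      exact hst _ (Fin.succ_ne_zero _)
  have h11 : cubeFace (Fin.succ 0) 1 (subdivisionPrism n) = ContinuousMap.id _ := by
    ext t : 1
    funext l
    refine Fin.cases ?_ (fun l => ?_) l
    · ext
      change (Fin.insertNth (α := fun _ => I) (Fin.succ 0) 1 t 0 : I) *
        (1 + (Fin.insertNth (α := fun _ => I) (Fin.succ 0) 1 t (Fin.succ 0) : I).1) / 2 = t 0
      rw [insertNth_succ_eq_cons, Fin.insertNth_zero', Fin.cons_zero, Fin.cons_succ, Fin.cons_zero]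
      simp only [Set.Icc.coe_one]
      ring
    · change Fin.insertNth (α := fun _ => I) (Fin.succ 0) 1 t l.succ.succ = t l.succ
      rw [insertNth_succ_eq_cons, Fin.insertNth_zero', Fin.cons_succ, Fin.cons_succ]
  have h10 : cubeFace (Fin.succ 0) 0 (subdivisionPrism n)
      = consMap halfLeft (ContinuousMap.id _) := by
    ext t : 1
    funext l
    refine Fin.cases ?_ (fun l => ?_) l
    · ext
      change (Fin.insertNth (α := fun _ => I) (Fin.succ 0) 0 t 0 : I) *
        (1 + (Fin.insertNth (α := fun _ => I) (Fin.succ 0) 0 t (Fin.succ 0) : I).1) / 2 = (t 0 : ℝ) / 2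
      rw [insertNth_succ_eq_cons, Fin.insertNth_zero', Fin.cons_zero, Fin.cons_succ, Fin.cons_zero]
      simp
    · change Fin.insertNth (α := fun _ => I) (Fin.succ 0) 0 t l.succ.succ = t l.succ
      rw [insertNth_succ_eq_cons, Fin.insertNth_zero', Fin.cons_succ, Fin.cons_succ]
  rw [h1, h11, h10, φ.2 _ h0]
  simp only [Fin.val_zero, pow_zero, one_smul, Fin.val_succ, zero_add, neg_smul,
    pow_succ, mul_neg, mul_one, neg_neg]
  abel

/-- The universal case, on the identity cube, of the formula Dδ + δD = S - 1;
`subdivisionBoundarySum` is the term δD. By naturality it gives the formula on every singular cube.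
The induction splits off the first coordinate. -/
theorem subdivisionHomotopySum_coboundary {n : ℕ} (φ : Cochain n (Fin n → I) A) :
    subdivisionHomotopySum n (coboundary n _ A φ) + subdivisionBoundarySum n φ
      = subdivisionSum n φ - φ.1 (ContinuousMap.id _) := by
  induction n with
  | zero =>
    simp [subdivisionHomotopySum, subdivisionBoundarySum, subdivisionSum]
  | succ n ih =>
    have hS : ∀ α, subdivisionHomotopySum n (coboundary n _ A (sliceCochain α φ))
        = subdivisionSum n (sliceCochain α φ) - φ.1 (consMap α (ContinuousMap.id _))
          - subdivisionBoundarySum n (sliceCochain α φ) := fun α => by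
      rw [eq_sub_iff_add_eq, ih]; rfl
    have e0 : halfLeft 0 = 0 := by ext; simp [halfLeft]
    have e1 : halfRight 1 = 1 := by ext; simp [halfRight]
    have e2 : halfLeft 1 = halfRight 0 := by ext; simp [halfLeft, halfRight]
    have hB : subdivisionBoundarySum (n + 1) φ
        = subdivisionHomotopySum n
            (cochainPullback (n + 1) A (cubeFace 0 1 (ContinuousMap.id (Fin (n + 1) → I))) φ)
          - subdivisionHomotopySum n
            (cochainPullback (n + 1) A (cubeFace 0 0 (ContinuousMap.id (Fin (n + 1) → I))) φ)
          - ∑ i : Fin n, (-1 : ℤ) ^ (i : ℕ) • (φ.1 (cubeFace i.succ.succ 1 (subdivisionPrism n))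
            - φ.1 (cubeFace i.succ.succ 0 (subdivisionPrism n)))
          + subdivisionBoundarySum n (sliceCochain halfLeft φ)
          + subdivisionBoundarySum n (sliceCochain halfRight φ) := by
      rw [subdivisionBoundarySum_succ, Fin.sum_univ_succ]
      cases n with
      | zero => simp [subdivisionBoundarySum]
      | succ q =>
        have hP : ∀ (i : Fin (q + 1)) (ε : I),
            (cochainPullback (q + 2) A (cubeFace i.succ ε (ContinuousMap.id (Fin (q + 2) → I)))
              φ).1 (subdivisionPrism q)
              = φ.1 (cubeFace i.succ.succ ε (subdivisionPrism (q + 1))) := by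
          intro i ε
          rw [cochainPullback_apply]
          refine congrArg φ.1 (ContinuousMap.ext fun t => ?_)
          change (i.succ.insertNth ε (Fin.cons _ fun j => t j.succ.succ : Fin (q + 1) → I)
              : Fin (q + 2) → I) = Fin.cons _ fun j =>
                (i.succ.succ.insertNth ε t : Fin (q + 3) → I) j.succ.succ
          simp only [insertNth_succ_eq_cons, Fin.cons_succ, Fin.cons_zero]
          rfl
        have key : ∑ i : Fin (q + 1), (-1 : ℤ) ^ (i.succ : ℕ) •
            (subdivisionHomotopySum (q + 1) (cochainPullback (q + 2) A
                (cubeFace i.succ 1 (ContinuousMap.id (Fin (q + 2) → I))) φ)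
              - subdivisionHomotopySum (q + 1) (cochainPullback (q + 2) A
                (cubeFace i.succ 0 (ContinuousMap.id (Fin (q + 2) → I))) φ))
            = subdivisionBoundarySum (q + 1) (sliceCochain halfLeft φ)
              + subdivisionBoundarySum (q + 1) (sliceCochain halfRight φ)
              - ∑ i : Fin (q + 1), (-1 : ℤ) ^ (i : ℕ) •
                (φ.1 (cubeFace i.succ.succ 1 (subdivisionPrism (q + 1)))
                  - φ.1 (cubeFace i.succ.succ 0 (subdivisionPrism (q + 1)))) := by
          rw [subdivisionBoundarySum_succ, subdivisionBoundarySum_succ, ← Finset.sum_add_distrib,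
            ← Finset.sum_sub_distrib]
          refine Finset.sum_congr rfl fun i _ => ?_
          rw [subdivisionHomotopySum_succ, subdivisionHomotopySum_succ, hP, hP,
            sliceCochain_cubeFace, sliceCochain_cubeFace, sliceCochain_cubeFace,
            sliceCochain_cubeFace, Fin.val_succ, pow_succ, mul_neg_one, neg_smul, ← smul_neg,
            ← smul_add, ← smul_sub]
          congr 1
          abel
        rw [key]
        simp only [Fin.val_zero, pow_zero, one_smul]
        abel
    rw [subdivisionHomotopySum_succ, subdivisionSum_succ, sliceCochain_coboundary,
      sliceCochain_coboundary, coboundary_subdivisionPrism, hB, e0, e1, e2]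
    simp only [map_sub]
    rw [hS, hS]
    abel

end Subdivision

/-! ### Subdivision of cochains, small cubes and Mayer–Vietoris -/

section SmallCubes

variable {U W X A : Type*} [TopologicalSpace U] [TopologicalSpace W] [TopologicalSpace X]
  [AddCommGroup A]

/-- The subdivision operator on cochains. -/
def subdivide {n : ℕ} : Cochain n W A →+ Cochain n W A where
  toFun φ := ⟨fun τ => subdivisionSum n (cochainPullback n A τ φ), by
    rintro τ ⟨i, hi⟩
    refine subdivisionSum_eq_zero_of_degenerate i _ ?_
    rintro ρ ⟨j, hj⟩
    exact φ.2 _ ⟨j, fun s t hst => hi _ _ fun k hk => hj s t hst k hk⟩⟩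
  map_zero' := by ext τ; exact map_zero _
  map_add' φ ψ := by
    ext τ
    exact map_add (subdivisionSum n) (cochainPullback n A τ φ) (cochainPullback n A τ ψ)

/-- The cochain homotopy between the subdivision operator and the identity. -/
def subdivisionHomotopy {n : ℕ} : Cochain (n + 1) W A →+ Cochain n W A where
  toFun φ := ⟨fun τ => subdivisionHomotopySum n (cochainPullback (n + 1) A τ φ), by
    rintro τ ⟨i, hi⟩
    refine subdivisionHomotopySum_eq_zero_of_degenerate i _ ?_
    rintro ρ ⟨j, hj⟩
    exact φ.2 _ ⟨j, fun s t hst => hi _ _ fun k hk => hj s t hst k hk⟩⟩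
  map_zero' := by ext τ; exact map_zero _
  map_add' φ ψ := by
    ext τ
    exact map_add (subdivisionHomotopySum n) (cochainPullback (n + 1) A τ φ)
      (cochainPullback (n + 1) A τ ψ)

theorem subdivisionHomotopy_coboundary_zero (φ : Cochain 0 W A) :
    subdivisionHomotopy (coboundary 0 W A φ) = subdivide φ - φ := by
  ext τ
  have := subdivisionHomotopySum_coboundary (cochainPullback 0 A τ φ)
  rwa [show subdivisionBoundarySum 0 (cochainPullback 0 A τ φ) = 0 from rfl, add_zero] at this

theorem subdivisionHomotopy_coboundary_succ {n : ℕ} (φ : Cochain (n + 1) W A) :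
    subdivisionHomotopy (coboundary (n + 1) W A φ) + coboundary n W A (subdivisionHomotopy φ)
      = subdivide φ - φ := by
  ext τ
  have := subdivisionHomotopySum_coboundary (cochainPullback (n + 1) A τ φ)
  rw [subdivisionBoundarySum_succ] at this
  exact this

/-- A formal consequence of the homotopy formula for φ and for δφ together with δδ = 0, which avoids
matching the faces of the subcubes. -/
theorem coboundary_subdivide {n : ℕ} (φ : Cochain n W A) :
    coboundary n W A (subdivide φ) = subdivide (coboundary n W A φ) := by
  have h2 := subdivisionHomotopy_coboundary_succ (coboundary n W A φ)
  rw [coboundary_coboundary, map_zero, zero_add] at h2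
  have h1 : coboundary n W A (subdivisionHomotopy (coboundary n W A φ))
      = coboundary n W A (subdivide φ) - coboundary n W A φ := by
    rw [← map_sub]
    cases n with
    | zero => rw [subdivisionHomotopy_coboundary_zero]
    | succ n => rw [← subdivisionHomotopy_coboundary_succ, map_add, coboundary_coboundary, add_zero]
  rw [h1] at h2
  exact sub_left_injective h2

theorem coboundary_subdivide_iterate {n : ℕ} (φ : Cochain n W A) (j : ℕ) :
    coboundary n W A (subdivide^[j] φ) = subdivide^[j] (coboundary n W A φ) := by
  induction j with
  | zero => rfl
  | succ j ih =>
    rw [Function.iterate_succ_apply', Function.iterate_succ_apply', coboundary_subdivide, ih]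

theorem subdivide_iterate_eq_zero {n : ℕ} (φ : Cochain n W A) (τ : SingularCube n W) (j : ℕ)
    (h : ∀ ρ : C(Fin n → I, Fin n → I), (∀ s t, dist (ρ s) (ρ t) ≤ (1 / 2) ^ j * dist s t) →
      φ.1 (τ.comp ρ) = 0) : (subdivide^[j] φ).1 τ = 0 := by
  induction j generalizing φ with
  | zero => exact h (ContinuousMap.id _) fun s t => by simp
  | succ j ih =>
    rw [Function.iterate_succ_apply]
    refine ih _ fun ρ hρ => ?_
    refine subdivisionSum_eq_zero_of_small _ fun ρ' hρ' => h (ρ.comp ρ') fun s t => ?_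
    refine (hρ _ _).trans ?_
    rw [pow_succ, mul_assoc]
    exact mul_le_mul_of_nonneg_left (hρ' s t) (by positivity)

/-- A cocycle that vanishes on the cubes that are small of the order of an open cover is a
coboundary. -/
theorem exists_coboundary_of_small {n : ℕ} (𝒰 : Set (Set W)) (ho : ∀ S ∈ 𝒰, IsOpen S)
    (hc : ∀ w, ∃ S ∈ 𝒰, w ∈ S) (ω : Cochain (n + 1) W A) (hω : coboundary (n + 1) W A ω = 0)
    (hs : ∀ τ : SingularCube (n + 1) W, (∃ S ∈ 𝒰, ∀ t, τ t ∈ S) → ω.1 τ = 0) :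
    ∃ c, coboundary n W A c = ω := by
  -- `Good N τ`: sets of diameter at most 2^(-N) are mapped by τ into one member of the cover. Every
  -- cube is good for some N by Lebesgue's lemma, and an N that is good for a cube is good for its
  -- faces.
  let Good {k : ℕ} (N : ℕ) (τ : SingularCube k W) : Prop :=
    ∀ T : Set (Fin k → I), (∀ s ∈ T, ∀ t ∈ T, dist s t ≤ (1 / 2 : ℝ) ^ N) → T.Nonempty →
      ∃ S ∈ 𝒰, ∀ t ∈ T, τ t ∈ S
  have good_exists : ∀ {k : ℕ} (τ : SingularCube k W), ∃ N, Good N τ := by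
    intro k τ
    obtain ⟨δ, hδ, h⟩ := lebesgue_number_lemma_of_metric_sUnion (s := (Set.univ : Set (Fin k → I)))
      (c := (fun S => τ ⁻¹' S) '' 𝒰) isCompact_univ
      (by rintro _ ⟨S, hS, rfl⟩; exact (ho S hS).preimage τ.continuous)
      (by
        intro t _
        obtain ⟨S, hS, ht⟩ := hc (τ t)
        exact ⟨_, ⟨S, hS, rfl⟩, ht⟩)
    obtain ⟨N, hN⟩ := exists_pow_lt_of_lt_one hδ (show (1 / 2 : ℝ) < 1 by norm_num)
    refine ⟨N, fun T hT ⟨s, hs⟩ => ?_⟩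
    obtain ⟨_, ⟨S, hS, rfl⟩, hb⟩ := h s (Set.mem_univ _)
    exact ⟨S, hS, fun t ht => hb (Metric.mem_ball.2 (lt_of_le_of_lt (hT t ht s hs) hN))⟩
  have good_face : ∀ {k : ℕ} (τ : SingularCube (k + 1) W) (N : ℕ) (i : Fin (k + 1)) (ε : I),
      Good N τ → Good N (cubeFace i ε τ) := by
    intro k τ N i ε h T hT hne
    obtain ⟨S, hS, hb⟩ := h ((fun t => (i.insertNth ε t : Fin (k + 1) → I)) '' T) (by
      rintro _ ⟨s, hs, rfl⟩ _ ⟨t, ht, rfl⟩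
      refine le_trans ?_ (hT s hs t ht)
      rw [dist_pi_le_iff dist_nonneg]
      intro j
      rcases eq_or_ne j i with rfl | hj
      · simp
      · obtain ⟨l, rfl⟩ := Fin.exists_succAbove_eq hj
        simp only [Fin.insertNth_apply_succAbove]
        exact dist_le_pi_dist s t l) (hne.image _)
    exact ⟨S, hS, fun t ht => hb _ ⟨t, ht, rfl⟩⟩
  have vanish : ∀ {k : ℕ} (φ : Cochain k W A) (τ : SingularCube k W) (N j : ℕ), Good N τ → N ≤ j →
      (∀ τ : SingularCube k W, (∃ S ∈ 𝒰, ∀ t, τ t ∈ S) → φ.1 τ = 0) →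
      (subdivide^[j] φ).1 τ = 0 := by
    intro k φ τ N j hτ hj hφ
    refine subdivide_iterate_eq_zero φ τ j fun ρ hρ => hφ _ ?_
    obtain ⟨S, hS, hb⟩ := hτ (Set.range ρ) (by
      rintro _ ⟨s, rfl⟩ _ ⟨t, rfl⟩
      have h1 : dist s t ≤ 1 := by
        rw [dist_pi_le_iff zero_le_one]
        intro i
        rw [Subtype.dist_eq, Real.dist_eq, abs_le]
        have := (s i).2; have := (t i).2
        constructor <;> linarith [(s i).2.1, (s i).2.2, (t i).2.1, (t i).2.2]
      calc dist (ρ s) (ρ t) ≤ (1 / 2) ^ j * dist s t := hρ s t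
        _ ≤ (1 / 2) ^ j * 1 := by gcongr
        _ ≤ (1 / 2) ^ N := by
          rw [mul_one]; exact pow_le_pow_of_le_one (by norm_num) (by norm_num) hj)
      (Set.range_nonempty ρ)
    exact ⟨S, hS, fun t => hb _ ⟨t, rfl⟩⟩
  set ψ : Cochain n W A := subdivisionHomotopy ω with hψdef
  have hψ : ∀ τ : SingularCube n W, (∃ S ∈ 𝒰, ∀ t, τ t ∈ S) → ψ.1 τ = 0 := by
    rintro τ ⟨S, hS, hτ⟩
    have : cochainPullback (n + 1) A τ ω = 0 := by
      ext ρ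
      exact hs _ ⟨S, hS, fun t => hτ _⟩
    change subdivisionHomotopySum n (cochainPullback (n + 1) A τ ω) = 0
    rw [this, map_zero]
  have hδψ : coboundary n W A ψ = subdivide ω - ω := by
    have := subdivisionHomotopy_coboundary_succ ω
    rwa [hω, map_zero, zero_add] at this
  -- The sum of all S^j D ω is finite on each cube because D ω vanishes on small cubes. Its
  -- coboundary telescopes to S^N ω - ω, which is -ω on a cube that is good for N; so -c is the
  -- primitive.
  let c : Cochain n W A := ⟨fun τ => ∑ᶠ j, (subdivide^[j] ψ).1 τ, fun τ hτ => by
    simp only [(subdivide^[_] ψ).2 τ hτ, finsum_zero]⟩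
  have hcN : ∀ (τ : SingularCube n W) (N : ℕ), Good N τ →
      c.1 τ = ∑ j ∈ Finset.range N, (subdivide^[j] ψ).1 τ := by
    intro τ N hτ
    refine finsum_eq_sum_of_support_subset _ fun j hj => ?_
    by_contra hjN
    simp only [Finset.coe_range, Set.mem_Iio, not_lt] at hjN
    exact hj (vanish ψ τ N j hτ hjN hψ)
  have htel : ∀ N, coboundary n W A (∑ j ∈ Finset.range N, subdivide^[j] ψ)
      = subdivide^[N] ω - ω := by
    intro N
    rw [map_sum, ← show _ = subdivide^[N] ω - ω from
      Finset.sum_range_sub (fun j => subdivide^[j] ω) N]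
    refine Finset.sum_congr rfl fun j _ => ?_
    rw [coboundary_subdivide_iterate, hδψ, Function.iterate_succ_apply, iterate_map_sub]
  refine ⟨-c, ?_⟩
  ext τ
  obtain ⟨N, hN⟩ := good_exists τ
  have h1 := congrArg (fun φ => φ.1 τ) (htel N)
  simp only [AddSubgroup.coe_sub, Pi.sub_apply] at h1
  rw [vanish ω τ N N hN le_rfl hs, zero_sub] at h1
  rw [map_neg]
  simp only [AddSubgroup.coe_neg, Pi.neg_apply]
  rw [neg_eq_iff_eq_neg, ← h1, coboundary_apply, coboundary_apply]
  refine Finset.sum_congr rfl fun i _ => ?_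
  rw [hcN _ N (good_face τ N i 1 hN), hcN _ N (good_face τ N i 0 hN)]
  simp [Finset.sum_apply]

theorem exists_lift_cube {n : ℕ} {u : C(U, X)} (hu : IsEmbedding u) (τ : SingularCube n X)
    (h : ∀ t, τ t ∈ Set.range u) : ∃ ρ : SingularCube n U, u.comp ρ = τ := by
  choose f hf using h
  refine ⟨⟨f, hu.isInducing.continuous_iff.2 ?_⟩, ?_⟩
  · have : u ∘ f = τ := funext hf
    rw [this]; exact τ.continuous
  · ext t; exact hf t

theorem extendZero_eq_zero {n : ℕ} {u : C(U, X)} (hu : Function.Injective u) (φ : Cochain n U A)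
    (τ : SingularCube n X) (h : ¬ ∃ ρ : SingularCube n U, u.comp ρ = τ) :
    (extendZero u hu φ).1 τ = 0 := by
  simp only [extendZero]
  exact dif_neg h

/-- Mayer–Vietoris for a cover by an open set and a disjoint family of open sets. -/
theorem exists_coboundary_of_cover {n : ℕ} {J : Type*} {V O : J → Type*}
    [∀ e, TopologicalSpace (V e)] [∀ e, TopologicalSpace (O e)]
    (u : C(U, X)) (hu : IsOpenEmbedding u) (v : ∀ e, C(V e, X)) (hv : ∀ e, IsOpenEmbedding (v e))
    (p : ∀ e, C(O e, U)) (q : ∀ e, C(O e, V e)) (hp : ∀ e, IsEmbedding (p e))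
    (hpq : ∀ e x, u (p e x) = v e (q e x))
    (hO : ∀ e x y, u x = v e y → ∃ z, p e z = x)
    (hdisj : ∀ e e' x y, v e x = v e' y → e = e')
    (hcov : ∀ x, x ∈ Set.range u ∨ ∃ e, x ∈ Set.range (v e))
    (ω : Cochain (n + 1) X A) (hω : coboundary (n + 1) X A ω = 0)
    (a : Cochain n U A) (ha : coboundary n U A a = cochainPullback (n + 1) A u ω)
    (b : ∀ e, Cochain n (V e) A)
    (hb : ∀ e, coboundary n (V e) A (b e) = cochainPullback (n + 1) A (v e) ω)
    (hd : ∀ e, IsCob n (cochainPullback n A (p e) a - cochainPullback n A (q e) (b e))) :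
    ∃ c, coboundary n X A c = ω := by
  have hq : ∀ e, Function.Injective (q e) := fun e x y hxy =>
    (hp e).injective (hu.injective (by rw [hpq, hpq, hxy]))
  -- `b e` is changed by a cocycle so that it agrees with `a` on the overlap as a cochain, not just
  -- up to coboundary: by a constant in degree 0, otherwise by the coboundary of a primitive
  -- extended by zero.
  have hb' : ∀ e, ∃ b' : Cochain n (V e) A,
      coboundary n (V e) A b' = cochainPullback (n + 1) A (v e) ω ∧
      cochainPullback n A (q e) b' = cochainPullback n A (p e) a := by
    intro e
    cases n with
    | zero =>
      obtain ⟨α, hα⟩ := hd e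
      let κ : Cochain 0 (V e) A := ⟨fun _ => α, fun τ ⟨i, _⟩ => i.elim0⟩
      have hκ : coboundary 0 (V e) A κ = 0 := IsCob.coboundary_eq_zero ⟨α, fun _ => rfl⟩
      refine ⟨b e + κ, by rw [map_add, hκ, hb, add_zero], ?_⟩
      ext τ
      rw [map_add]
      exact (sub_eq_iff_eq_add'.1 (hα τ)).symm
    | succ n =>
      obtain ⟨d, hd⟩ := hd e
      refine ⟨b e + coboundary n _ A (extendZero (q e) (hq e) d), ?_, ?_⟩
      · rw [map_add, coboundary_coboundary, hb, add_zero]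
      · rw [map_add, ← coboundary_pullback, cochainPullback_extendZero, hd]
        abel
  choose b' hb'1 hb'2 using hb'
  let c₀ : Cochain n X A := extendZero u hu.injective a
  have hc₀ : cochainPullback n A u c₀ = a := cochainPullback_extendZero _ _ _
  -- The correction needed on the cubes inside `V e`. It vanishes on cubes inside U because there
  -- `b' e` and `c₀` agree, and on cubes inside the other V's by disjointness.
  let f : ∀ e, Cochain n X A := fun e =>
    extendZero (v e) (hv e).injective (b' e - cochainPullback n A (v e) c₀)
  have hf : ∀ e, cochainPullback n A (v e) (f e) = b' e - cochainPullback n A (v e) c₀ :=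
    fun e => cochainPullback_extendZero _ _ _
  have hf0 : ∀ e e', e' ≠ e → cochainPullback n A (v e) (f e') = 0 := by
    intro e e' hee
    ext τ
    refine extendZero_eq_zero (hv e').injective _ _ ?_
    rintro ⟨ρ, hρ⟩
    exact hee (hdisj _ _ _ _ (DFunLike.congr_fun hρ fun _ => 0))
  have hfu : ∀ e, cochainPullback n A u (f e) = 0 := by
    intro e
    ext τ
    by_cases h : ∃ ρ : SingularCube n (V e), (v e).comp ρ = u.comp τ
    · obtain ⟨ρ, hρ⟩ := h
      obtain ⟨κ, rfl⟩ := exists_lift_cube (hp e) τ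
        fun t => hO e _ _ (DFunLike.congr_fun hρ t).symm
      have e1 : (q e).comp κ = ρ := by
        ext t
        refine (hv e).injective ?_
        have := DFunLike.congr_fun hρ t
        simp only [ContinuousMap.comp_apply] at this ⊢
        rw [this, hpq]
      have e2 := congrArg (fun φ => φ.1 ρ) (hf e)
      simp only [AddSubgroup.coe_sub, Pi.sub_apply, cochainPullback_apply] at e2
      rw [cochainPullback_apply, ← hρ, e2]
      have e3 := congrArg (fun φ => φ.1 κ) (hb'2 e)
      simp only [cochainPullback_apply] at e3
      rw [← e1, e3, e1, hρ, ← cochainPullback_apply u c₀, hc₀, sub_self]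
      rfl
    · exact extendZero_eq_zero (hv e).injective _ _ h
  let c₁ : Cochain n X A := ⟨fun τ => ∑ᶠ e, (f e).1 τ, fun τ hτ => by
    simp only [(f _).2 τ hτ, finsum_zero]⟩
  have hc₁u : cochainPullback n A u c₁ = 0 := by
    ext τ
    change ∑ᶠ e, (cochainPullback n A u (f e)).1 τ = 0
    simp only [hfu]
    exact finsum_zero
  have hc₁v : ∀ e, cochainPullback n A (v e) c₁ = b' e - cochainPullback n A (v e) c₀ := by
    intro e
    rw [← hf e]
    ext τ
    change ∑ᶠ e', (cochainPullback n A (v e) (f e')).1 τ = _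
    refine finsum_eq_single _ e fun e' he' => ?_
    rw [hf0 e e' he']; rfl
  -- After subtracting the coboundary of the glued cochain, the cocycle vanishes on every cube
  -- inside a member of the cover.
  obtain ⟨c', hc'⟩ := exists_coboundary_of_small
    (insert (Set.range u) (Set.range fun e => Set.range (v e)))
    (by
      rintro S (rfl | ⟨e, rfl⟩)
      · exact hu.isOpen_range
      · exact (hv e).isOpen_range)
    (by
      intro x
      rcases hcov x with h | ⟨e, h⟩
      · exact ⟨_, Or.inl rfl, h⟩
      · exact ⟨_, Or.inr ⟨e, rfl⟩, h⟩)
    (ω - coboundary n X A (c₀ + c₁)) (by rw [map_sub, coboundary_coboundary, hω, sub_zero]) (by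
      rintro τ ⟨S, rfl | ⟨e, rfl⟩, hτ⟩
      · obtain ⟨ρ, rfl⟩ := exists_lift_cube hu.isEmbedding τ hτ
        rw [← cochainPullback_apply, map_sub, ← coboundary_pullback, map_add, hc₀, hc₁u, add_zero,
          ha, sub_self]
        rfl
      · obtain ⟨ρ, rfl⟩ := exists_lift_cube (hv e).isEmbedding τ hτ
        rw [← cochainPullback_apply, map_sub, ← coboundary_pullback, map_add, hc₁v,
          add_sub_cancel, hb'1, sub_self]
        rfl)
  exact ⟨c₀ + c₁ + c', by rw [map_add, hc', add_sub_cancel]⟩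

end SmallCubes

/-! ### Cohomology of punctured balls -/

section Punctured

variable {A : Type*} [AddCommGroup A]

/-- The punctured open unit ball of the sup norm. -/
abbrev PuncturedBall (k : ℕ) := {x : Fin k → ℝ // ‖x‖ < 1 ∧ x ≠ 0}

/-- The complement of half of the first axis in the punctured ball. -/
abbrev SlitBall (k : ℕ) (s : ℝ) :=
  {x : PuncturedBall (k + 1) // 0 < s * x.1 0 ∨ ∃ i : Fin k, x.1 i.succ ≠ 0}

/-- The complement of the first axis in the ball. -/
abbrev AxisComplement (k : ℕ) := {x : PuncturedBall (k + 1) // ∃ i : Fin k, x.1 i.succ ≠ 0}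

theorem norm_cons_lt_one {k : ℕ} {a : ℝ} {y : Fin k → ℝ} (ha : |a| < 1) (hy : ‖y‖ < 1) :
    ‖(Fin.cons a y : Fin (k + 1) → ℝ)‖ < 1 := by
  rw [pi_norm_lt_iff one_pos]
  refine Fin.cases ?_ fun i => ?_
  · simpa using ha
  · exact (norm_le_pi_norm y i).trans_lt hy

theorem continuous_cons {Z : Type*} [TopologicalSpace Z] {k : ℕ} {α : Type*} [TopologicalSpace α]
    {a : Z → α} {y : Z → Fin k → α} (ha : Continuous a) (hy : Continuous y) :
    Continuous fun z => (Fin.cons (a z) (y z) : Fin (k + 1) → α) := by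
  refine continuous_pi fun i => ?_
  refine Fin.cases ?_ (fun i => ?_) i
  · simpa using ha
  · exact (continuous_apply i).comp hy

/-- The slit ball is star-shaped about the point (s / 2, 0, …, 0), which lies on the half of the
axis that is kept. -/
theorem isCob_slitBall {n k : ℕ} {s : ℝ} (hs : |s| = 1) (ω : Cochain n (SlitBall k s) A)
    (hω : coboundary n _ A ω = 0) : IsCob n ω := by
  have hs2 : s * s = 1 := by rw [← abs_mul_abs_self, hs, one_mul]
  let c : Fin (k + 1) → ℝ := Fin.cons (s / 2) 0
  have hc : ‖c‖ < 1 := norm_cons_lt_one (by rw [abs_div, hs]; norm_num) (by simp)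
  let f : SlitBall k s × I → Fin (k + 1) → ℝ := fun p => (p.2 : ℝ) • p.1.1.1 + (1 - (p.2 : ℝ)) • c
  have f0 : ∀ p, s * f p 0 = p.2 * (s * p.1.1.1 0) + (1 - (p.2 : ℝ)) / 2 := fun p => by
    simp only [f, c, Pi.add_apply, Pi.smul_apply, smul_eq_mul, Fin.cons_zero]
    linear_combination (1 - (p.2 : ℝ)) / 2 * hs2
  have fs : ∀ p (i : Fin k), f p i.succ = p.2 * p.1.1.1 i.succ := fun p i => by
    simp [f, c]
  have hfn : ∀ p, ‖f p‖ < 1 := fun p => by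
    have := (convex_ball (0 : Fin (k + 1) → ℝ) 1) (x := p.1.1.1) (by simpa using p.1.1.2.1)
      (y := c) (by simpa using hc) p.2.2.1 (sub_nonneg.2 p.2.2.2) (by ring)
    simpa using this
  have hfs : ∀ p, 0 < s * f p 0 ∨ ∃ i : Fin k, f p i.succ ≠ 0 := by
    rintro ⟨x, t⟩
    have ht0 := t.2.1
    have ht1 := t.2.2
    rw [f0]
    rcases ht0.eq_or_lt with h | h
    · left; simp [← h]
    rcases x.2 with hx | ⟨i, hi⟩
    · left
      have := mul_pos h hx
      simp only
      linarith
    · right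
      exact ⟨i, by rw [fs]; exact mul_ne_zero h.ne' hi⟩
  have hfz : ∀ p, f p ≠ 0 := fun p h => by
    have := hfs p
    simp [h] at this
  have hfc : Continuous f := by fun_prop
  refine isCob_of_contraction hω
    ⟨fun p => ⟨⟨f p, hfn p, hfz p⟩, hfs p⟩, by fun_prop⟩
    ⟨⟨c, hc, fun h => ?_⟩, Or.inl ?_⟩ ?_ ?_
  · have := congrFun h 0
    simp only [c, Fin.cons_zero, Pi.zero_apply] at this
    have : s = 0 := by linarith
    simp [this] at hs
  · simp only [c, Fin.cons_zero]; linarith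
  · intro x; ext i; simp [f]
  · intro x; ext i; simp [f]

/-- The inclusion of the punctured ball in the next one at height `1 / 2`. -/
def puncturedInclusion (k : ℕ) : C(PuncturedBall k, PuncturedBall (k + 1)) :=
  ⟨fun y => ⟨Fin.cons (1 / 2) y.1, norm_cons_lt_one (by rw [abs_of_pos] <;> norm_num) y.2.1,
    fun h => by have := congrFun h 0; simp at this⟩,
    (continuous_cons continuous_const continuous_subtype_val).subtype_mk _⟩

theorem exists_tail_ne_zero {k : ℕ} (y : PuncturedBall k) :
    ∃ i : Fin k, (puncturedInclusion k y).1 i.succ ≠ 0 := by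
  by_contra! h
  exact y.2.2 (funext fun i => by simpa [puncturedInclusion] using h i)

/-- The inclusion of the slit ball. -/
def slitInclusion (k : ℕ) (s : ℝ) : C(SlitBall k s, PuncturedBall (k + 1)) :=
  ⟨Subtype.val, by fun_prop⟩

theorem isOpenEmbedding_slitInclusion (k : ℕ) (s : ℝ) : IsOpenEmbedding (slitInclusion k s) := by
  have hcoord : ∀ j, Continuous fun x : PuncturedBall (k + 1) => x.1 j := fun j =>
    (continuous_apply j).comp continuous_subtype_val
  refine IsOpen.isOpenEmbedding_subtypeVal ?_
  have : {x : PuncturedBall (k + 1) | 0 < s * x.1 0 ∨ ∃ i : Fin k, x.1 i.succ ≠ 0}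
      = {x | 0 < s * x.1 0} ∪ ⋃ i : Fin k, {x | x.1 i.succ ≠ 0} := by ext; simp
  change IsOpen {x : PuncturedBall (k + 1) | 0 < s * x.1 0 ∨ ∃ i : Fin k, x.1 i.succ ≠ 0}
  rw [this]
  exact (isOpen_lt continuous_const (continuous_const.mul (hcoord 0))).union
    (isOpen_iUnion fun i => isOpen_ne_fun (hcoord _) continuous_const)

/-- Sliding the first coordinate linearly to 1 / 2 deforms the complement of the axis into the copy
of the lower punctured ball. -/
theorem isCob_axisComplement {n k : ℕ} (ω : Cochain n (AxisComplement k) A)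
    (hω : coboundary n _ A ω = 0)
    (h : IsCob n (cochainPullback n A (⟨fun y => ⟨puncturedInclusion k y, exists_tail_ne_zero y⟩,
      by fun_prop⟩ : C(PuncturedBall k, AxisComplement k)) ω)) : IsCob n ω := by
  let f : AxisComplement k × I → Fin (k + 1) → ℝ := fun p =>
    Fin.cons (p.2 * p.1.1.1 0 + (1 - (p.2 : ℝ)) * (1 / 2)) (fun i => p.1.1.1 i.succ)
  have htail : ∀ x : AxisComplement k, ‖fun i : Fin k => x.1.1 i.succ‖ < 1 := fun x => by
    rw [pi_norm_lt_iff one_pos]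
    exact fun i => (norm_le_pi_norm x.1.1 _).trans_lt x.1.2.1
  have hfn : ∀ p, ‖f p‖ < 1 := fun p => by
    refine norm_cons_lt_one ?_ (htail p.1)
    have h1 : |p.1.1.1 0| < 1 := (norm_le_pi_norm p.1.1.1 0).trans_lt p.1.1.2.1
    have h2 := (convex_ball (0 : ℝ) 1) (x := p.1.1.1 0) (by simpa using h1)
      (y := 1 / 2) (by norm_num [abs_of_pos]) p.2.2.1 (sub_nonneg.2 p.2.2.2) (by ring)
    simpa using h2
  have hfs : ∀ p, ∃ i : Fin k, f p i.succ ≠ 0 := fun p => p.1.2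
  have hfz : ∀ p, f p ≠ 0 := fun p h => by
    obtain ⟨i, hi⟩ := hfs p
    simp [h] at hi
  have hcoord : ∀ j, Continuous fun x : AxisComplement k => x.1.1 j := fun j =>
    (continuous_apply j).comp (continuous_subtype_val.comp continuous_subtype_val)
  have hfc : Continuous f := continuous_cons
    (((continuous_subtype_val.comp continuous_snd).mul ((hcoord 0).comp continuous_fst)).add
      ((continuous_const.sub (continuous_subtype_val.comp continuous_snd)).mul continuous_const))
    (continuous_pi fun i => (hcoord i.succ).comp continuous_fst)
  let H : C(AxisComplement k × I, AxisComplement k) :=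
    ⟨fun p => ⟨⟨f p, hfn p, hfz p⟩, hfs p⟩, by fun_prop⟩
  let pr : C(AxisComplement k, PuncturedBall k) :=
    ⟨fun x => ⟨fun i => x.1.1 i.succ, htail x, fun h => by
      obtain ⟨i, hi⟩ := x.2
      exact hi (congrFun h i)⟩, (continuous_pi fun i : Fin k => hcoord i.succ).subtype_mk _⟩
  have h1 : endMap H 1 = ContinuousMap.id _ := by
    ext x i
    refine Fin.cases ?_ (fun i => ?_) i
    · simp [endMap, H, f]
    · simp [endMap, H, f]
  have h0 : endMap H 0 = (⟨fun y => ⟨puncturedInclusion k y, exists_tail_ne_zero y⟩,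
      by fun_prop⟩ : C(PuncturedBall k, AxisComplement k)).comp pr := by
    ext x i
    refine Fin.cases ?_ (fun i => ?_) i
    · simp [endMap, H, f, puncturedInclusion]
    · simp [endMap, H, f, pr, puncturedInclusion]
  have := isCob_pullback_of_homotopy hω H (by
    rw [h0, ← cochainPullback_comp]
    exact h.pullback pr)
  rw [h1] at this
  exact this

/-- Suspension: the punctured ball is the union of two contractible slit balls whose intersection is
equivalent to the punctured ball of one dimension less. The first two clauses, which give the
primitives on actual cubes, serve to evaluate ω on an explicit cycle. -/
theorem puncturedBall_step {n k : ℕ} (ω : Cochain (n + 1) (PuncturedBall (k + 1)) A)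
    (hω : coboundary (n + 1) _ A ω = 0) :
    ∃ a b : Cochain n (PuncturedBall (k + 1)) A,
      (∀ τ, (∀ t, 0 < (τ t).1 0 ∨ ∃ i : Fin k, (τ t).1 i.succ ≠ 0) →
        (coboundary n _ A a).1 τ = ω.1 τ) ∧
      (∀ τ, (∀ t, (τ t).1 0 < 0 ∨ ∃ i : Fin k, (τ t).1 i.succ ≠ 0) →
        (coboundary n _ A b).1 τ = ω.1 τ) ∧
      coboundary n _ A (cochainPullback n A (puncturedInclusion k) (a - b)) = 0 ∧
      (IsCob n (cochainPullback n A (puncturedInclusion k) (a - b)) → IsCob (n + 1) ω) := by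
  let u := slitInclusion k
  have hu := isOpenEmbedding_slitInclusion k
  obtain ⟨a, ha⟩ := isCob_slitBall (n := n + 1) (k := k) (s := 1) (by simp)
    (cochainPullback _ A (u 1) ω) (by rw [coboundary_pullback, hω, map_zero])
  obtain ⟨b, hb⟩ := isCob_slitBall (n := n + 1) (k := k) (s := -1) (by simp)
    (cochainPullback _ A (u (-1)) ω) (by rw [coboundary_pullback, hω, map_zero])
  let j : ∀ s, C(AxisComplement k, SlitBall k s) := fun s =>
    ⟨fun x => ⟨x.1, Or.inr x.2⟩, by fun_prop⟩
  have hj : ∀ s, IsEmbedding (j s) := fun s =>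
    IsEmbedding.of_comp (j s).continuous (u s).continuous IsEmbedding.subtypeVal
  have hpull : ∀ s (c : Cochain n (SlitBall k s) A),
      cochainPullback n A (puncturedInclusion k) (extendZero (u s) (hu s).injective c)
        = cochainPullback n A (⟨fun y => ⟨puncturedInclusion k y, exists_tail_ne_zero y⟩,
      by fun_prop⟩ : C(PuncturedBall k, AxisComplement k)) (cochainPullback n A (j s) c) := by
    intro s c
    conv_rhs => rw [← cochainPullback_extendZero (u s) (hu s).injective c]
    rfl
  have hcob : coboundary n _ A (cochainPullback n A (j 1) a - cochainPullback n A (j (-1)) b) = 0 := by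
    rw [map_sub, coboundary_pullback, coboundary_pullback, ha, hb]
    exact sub_self _
  refine ⟨extendZero (u 1) (hu 1).injective a, extendZero (u (-1)) (hu (-1)).injective b,
    ?_, ?_, ?_, ?_⟩
  · intro τ hτ
    obtain ⟨ρ, rfl⟩ := exists_lift_cube (hu 1).isEmbedding τ
      fun t => ⟨⟨τ t, by simpa using hτ t⟩, rfl⟩
    rw [← cochainPullback_apply, ← coboundary_pullback, cochainPullback_extendZero, ha]
    rfl
  · intro τ hτ
    obtain ⟨ρ, rfl⟩ := exists_lift_cube (hu (-1)).isEmbedding τ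
      fun t => ⟨⟨τ t, by simpa using hτ t⟩, rfl⟩
    rw [← cochainPullback_apply, ← coboundary_pullback, cochainPullback_extendZero, hb]
    rfl
  · rw [map_sub, hpull, hpull, ← map_sub, coboundary_pullback, hcob, map_zero]
  · intro h
    rw [map_sub, hpull, hpull, ← map_sub] at h
    refine exists_coboundary_of_cover (J := Unit) (u 1) (hu 1) (fun _ => u (-1))
      (fun _ => hu (-1)) (fun _ => j 1) (fun _ => j (-1)) (fun _ => hj 1) (fun _ _ => rfl) ?_
      (fun _ _ _ _ _ => rfl) ?_ ω hω a ha (fun _ => b) (fun _ => hb)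
      fun _ => isCob_axisComplement _ hcob h
    · rintro - x y hxy
      change x.1 = y.1 at hxy
      refine ⟨⟨x.1, ?_⟩, rfl⟩
      rcases x.2 with h1 | h1
      · rcases y.2 with h2 | h2
        · rw [← hxy] at h2; linarith
        · rwa [hxy]
      · exact h1
    · intro x
      by_cases h : ∃ i : Fin k, x.1 i.succ ≠ 0
      · exact Or.inl ⟨⟨x, Or.inr h⟩, rfl⟩
      · have h0 : x.1 0 ≠ 0 := by
          intro h0
          push Not at h
          exact x.2.2 (funext (Fin.cases h0 h))
        rcases lt_or_gt_of_ne h0 with h1 | h1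
        · exact Or.inr ⟨(), ⟨x, Or.inl (by linarith)⟩, rfl⟩
        · exact Or.inl ⟨⟨x, Or.inl (by linarith)⟩, rfl⟩

theorem isCob_of_isEmpty {n : ℕ} {W : Type*} [TopologicalSpace W] [IsEmpty W]
    (ω : Cochain n W A) : IsCob n ω := by
  have : IsEmpty (SingularCube n W) := ⟨fun τ => isEmptyElim (τ fun _ => 0)⟩
  cases n with
  | zero => exact ⟨0, fun τ => isEmptyElim τ⟩
  | succ n => exact ⟨0, Subtype.ext (funext fun τ => isEmptyElim τ)⟩

/-- Up to homotopy this is a sphere of dimension k - 1, which has no reduced cohomology in degrees n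
≥ k. Each suspension step lowers n and k together, down to the empty space. -/
theorem isCob_puncturedBall {n k : ℕ} (hk : k ≤ n) (ω : Cochain n (PuncturedBall k) A)
    (hω : coboundary n _ A ω = 0) : IsCob n ω := by
  induction k generalizing n with
  | zero =>
    have : IsEmpty (PuncturedBall 0) := ⟨fun x => x.2.2 (Subsingleton.elim _ _)⟩
    exact isCob_of_isEmpty ω
  | succ k ih =>
    obtain ⟨n, rfl⟩ : ∃ m, n = m + 1 := ⟨n - 1, by omega⟩
    obtain ⟨a, b, -, -, h1, h2⟩ := puncturedBall_step ω hω
    exact h2 (ih (by omega) _ h1)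

/-- The faces of the cube of side `1` around the origin. -/
def boundaryFace (k : ℕ) (i : Fin (k + 1)) (ε : Bool) : SingularCube k (PuncturedBall (k + 1)) :=
  ⟨fun t => ⟨fun j => ((i.insertNth (endpoint ε) t : Fin (k + 1) → I) j : ℝ) - 1 / 2, by
    refine ⟨?_, fun h => ?_⟩
    · rw [pi_norm_lt_iff one_pos]
      intro j
      have := ((i.insertNth (endpoint ε) t : Fin (k + 1) → I) j).2
      rw [Real.norm_eq_abs, abs_lt]
      constructor <;> linarith [this.1, this.2]
    · have := congrFun h i
      simp only [Fin.insertNth_apply_same, Pi.zero_apply] at this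
      cases ε <;> norm_num [endpoint] at this⟩, by
    refine Continuous.subtype_mk (continuous_pi fun j => ?_) _
    fun_prop⟩

theorem boundaryFace_apply (k : ℕ) (i : Fin (k + 1)) (ε : Bool) (t : Fin k → I) (j : Fin (k + 1)) :
    (boundaryFace k i ε t).1 j
      = ((i.insertNth (endpoint ε) t : Fin (k + 1) → I) j : ℝ) - 1 / 2 := rfl

/-- The faces of a cube around the origin form a fundamental cycle of the n-sphere, and the
vanishing of ω on it is the only condition in degree n. The induction passes to the equator,
realized as the boundary of the top face of the cube. -/
theorem isCob_puncturedBall_of_sum_eq_zero {n : ℕ} (ω : Cochain n (PuncturedBall (n + 1)) A)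
    (hω : coboundary n _ A ω = 0)
    (h : ∑ i : Fin (n + 1), (-1 : ℤ) ^ (i : ℕ) •
      (ω.1 (boundaryFace n i true) - ω.1 (boundaryFace n i false)) = 0) : IsCob n ω := by
  induction n with
  | zero =>
    have hpath : ∀ (s : ℝ) (hs : |s| = 1) (b : Bool) (hb : (endpoint b : ℝ) - 1 / 2 = s / 2)
        (τ : SingularCube 0 (PuncturedBall 1)), 0 < s * (τ 0).1 0 →
        ω.1 τ = ω.1 (boundaryFace 0 0 b) := by
      intro s hs b hb τ hτ
      obtain ⟨α, hα⟩ := isCob_slitBall (k := 0) hs (cochainPullback 0 A (slitInclusion 0 s) ω)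
        (by rw [coboundary_pullback, hω, map_zero])
      have hconst : ∀ τ : SingularCube 0 (PuncturedBall 1), 0 < s * (τ 0).1 0 → ω.1 τ = α := by
        intro τ hτ
        obtain ⟨ρ, rfl⟩ := exists_lift_cube (isOpenEmbedding_slitInclusion 0 s).isEmbedding τ
          fun t => ⟨⟨τ t, Or.inl (by rwa [Subsingleton.elim t 0])⟩, rfl⟩
        exact hα ρ
      rw [hconst τ hτ, hconst]
      rw [boundaryFace_apply, Fin.insertNth_apply_same, hb, ← mul_div_assoc, ← abs_mul_abs_self, hs]
      norm_num
    have h1 : ω.1 (boundaryFace 0 0 true) = ω.1 (boundaryFace 0 0 false) := by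
      simpa [sub_eq_zero] using h
    refine ⟨ω.1 (boundaryFace 0 0 true), fun τ => ?_⟩
    have h0 : (τ 0).1 0 ≠ 0 := fun h0 => (τ 0).2.2 (funext fun i => by rwa [Fin.fin_one_eq_zero i])
    rcases lt_or_gt_of_ne h0 with h2 | h2
    · rw [h1]
      exact hpath (-1) (by simp) false (by norm_num [endpoint]) τ (by linarith)
    · exact hpath 1 (by simp) true (by norm_num [endpoint]) τ (by linarith)
  | succ n ih =>
    obtain ⟨a, b, ha, hb, h1, h2⟩ := puncturedBall_step ω hω
    refine h2 (ih _ h1 ?_)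
    -- The coboundary of `b` vanishes on the whole cycle, and it equals ω on every face but the top
    -- one, since only that face meets the half axis removed for `b`. On the top face ω is the
    -- coboundary of `a`.
    have hF := sum_coboundary_family (fun i ε => boundaryFace (n + 1) i ε) (fun i j hij ε ε' => by
      ext t l
      change ((Fin.insertNth (α := fun _ => I) _ _ _ l : I) : ℝ) - 1 / 2
        = ((Fin.insertNth (α := fun _ => I) _ _ _ l : I) : ℝ) - 1 / 2
      have := congrFun (insertNth_insertNth_comm i j hij (endpoint ε) (endpoint ε') t) l
      exact congrArg (fun x : I => (x : ℝ) - 1 / 2) this) b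
    rw [← hF] at h
    have hsucc : ∀ (i : Fin (n + 1)) (ε : Bool), (coboundary n _ A b).1 (boundaryFace (n + 1) i.succ ε)
        = ω.1 (boundaryFace (n + 1) i.succ ε) := fun i ε => by
      refine hb _ fun t => Or.inr ⟨i, ?_⟩
      rw [boundaryFace_apply, Fin.insertNth_apply_same]
      cases ε <;> norm_num [endpoint]
    have h00 : (coboundary n _ A b).1 (boundaryFace (n + 1) 0 false)
        = ω.1 (boundaryFace (n + 1) 0 false) := by
      refine hb _ fun t => Or.inl ?_
      rw [boundaryFace_apply, Fin.insertNth_apply_same]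
      norm_num [endpoint]
    have h01 : (coboundary n _ A a).1 (boundaryFace (n + 1) 0 true)
        = ω.1 (boundaryFace (n + 1) 0 true) := by
      refine ha _ fun t => Or.inl ?_
      rw [boundaryFace_apply, Fin.insertNth_apply_same]
      norm_num [endpoint]
    rw [Fin.sum_univ_succ, Fin.sum_univ_succ (n := n + 1)] at h
    simp only [hsucc, h00, ← h01] at h
    -- Comparison of the two sums leaves the top face alone, so `a - b` sums to zero over the
    -- boundary of the top face.
    have h3 : (coboundary n _ A (a - b)).1 (boundaryFace (n + 1) 0 true) = 0 := by
      rw [map_sub]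
      have := add_right_cancel h
      simp only [Fin.val_zero, pow_zero, one_smul, sub_left_inj] at this
      exact sub_eq_zero.2 this
    rw [coboundary_apply] at h3
    rw [← h3]
    -- The top face of the centered unit cube lies at height 1 - 1 / 2, the height chosen for
    -- `puncturedInclusion`.
    have hface : ∀ (i : Fin (n + 1)) (ε : Bool), (puncturedInclusion (n + 1)).comp (boundaryFace n i ε)
        = cubeFace i (endpoint ε) (boundaryFace (n + 1) 0 true) := by
      intro i ε
      ext t l
      change (Fin.cons (1 / 2) _ : Fin (n + 2) → ℝ) l
        = ((Fin.insertNth (α := fun _ => I) 0 1 (i.insertNth (endpoint ε) t : Fin (n + 1) → I) l : I) : ℝ)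
          - 1 / 2
      rw [Fin.insertNth_zero']
      refine Fin.cases ?_ (fun l => ?_) l
      · norm_num
      · simp [boundaryFace_apply]
    refine Finset.sum_congr rfl fun i _ => ?_
    rw [cochainPullback_apply, cochainPullback_apply, hface, hface]
    rfl

end Punctured

/-! ### Homotopy extension for cubes -/

section HomotopyExtension

variable {T A : Type*} [TopologicalSpace T] [AddCommGroup A]

/-- Centered coordinates on the cube. -/
def centered {k : ℕ} (x : Fin k → I) : Fin k → ℝ := fun i => 2 * (x i : ℝ) - 1

theorem continuous_centered {k : ℕ} : Continuous (centered (k := k)) := by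
  unfold centered; fun_prop

theorem norm_centered_le_one {k : ℕ} (x : Fin k → I) : ‖centered x‖ ≤ 1 := by
  rw [pi_norm_le_iff_of_nonneg zero_le_one]
  intro i
  have := (x i).2
  rw [centered, Real.norm_eq_abs, abs_le]
  constructor <;> linarith [this.1, this.2]

theorem norm_centered_eq_one {k : ℕ} {x : Fin k → I} (hx : x ∈ Cube.boundary (Fin k)) :
    ‖centered x‖ = 1 := by
  refine le_antisymm (norm_centered_le_one x) ?_
  obtain ⟨i, hi⟩ := hx
  refine le_trans (le_of_eq ?_) (norm_le_pi_norm (centered x) i)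
  rcases hi with hi | hi <;> norm_num [centered, hi]

theorem exists_abs_eq_norm {k : ℕ} (y : Fin k → ℝ) (hy : 0 < ‖y‖) : ∃ i, |y i| = ‖y‖ := by
  by_contra! h
  exact lt_irrefl _ ((pi_norm_lt_iff hy).2 fun i => (norm_le_pi_norm y i).lt_of_ne (h i))

theorem isClosed_boundary (k : ℕ) : IsClosed (Cube.boundary (Fin k)) := by
  have : Cube.boundary (Fin k) = ⋃ i : Fin k, ({y | y i = 0} ∪ {y | y i = 1}) := by
    ext y; simp [Cube.boundary]
  rw [this]
  exact isClosed_iUnion_of_finite fun i =>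
    (isClosed_eq (continuous_apply i) continuous_const).union
      (isClosed_eq (continuous_apply i) continuous_const)

/-- The scaling factor of the retraction of the cylinder over a cube. -/
def cylinderScale {k : ℕ} (p : (Fin k → I) × I) : ℝ :=
  -- The lower bound 1 / 2 only avoids a division by zero: if the norm is below it, the second term
  -- is 2 ≥ 1 + t and the minimum is 1 + t.
  min (1 + p.2) (1 / max ‖centered p.1‖ (1 / 2))

theorem continuous_cylinderScale {k : ℕ} : Continuous (cylinderScale (k := k)) := by
  have := continuous_centered (k := k)
  refine Continuous.min (by fun_prop) (Continuous.div (by fun_prop) (by fun_prop) fun p => ?_)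
  have : (1 / 2 : ℝ) ≤ max ‖centered p.1‖ (1 / 2) := le_max_right _ _
  intro h
  linarith

/-- The retraction of the cylinder over a cube onto the union of its bottom and its sides. -/
def cylinderRetraction (k : ℕ) : C((Fin k → I) × I, (Fin k → I) × I) :=
  -- The slice at height t is stretched by the factor 1 + t; what would leave the cube is pushed
  -- back to its boundary, and the overshoot of the norm beyond 1 becomes the height on the side.
  ⟨fun p => (fun i => Set.projIcc 0 1 zero_le_one ((1 + cylinderScale p * centered p.1 i) / 2),
    Set.projIcc 0 1 zero_le_one (‖centered p.1‖ * (1 + p.2) - 1)), by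
    have h1 := continuous_centered (k := k)
    have h2 := continuous_cylinderScale (k := k)
    refine Continuous.prodMk (continuous_pi fun i => continuous_projIcc.comp ?_)
      (continuous_projIcc.comp (by fun_prop))
    have : Continuous fun p : (Fin k → I) × I => centered p.1 i :=
      (continuous_apply i).comp (h1.comp continuous_fst)
    fun_prop⟩

theorem cylinderRetraction_mem {k : ℕ} (p : (Fin k → I) × I) :
    (cylinderRetraction k p).2 = 0 ∨ (cylinderRetraction k p).1 ∈ Cube.boundary (Fin k) := by
  by_cases h : ‖centered p.1‖ * (1 + p.2) ≤ 1
  · left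
    exact Set.projIcc_of_le_left (zero_le_one' ℝ) (by linarith)
  · right
    push Not at h
    have ht := p.2.2
    have hN : 1 / 2 < ‖centered p.1‖ := by nlinarith [ht.1, ht.2, norm_nonneg (centered p.1)]
    have hs : cylinderScale p = 1 / ‖centered p.1‖ := by
      rw [cylinderScale, max_eq_left hN.le, min_eq_right]
      rw [div_le_iff₀ (by linarith)]
      linarith
    obtain ⟨i, hi⟩ := exists_abs_eq_norm (centered p.1) (by linarith)
    refine ⟨i, ?_⟩
    change Set.projIcc (0 : ℝ) 1 zero_le_one _ = 0 ∨ Set.projIcc (0 : ℝ) 1 zero_le_one _ = 1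
    rw [hs, ← hi]
    have hne : |centered p.1 i| ≠ 0 := by rw [hi]; linarith
    rcases abs_choice (centered p.1 i) with h1 | h1
    · right
      refine Set.projIcc_of_right_le _ ?_
      rw [h1] at hne ⊢
      rw [one_div_mul_cancel hne]; norm_num
    · left
      refine Set.projIcc_of_le_left _ ?_
      rw [h1] at hne ⊢
      have : 1 / -centered p.1 i * centered p.1 i = -1 := by
        have := neg_ne_zero.1 hne
        field_simp
      rw [this]; norm_num

theorem cylinderRetraction_eq {k : ℕ} (p : (Fin k → I) × I)
    (hp : p.2 = 0 ∨ p.1 ∈ Cube.boundary (Fin k)) : cylinderRetraction k p = p := by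
  have hs : cylinderScale p = 1 := by
    rw [cylinderScale]
    rcases hp with hp | hp
    · rw [hp, min_eq_left]
      · simp
      · rw [Set.Icc.coe_zero, add_zero, le_div_iff₀ (by positivity), one_mul]
        exact max_le (norm_centered_le_one _) (by norm_num)
    · rw [norm_centered_eq_one hp, max_eq_left (by norm_num), min_eq_right] <;> simp [p.2.2.1]
  refine Prod.ext (funext fun i => ?_) ?_
  · change Set.projIcc (0 : ℝ) 1 zero_le_one _ = _
    rw [hs]
    have : (1 + 1 * centered p.1 i) / 2 = (p.1 i : ℝ) := by rw [centered]; ring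
    rw [this, Set.projIcc_val]
  · change Set.projIcc (0 : ℝ) 1 zero_le_one _ = _
    rcases hp with hp | hp
    · rw [hp]
      exact Set.projIcc_of_le_left _ (by simpa using norm_centered_le_one p.1)
    · rw [norm_centered_eq_one hp]
      have : 1 * (1 + (p.2 : ℝ)) - 1 = p.2 := by ring
      rw [this, Set.projIcc_val]

theorem exists_homotopy_extension {k : ℕ} (a : C(Fin k → I, T)) (h : (Fin k → I) × I → T)
    (hc : ContinuousOn h {p | p.1 ∈ Cube.boundary (Fin k)})
    (h0 : ∀ x ∈ Cube.boundary (Fin k), h (x, 0) = a x) :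
    ∃ F : C((Fin k → I) × I, T), (∀ x, F (x, 0) = a x) ∧
      ∀ x ∈ Cube.boundary (Fin k), ∀ t, F (x, t) = h (x, t) := by
  classical
  let f : (Fin k → I) × I → T := fun p => if p.1 ∈ Cube.boundary (Fin k) then h p else a p.1
  have f0 : ∀ x, f (x, 0) = a x := fun x => by
    by_cases hx : x ∈ Cube.boundary (Fin k)
    · simp only [f, hx, if_true, h0 x hx]
    · simp only [f, hx, if_false]
  have hf : ContinuousOn f ({p | p.2 = 0} ∪ {p | p.1 ∈ Cube.boundary (Fin k)}) := by
    refine ContinuousOn.union_of_isClosed ?_ ?_ (isClosed_eq continuous_snd continuous_const)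
      ((isClosed_boundary k).preimage continuous_fst)
    · refine ContinuousOn.congr (f := fun p => a p.1) (by fun_prop) ?_
      rintro ⟨x, t⟩ ht
      change t = 0 at ht
      rw [ht, f0]
    · exact hc.congr fun p hp => if_pos hp
  refine ⟨⟨f ∘ cylinderRetraction k, hf.comp_continuous (cylinderRetraction k).continuous
    fun p => cylinderRetraction_mem p⟩, fun x => ?_, fun x hx t => ?_⟩
  · change f (cylinderRetraction k (x, 0)) = _
    rw [cylinderRetraction_eq _ (Or.inl rfl), f0]
  · change f (cylinderRetraction k (x, t)) = _
    rw [cylinderRetraction_eq _ (Or.inr hx)]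
    exact if_pos hx

theorem mem_boundary_succ {k : ℕ} {t : Fin (k + 1) → I} : t ∈ Cube.boundary (Fin (k + 1)) ↔
    t 0 = 0 ∨ t 0 = 1 ∨ (fun i => t (Fin.succ i)) ∈ Cube.boundary (Fin k) := by
  simp only [Cube.boundary, Set.mem_ofPred_eq, Fin.exists_fin_succ, or_assoc]

theorem insertNth_zero_tail {k : ℕ} {t : Fin (k + 1) → I} {ε : I} (h : t 0 = ε) :
    (Fin.insertNth 0 ε (fun i => t (Fin.succ i)) : Fin (k + 1) → I) = t := by
  rw [Fin.insertNth_zero', ← h]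
  exact Fin.cons_self_tail t

theorem continuous_tail {k : ℕ} : Continuous fun (t : Fin (k + 1) → I) (i : Fin k) => t i.succ := by
  fun_prop

/-- A cocycle vanishes on the boundary of the cube of a homotopy, so the difference between the ends
is determined by the side faces. -/
theorem endMap_sub_endMap_of_sides {k : ℕ} {ζ : Cochain k T A} (hζ : coboundary k T A ζ = 0)
    (F G : C((Fin k → I) × I, T)) (h : ∀ x ∈ Cube.boundary (Fin k), ∀ t, F (x, t) = G (x, t)) :
    ζ.1 (endMap F 1) - ζ.1 (endMap F 0) = ζ.1 (endMap G 1) - ζ.1 (endMap G 0) := by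
  cases k with
  | zero =>
    rw [← coboundary_cubeOf_zero, ← coboundary_cubeOf_zero, hζ]; rfl
  | succ k =>
    have hF := coboundary_cubeOf_succ ζ F
    have hG := coboundary_cubeOf_succ ζ G
    rw [hζ] at hF hG
    have hF' := (sub_eq_zero.1 hF.symm)
    have hG' := (sub_eq_zero.1 hG.symm)
    rw [hF', hG']
    refine Finset.sum_congr rfl fun i _ => ?_
    have key : ∀ ε : Bool,
        (⟨fun p => F (i.insertNth (endpoint ε) p.1, p.2), by fun_prop⟩ : C((Fin k → I) × I, T))
          = ⟨fun p => G (i.insertNth (endpoint ε) p.1, p.2), by fun_prop⟩ := fun ε => by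
      ext p
      refine h _ ⟨i, ?_⟩ _
      rw [Fin.insertNth_apply_same]
      cases ε <;> simp [endpoint]
    exact congrArg₂ (fun c d => (-1 : ℤ) ^ (i : ℕ) • (ζ.1 (cubeOf c) - ζ.1 (cubeOf d)))
      (key true) (key false)

/-- A cochain detects the homotopy groups in its degree if loops with the same value as the
constant loop are null-homotopic. -/
def Detects {k : ℕ} (ζ : Cochain k T A) : Prop :=
  -- The constant loop has value 0 in positive degrees, but not necessarily in degree 0.
  ∀ (x : T) (q : GenLoop (Fin k) T x), ζ.1 q.1 = ζ.1 (ContinuousMap.const _ x) →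
    GenLoop.Homotopic q GenLoop.const

/-- The homotopy that shrinks a cube to its corner. -/
def shrink {k : ℕ} (b : C(Fin k → I, T)) : C((Fin k → I) × I, T) :=
  ⟨fun p => b fun i => unitInterval.symm p.2 * p.1 i, by fun_prop⟩

theorem shrink_zero {k : ℕ} (b : C(Fin k → I, T)) (x : Fin k → I) : shrink b (x, 0) = b x := by
  simp [shrink]

theorem shrink_one {k : ℕ} (b : C(Fin k → I, T)) (x : Fin k → I) : shrink b (x, 1) = b 0 := by
  simp [shrink]; rfl

theorem exists_map_eq_on_boundary_of_homotopy {k : ℕ} (f₀ : C(Fin k → I, T))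
    (h : (Fin k → I) × I → T) (hc : ContinuousOn h {p | p.1 ∈ Cube.boundary (Fin k)})
    (h0 : ∀ x ∈ Cube.boundary (Fin k), h (x, 0) = f₀ x) :
    ∃ F : C(Fin k → I, T), ∀ x ∈ Cube.boundary (Fin k), F x = h (x, 1) := by
  obtain ⟨F, -, hF⟩ := exists_homotopy_extension f₀ h hc h0
  exact ⟨endMap F 1, fun x hx => hF x hx 1⟩

theorem isClosed_coord_eq {k : ℕ} (i : Fin k) (ε : I) :
    IsClosed {p : (Fin k → I) × I | p.1 i = ε} :=
  isClosed_eq ((continuous_apply i).comp continuous_fst) continuous_const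

theorem isClosed_tail_mem {k : ℕ} :
    IsClosed {t : Fin (k + 1) → I | (fun i => t (Fin.succ i)) ∈ Cube.boundary (Fin k)} :=
  (isClosed_boundary k).preimage continuous_tail

/-- Shrinking b to its corner, and dragging a along on the boundary, turns a into a loop with the
value of a constant loop. This loop is null-homotopic, and undoing the shrinking on the boundary of
the null-homotopy yields a homotopy from a to b. -/
theorem homotopicRel_of_eq {k : ℕ} {ζ : Cochain k T A} (hζ : coboundary k T A ζ = 0)
    (hd : Detects ζ) (a b : C(Fin k → I, T)) (hab : ∀ x ∈ Cube.boundary (Fin k), a x = b x)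
    (heq : ζ.1 a = ζ.1 b) : a.HomotopicRel b (Cube.boundary (Fin k)) := by
  classical
  set B := shrink b with hB
  obtain ⟨F, hF0, hF⟩ := exists_homotopy_extension a B B.continuous.continuousOn
    fun x hx => by rw [hB, shrink_zero, hab x hx]
  let q : GenLoop (Fin k) T (b 0) := ⟨endMap F 1, fun x hx => by
    change F (x, 1) = b 0
    rw [hF x hx, hB, shrink_one]⟩
  have e0 : endMap F 0 = a := by ext x; exact hF0 x
  have e1 : endMap B 0 = b := by ext x; exact shrink_zero b x
  have e2 : endMap B 1 = ContinuousMap.const _ (b 0) := by ext x; exact shrink_one b x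
  have hq := hd (b 0) q (by
    have := endMap_sub_endMap_of_sides hζ F B hF
    rw [e0, e1, e2, heq] at this
    exact sub_left_injective this)
  obtain ⟨N⟩ := hq
  let f₀ : C(Fin (k + 1) → I, T) := ⟨fun t => N (t 0, fun i => t i.succ), by fun_prop⟩
  -- The shrinking run backwards on the boundary of the null-homotopy: from the loop to a on the
  -- initial face, from the constant to b on the final face and the sides.
  let h : (Fin (k + 1) → I) × I → T := fun p =>
    if p.1 0 = 0 then F (fun i => p.1 i.succ, unitInterval.symm p.2)
      else B (fun i => p.1 i.succ, unitInterval.symm p.2)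
  have hside : ∀ p : (Fin (k + 1) → I) × I,
      (p.1 0 = 1 ∨ (fun i => p.1 (Fin.succ i)) ∈ Cube.boundary (Fin k)) →
      h p = B (fun i => p.1 i.succ, unitInterval.symm p.2) := by
    intro p hp
    by_cases h0 : p.1 0 = 0
    · rcases hp with hp | hp
      · rw [h0] at hp; exact absurd hp zero_ne_one
      · simp only [h, h0, if_true]
        exact hF _ hp _
    · simp only [h, h0, if_false]
  obtain ⟨G, hG⟩ := exists_map_eq_on_boundary_of_homotopy f₀ h (by
      have : {p : (Fin (k + 1) → I) × I | p.1 ∈ Cube.boundary (Fin (k + 1))}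
          = {p | p.1 0 = 0} ∪ {p | p.1 0 = 1 ∨ (fun i => p.1 (Fin.succ i)) ∈
            Cube.boundary (Fin k)} := by
        ext p; exact mem_boundary_succ
      rw [this]
      refine ContinuousOn.union_of_isClosed ?_ ?_ (isClosed_coord_eq 0 0)
        ((isClosed_coord_eq 0 1).union (isClosed_tail_mem.preimage continuous_fst))
      · refine ContinuousOn.congr (f := fun p =>
          F (fun i => p.1 i.succ, unitInterval.symm p.2)) (by fun_prop) fun p hp => ?_
        exact if_pos hp
      · refine ContinuousOn.congr (f := fun p =>
          B (fun i => p.1 i.succ, unitInterval.symm p.2)) (by fun_prop) fun p hp => hside p hp)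
    (by
      intro t ht
      by_cases h0 : t 0 = 0
      · simp only [h, h0, if_true, f₀, ContinuousMap.coe_mk, N.apply_zero, unitInterval.symm_zero]
        rfl
      · have h1 := mem_boundary_succ.1 ht
        simp only [h0, false_or] at h1
        rw [hside _ h1]
        simp only [unitInterval.symm_zero, hB, shrink_one]
        rcases h1 with h1 | h1
        · simp only [f₀, ContinuousMap.coe_mk, h1, N.apply_one]
          rfl
        · simp only [f₀, ContinuousMap.coe_mk]
          rw [N.eq_snd _ h1]
          rfl)
  refine ⟨⟨⟨⟨fun p => G (Fin.cons p.1 p.2), G.continuous.comp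
    (continuous_cons continuous_fst continuous_snd)⟩, fun x => ?_, fun x => ?_⟩, fun s x hx => ?_⟩⟩
  · change G _ = a x
    rw [hG _ (mem_boundary_succ.2 (Or.inl rfl))]
    simp [h, hF0]
  · change G _ = b x
    rw [hG _ (mem_boundary_succ.2 (Or.inr (Or.inl rfl))), hside _ (Or.inl rfl)]
    simp [hB, shrink_zero]
  · change G _ = a x
    rw [hG _ (mem_boundary_succ.2 (Or.inr (Or.inr (by simpa using hx)))),
      hside _ (Or.inr (by simpa using hx))]
    simp [hB, shrink_zero, hab x hx]

/-- A map on the boundary of a cube on which the obstruction vanishes extends to the cube. -/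
theorem exists_extension_of_sum_eq_zero {k : ℕ} {ζ : Cochain k T A} (hζ : coboundary k T A ζ = 0)
    (hd : Detects ζ) (f : (Fin (k + 1) → I) → T)
    (hf : ContinuousOn f (Cube.boundary (Fin (k + 1))))
    (hsum : ∀ c : Fin (k + 1) → Bool → C(Fin k → I, T),
      (∀ i ε t, c i ε t = f (i.insertNth (endpoint ε) t)) →
      ∑ i : Fin (k + 1), (-1 : ℤ) ^ (i : ℕ) • (ζ.1 (c i true) - ζ.1 (c i false)) = 0) :
    ∃ F : C(Fin (k + 1) → I, T), ∀ t ∈ Cube.boundary (Fin (k + 1)), F t = f t := by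
  classical
  have hmem : ∀ (i : Fin (k + 1)) (ε : Bool) (t : Fin k → I),
      (i.insertNth (endpoint ε) t : Fin (k + 1) → I) ∈ Cube.boundary (Fin (k + 1)) := by
    intro i ε t
    refine ⟨i, ?_⟩
    rw [Fin.insertNth_apply_same]
    cases ε <;> simp [endpoint]
  let c : Fin (k + 1) → Bool → C(Fin k → I, T) := fun i ε =>
    ⟨fun t => f (i.insertNth (endpoint ε) t), hf.comp_continuous (by fun_prop) (hmem i ε)⟩
  have hc := hsum c fun _ _ _ => rfl
  -- R retracts the cube onto its bottom and sides, so F = f ∘ R has the right values except on the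
  -- top face.
  let R : C(Fin (k + 1) → I, Fin (k + 1) → I) :=
    ⟨fun t => Fin.cons (cylinderRetraction k (fun i => t i.succ, t 0)).2
      (cylinderRetraction k (fun i => t i.succ, t 0)).1,
      continuous_cons ((cylinderRetraction k).continuous.comp (by fun_prop)).snd
        ((cylinderRetraction k).continuous.comp (by fun_prop)).fst⟩
  have hR : ∀ t, R t ∈ Cube.boundary (Fin (k + 1)) := fun t => by
    rw [mem_boundary_succ]
    rcases cylinderRetraction_mem (fun i => t (Fin.succ i), t 0) with h | h
    · exact Or.inl h
    · exact Or.inr (Or.inr h)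
  have hR2 : ∀ t, (t 0 = 0 ∨ (fun i => t (Fin.succ i)) ∈ Cube.boundary (Fin k)) → R t = t := by
    intro t ht
    have := cylinderRetraction_eq (fun i => t (Fin.succ i), t 0) ht
    change (Fin.cons _ _ : Fin (k + 1) → I) = t
    rw [this]
    exact Fin.cons_self_tail t
  let F : C(Fin (k + 1) → I, T) := ⟨f ∘ R, hf.comp_continuous R.continuous hR⟩
  have hF : ∀ t, (t 0 = 0 ∨ (fun i => t (Fin.succ i)) ∈ Cube.boundary (Fin k)) → F t = f t := by
    intro t ht
    change f (R t) = f t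
    rw [hR2 t ht]
  have hside : ∀ i : Fin k, ∀ ε, cubeFace i.succ (endpoint ε) F = c i.succ ε := by
    intro i ε
    ext t
    refine hF _ (Or.inr ⟨i, ?_⟩)
    simp only [ContinuousMap.coe_mk, Fin.insertNth_apply_same]
    cases ε <;> simp [endpoint]
  have hbot : cubeFace 0 (endpoint false) F = c 0 false := by
    ext t
    exact hF _ (Or.inl (by simp [endpoint]))
  -- ζ sums to zero over the faces of F because it is a cocycle, and over the faces of f by
  -- hypothesis. All faces but the top agree, so the top faces have the same value and are homotopic
  -- rel boundary; homotopy extension then corrects F there.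
  have htop : ζ.1 (cubeFace 0 1 F) = ζ.1 (c 0 true) := by
    have h1 : (coboundary k T A ζ).1 F = 0 := by rw [hζ]; rfl
    rw [coboundary_apply, ← hc, Fin.sum_univ_succ, Fin.sum_univ_succ (n := k)] at h1
    have hs : ∀ i : Fin k, cubeFace i.succ 1 F = c i.succ true ∧
      cubeFace i.succ 0 F = c i.succ false := fun i => ⟨hside i true, hside i false⟩
    simp only [(hs _).1, (hs _).2] at h1
    rw [show cubeFace 0 0 F = c 0 false from hbot] at h1
    simpa using h1
  obtain ⟨N⟩ := homotopicRel_of_eq hζ hd (cubeFace 0 1 F) (c 0 true) (by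
    intro x hx
    exact hF _ (Or.inr (by simpa using hx))) htop
  let h : (Fin (k + 1) → I) × I → T := fun p =>
    if p.1 0 = 1 then N (p.2, fun i => p.1 i.succ) else f p.1
  have hL : ∀ p : (Fin (k + 1) → I) × I,
      (p.1 0 = 0 ∨ (fun i => p.1 (Fin.succ i)) ∈ Cube.boundary (Fin k)) → h p = f p.1 := by
    intro p hp
    by_cases h1 : p.1 0 = 1
    · rcases hp with hp | hp
      · rw [hp] at h1; exact absurd h1 zero_ne_one
      · simp only [h, h1, if_true]
        rw [N.eq_snd _ hp]
        change f _ = f _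
        congr 1
        exact insertNth_zero_tail h1
    · simp only [h, h1, if_false]
  obtain ⟨G, hG⟩ := exists_map_eq_on_boundary_of_homotopy F h (by
      have : {p : (Fin (k + 1) → I) × I | p.1 ∈ Cube.boundary (Fin (k + 1))}
          = {p | p.1 0 = 1} ∪ {p | p.1 0 = 0 ∨ (fun i => p.1 (Fin.succ i)) ∈
            Cube.boundary (Fin k)} := by
        ext p
        refine mem_boundary_succ.trans ?_
        simp only [Set.mem_union, Set.mem_ofPred_eq]
        tauto
      rw [this]
      refine ContinuousOn.union_of_isClosed ?_ ?_ (isClosed_coord_eq 0 1)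
        ((isClosed_coord_eq 0 0).union (isClosed_tail_mem.preimage continuous_fst))
      · refine ContinuousOn.congr (f := fun p => N (p.2, fun i => p.1 i.succ))
          (by fun_prop) fun p hp => ?_
        exact if_pos hp
      · refine ContinuousOn.congr (f := fun p => f p.1)
          (hf.comp (f := Prod.fst) continuous_fst.continuousOn ?_) fun p hp => hL p hp
        intro p hp
        rw [mem_boundary_succ]
        rcases hp with hp | hp
        · exact Or.inl hp
        · exact Or.inr (Or.inr hp))
    (by
      intro t ht
      by_cases h1 : t 0 = 1
      · simp only [h, h1, if_true, N.apply_zero]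
        change F _ = F _
        congr 1
        exact insertNth_zero_tail h1
      · have h2 := mem_boundary_succ.1 ht
        simp only [h1, false_or] at h2
        rw [hL _ h2, hF _ h2])
  refine ⟨G, fun t ht => ?_⟩
  rw [hG t ht]
  by_cases h1 : t 0 = 1
  · simp only [h, h1, if_true, N.apply_one]
    change f _ = f _
    congr 1
    exact insertNth_zero_tail h1
  · simp only [h, h1, if_false]

/-- A map on a cube can be changed in the interior so that a cochain takes a given value. -/
theorem exists_map_with_value {k : ℕ} {ζ : Cochain k T A} (hζ : coboundary k T A ζ = 0)
    (F : C(Fin k → I, T)) (hs : ∀ α : A, ∃ q : GenLoop (Fin k) T (F 0), ζ.1 q.1 = α) (α : A) :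
    ∃ G : C(Fin k → I, T), (∀ x ∈ Cube.boundary (Fin k), G x = F x) ∧ ζ.1 G = α := by
  -- Growing the boundary of this loop from the corner value to F changes its value by ζ(F) -
  -- ζ(const), whence the choice.
  obtain ⟨q, hq⟩ := hs (α - ζ.1 F + ζ.1 (ContinuousMap.const _ (F 0)))
  let B : C((Fin k → I) × I, T) := ⟨fun p => shrink F (p.1, unitInterval.symm p.2), by fun_prop⟩
  have B0 : endMap B 0 = ContinuousMap.const _ (F 0) := by
    ext x
    simp [endMap, B, shrink_one]
  have B1 : endMap B 1 = F := by
    ext x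
    simp [endMap, B, shrink_zero]
  obtain ⟨H, hH0, hH⟩ := exists_homotopy_extension q.1 B B.continuous.continuousOn (by
    intro x hx
    rw [q.2 x hx]
    exact DFunLike.congr_fun B0 x)
  refine ⟨endMap H 1, fun x hx => ?_, ?_⟩
  · exact (hH x hx 1).trans (DFunLike.congr_fun B1 x)
  · have := endMap_sub_endMap_of_sides hζ H B hH
    have e0 : endMap H 0 = q.1 := by ext x; exact hH0 x
    rw [e0, B0, B1, hq, sub_eq_iff_eq_add] at this
    rw [this]
    abel

end HomotopyExtension

/-! ### Lifting to spaces of paths -/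

section PathLift

variable {K A : Type*} [TopologicalSpace K] [AddCommGroup A]

/-- The cube adjoint to a cube in a space of paths. -/
def pathCube {k : ℕ} (d : C(Fin k → I, C(I, K))) : SingularCube (k + 1) K :=
  ⟨fun t => d (fun i => t i.succ) (t 0), by fun_prop⟩

/-- The map on the boundary of a cube prescribed by a family of paths over the boundary of a face,
together with the initial and end points of the paths sought. -/
def pathBoundary {k : ℕ} (k₀ : K) (G : C(Fin k → I, K)) (f : (Fin k → I) → C(I, K)) :
    (Fin (k + 1) → I) → K :=
  open Classical in
  fun t => if t 0 = 0 then k₀ else if t 0 = 1 then G (fun i => t i.succ)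
    else f (fun i => t i.succ) (t 0)

theorem pathBoundary_zero {k : ℕ} {k₀ : K} {G : C(Fin k → I, K)} {f : (Fin k → I) → C(I, K)}
    {t : Fin (k + 1) → I} (ht : t 0 = 0) : pathBoundary k₀ G f t = k₀ := by
  simp [pathBoundary, ht]

theorem pathBoundary_one {k : ℕ} {k₀ : K} {G : C(Fin k → I, K)} {f : (Fin k → I) → C(I, K)}
    {t : Fin (k + 1) → I} (ht : t 0 = 1) :
    pathBoundary k₀ G f t = G (fun i => t i.succ) := by
  simp [pathBoundary, ht]

theorem pathBoundary_side {k : ℕ} {k₀ : K} {G : C(Fin k → I, K)} {f : (Fin k → I) → C(I, K)}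
    (h0 : ∀ x ∈ Cube.boundary (Fin k), f x 0 = k₀)
    (h1 : ∀ x ∈ Cube.boundary (Fin k), f x 1 = G x)
    {t : Fin (k + 1) → I} (ht : (fun i => t (Fin.succ i)) ∈ Cube.boundary (Fin k)) :
    pathBoundary k₀ G f t = f (fun i => t i.succ) (t 0) := by
  by_cases t0 : t 0 = 0
  · rw [pathBoundary_zero t0, t0, h0 _ ht]
  by_cases t1 : t 0 = 1
  · rw [pathBoundary_one t1, t1, h1 _ ht]
  simp [pathBoundary, t0, t1]

theorem continuousOn_pathBoundary {k : ℕ} {k₀ : K} {G : C(Fin k → I, K)}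
    {f : (Fin k → I) → C(I, K)} (hf : ContinuousOn f (Cube.boundary (Fin k)))
    (h0 : ∀ x ∈ Cube.boundary (Fin k), f x 0 = k₀)
    (h1 : ∀ x ∈ Cube.boundary (Fin k), f x 1 = G x) :
    ContinuousOn (pathBoundary k₀ G f) (Cube.boundary (Fin (k + 1))) := by
  have hset : Cube.boundary (Fin (k + 1)) = {t | t 0 = 0} ∪ ({t | t 0 = 1}
      ∪ {t | (fun i => t (Fin.succ i)) ∈ Cube.boundary (Fin k)}) := by
    ext t; exact mem_boundary_succ
  have hc : ∀ ε : I, IsClosed {t : Fin (k + 1) → I | t 0 = ε} := fun ε =>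
    isClosed_eq (continuous_apply 0) continuous_const
  rw [hset]
  refine ContinuousOn.union_of_isClosed ?_ (ContinuousOn.union_of_isClosed ?_ ?_ (hc 1)
    isClosed_tail_mem) (hc 0) ((hc 1).union isClosed_tail_mem)
  · exact continuousOn_const.congr fun t ht => pathBoundary_zero ht
  · exact ContinuousOn.congr (f := fun t => G fun i => t i.succ) (by fun_prop)
      fun t ht => pathBoundary_one ht
  · refine ContinuousOn.congr (f := fun t => f (fun i => t (Fin.succ i)) (t 0)) ?_
      fun t ht => pathBoundary_side h0 h1 ht
    have h2 : ContinuousOn (fun t : Fin (k + 1) → I => f fun i => t (Fin.succ i))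
        {t | (fun i => t (Fin.succ i)) ∈ Cube.boundary (Fin k)} :=
      hf.comp (f := fun (t : Fin (k + 1) → I) i => t (Fin.succ i))
        continuous_tail.continuousOn fun t ht => ht
    exact ContinuousEval.continuous_eval.comp_continuousOn
      (h2.prodMk (continuous_apply 0).continuousOn)

theorem exists_paths_of_extension {k : ℕ} {k₀ : K} {G : C(Fin k → I, K)}
    {f : (Fin k → I) → C(I, K)} (h0 : ∀ x ∈ Cube.boundary (Fin k), f x 0 = k₀)
    (h1 : ∀ x ∈ Cube.boundary (Fin k), f x 1 = G x) (F : C(Fin (k + 1) → I, K))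
    (hF : ∀ t ∈ Cube.boundary (Fin (k + 1)), F t = pathBoundary k₀ G f t) :
    ∃ Γ : C(Fin k → I, C(I, K)), (∀ x ∈ Cube.boundary (Fin k), Γ x = f x) ∧
      (∀ x, Γ x 0 = k₀) ∧ (∀ x, Γ x 1 = G x) ∧ pathCube Γ = F := by
  refine ⟨ContinuousMap.curry ⟨fun p => F (Fin.cons p.2 p.1),
    F.continuous.comp (continuous_cons continuous_snd continuous_fst)⟩, fun x hx => ?_, fun x => ?_,
    fun x => ?_, ?_⟩
  · ext u
    change F _ = _
    rw [hF _ (mem_boundary_succ.2 (Or.inr (Or.inr (by simpa using hx)))),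
      pathBoundary_side h0 h1 (by simpa using hx)]
    simp
  · change F _ = _
    rw [hF _ (mem_boundary_succ.2 (Or.inl rfl)), pathBoundary_zero rfl]
  · change F _ = _
    rw [hF _ (mem_boundary_succ.2 (Or.inr (Or.inl rfl))), pathBoundary_one rfl]
    simp
  · ext t
    exact congrArg F (Fin.cons_self_tail t)

/-- With this, extension into a space with trivial π_k is the case ζ = 0 of the obstruction lemma.
-/
theorem detects_zero {k : ℕ} (h : ∀ x : K, Subsingleton (π_ k K x)) :
    Detects (0 : Cochain k K ℤ) := fun x q _ =>
  Quotient.exact (Subsingleton.elim (h := h x) (Quotient.mk _ q) (Quotient.mk _ GenLoop.const))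

theorem exists_boundary_extension {k : ℕ} (h : ∀ x : K, Subsingleton (π_ k K x))
    (f : (Fin (k + 1) → I) → K) (hf : ContinuousOn f (Cube.boundary (Fin (k + 1)))) :
    ∃ F : C(Fin (k + 1) → I, K), ∀ t ∈ Cube.boundary (Fin (k + 1)), F t = f t := by
  refine exists_extension_of_sum_eq_zero (map_zero _) (detects_zero h) f hf fun c _ => ?_
  refine Finset.sum_eq_zero fun i _ => ?_
  change (-1 : ℤ) ^ (i : ℕ) • ((0 : ℤ) - 0) = 0
  simp

theorem exists_paths {k : ℕ} (h : ∀ x : K, Subsingleton (π_ k K x)) {k₀ : K}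
    {G : C(Fin k → I, K)} {f : (Fin k → I) → C(I, K)}
    (hf : ContinuousOn f (Cube.boundary (Fin k)))
    (h0 : ∀ x ∈ Cube.boundary (Fin k), f x 0 = k₀)
    (h1 : ∀ x ∈ Cube.boundary (Fin k), f x 1 = G x) :
    ∃ Γ : C(Fin k → I, C(I, K)), (∀ x ∈ Cube.boundary (Fin k), Γ x = f x) ∧
      (∀ x, Γ x 0 = k₀) ∧ (∀ x, Γ x 1 = G x) := by
  obtain ⟨F, hF⟩ := exists_boundary_extension h _ (continuousOn_pathBoundary hf h0 h1)
  obtain ⟨Γ, a, b, c, -⟩ := exists_paths_of_extension h0 h1 F hF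
  exact ⟨Γ, a, b, c⟩

theorem exists_paths_with_value {k : ℕ} (h : ∀ x : K, Subsingleton (π_ k K x))
    {ζ : Cochain (k + 1) K A} (hζ : coboundary (k + 1) K A ζ = 0)
    (hs : ∀ (x : K) (α : A), ∃ q : GenLoop (Fin (k + 1)) K x, ζ.1 q.1 = α) {k₀ : K}
    {G : C(Fin k → I, K)} {f : (Fin k → I) → C(I, K)}
    (hf : ContinuousOn f (Cube.boundary (Fin k)))
    (h0 : ∀ x ∈ Cube.boundary (Fin k), f x 0 = k₀)
    (h1 : ∀ x ∈ Cube.boundary (Fin k), f x 1 = G x) (α : A) :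
    ∃ Γ : C(Fin k → I, C(I, K)), (∀ x ∈ Cube.boundary (Fin k), Γ x = f x) ∧
      (∀ x, Γ x 0 = k₀) ∧ (∀ x, Γ x 1 = G x) ∧ ζ.1 (pathCube Γ) = α := by
  obtain ⟨F, hF⟩ := exists_boundary_extension h _ (continuousOn_pathBoundary hf h0 h1)
  obtain ⟨F', hF', hα⟩ := exists_map_with_value hζ F (hs _) α
  obtain ⟨Γ, a, b, c, d⟩ := exists_paths_of_extension h0 h1 F' fun t ht => by
    rw [hF' t ht, hF t ht]
  exact ⟨Γ, a, b, c, by rw [d, hα]⟩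

/-- In the obstruction over the (k+2)-cube the bottom face is constant and contributes 0, the top
face contributes ζ(G), and the sides have their index shifted by one and so enter with a minus sign.
-/
theorem exists_paths_of_sum_eq {k : ℕ} {ζ : Cochain (k + 1) K A}
    (hζ : coboundary (k + 1) K A ζ = 0) (hd : Detects ζ) {k₀ : K}
    {G : C(Fin (k + 1) → I, K)} {f : (Fin (k + 1) → I) → C(I, K)}
    (hf : ContinuousOn f (Cube.boundary (Fin (k + 1))))
    (h0 : ∀ x ∈ Cube.boundary (Fin (k + 1)), f x 0 = k₀)
    (h1 : ∀ x ∈ Cube.boundary (Fin (k + 1)), f x 1 = G x)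
    (d : Fin (k + 1) → Bool → C(Fin k → I, C(I, K)))
    (hdf : ∀ i ε t, d i ε t = f (i.insertNth (endpoint ε) t))
    (hsum : ζ.1 G = ∑ i : Fin (k + 1), (-1 : ℤ) ^ (i : ℕ) •
      (ζ.1 (pathCube (d i true)) - ζ.1 (pathCube (d i false)))) :
    ∃ Γ : C(Fin (k + 1) → I, C(I, K)), (∀ x ∈ Cube.boundary (Fin (k + 1)), Γ x = f x) ∧
      (∀ x, Γ x 0 = k₀) ∧ (∀ x, Γ x 1 = G x) := by
  obtain ⟨F, hF⟩ := exists_extension_of_sum_eq_zero hζ hd (pathBoundary k₀ G f)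
    (continuousOn_pathBoundary hf h0 h1) (by
      intro c hc
      have c0 : c 0 false = ContinuousMap.const _ k₀ := by
        ext t
        rw [hc, pathBoundary_zero]
        · rfl
        · simp [endpoint]
      have c1 : c 0 true = G := by
        ext t
        rw [hc, pathBoundary_one] <;> simp [endpoint]
      have cs : ∀ i ε, c (Fin.succ i) ε = pathCube (d i ε) := by
        intro i ε
        ext t
        have htail : (fun j => (i.succ.insertNth (endpoint ε) t : Fin (k + 2) → I) (Fin.succ j))
            = i.insertNth (endpoint ε) (fun j => t j.succ) := by
          rw [insertNth_succ_eq_cons]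
          rfl
        rw [hc, pathBoundary_side h0 h1]
        · rw [htail, ← hdf, insertNth_succ_eq_cons]
          rfl
        · rw [htail]
          refine ⟨i, ?_⟩
          rw [Fin.insertNth_apply_same]
          cases ε <;> simp [endpoint]
      rw [Fin.sum_univ_succ, c0, c1, cochain_const, hsum, sub_zero]
      simp only [cs, Fin.val_zero, pow_zero, one_smul, Fin.val_succ, pow_succ, mul_neg, mul_one,
        neg_smul, Finset.sum_neg_distrib, add_neg_cancel])
  obtain ⟨Γ, a, b, c, -⟩ := exists_paths_of_extension h0 h1 F hF
  exact ⟨Γ, a, b, c⟩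

end PathLift

/-! ### The homotopy fiber -/

section Fiber

variable {Y K A : Type*} [TopologicalSpace Y] [TopologicalSpace K] [AddCommGroup A]

theorem isFibration_proj (g : C(Y, K)) (k₀ : K) :
    IsFibration (HomotopyFiber.proj g k₀) := by
  intro W _ h f hf
  -- At time s the old path is followed by the track of g ∘ h up to s, at speed 1 + s; at s = 0 the
  -- old path is unchanged.
  let P : (W × I) × I → K := fun p =>
    if (p.2 : ℝ) * (1 + p.1.2) ≤ 1 then
      (f p.1.1).1.2 (Set.projIcc 0 1 zero_le_one ((p.2 : ℝ) * (1 + p.1.2)))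
    else g (h (p.1.1, Set.projIcc 0 1 zero_le_one ((p.2 : ℝ) * (1 + p.1.2) - 1)))
  have hP : Continuous P := by
    refine Continuous.if_le ?_ ?_ (by fun_prop) continuous_const ?_
    · have h1 : Continuous fun p : (W × I) × I => (f p.1.1).1.2 := by fun_prop
      have h2 : Continuous fun p : (W × I) × I =>
          (Set.projIcc (0 : ℝ) 1 zero_le_one ((p.2 : ℝ) * (1 + p.1.2))) :=
        continuous_projIcc.comp (by fun_prop)
      exact ContinuousEval.continuous_eval.comp (h1.prodMk h2)
    · have h2 : Continuous fun p : (W × I) × I =>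
          (Set.projIcc (0 : ℝ) 1 zero_le_one ((p.2 : ℝ) * (1 + p.1.2) - 1)) :=
        continuous_projIcc.comp (by fun_prop)
      fun_prop
    · intro p hp
      rw [hp, sub_self, Set.projIcc_right, Set.projIcc_left]
      have h1 := (f p.1.1).2.2
      have h2 := hf p.1.1
      change (f p.1.1).1.1 = _ at h2
      rw [h2] at h1
      exact h1
  let Γ : C(W × I, C(I, K)) := ContinuousMap.curry ⟨P, hP⟩
  have hΓ : ∀ w s, Γ w s = P (w, s) := fun _ _ => rfl
  refine ⟨⟨fun w => ⟨(h w, Γ w), ?_, ?_⟩, by fun_prop⟩, fun x => ?_, fun y => rfl⟩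
  · rw [hΓ]
    simp only [P, Set.Icc.coe_zero, zero_mul, zero_le_one, if_true, Set.projIcc_left]
    exact (f w.1).2.1
  · rw [hΓ]
    simp only [P, Set.Icc.coe_one, one_mul]
    by_cases h0 : (w.2 : ℝ) ≤ 0
    · have h0' : w.2 = 0 := le_antisymm h0 w.2.2.1
      have hw : w = (w.1, 0) := Prod.ext rfl h0'
      rw [hw]
      simp only [Set.Icc.coe_zero, add_zero, le_refl, if_true, Set.projIcc_right]
      refine (f w.1).2.2.trans ?_
      rw [← hf]
      rfl
    · rw [if_neg (by linarith)]
      simp only [add_sub_cancel_left, Set.projIcc_val]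
  · refine Subtype.ext (Prod.ext (hf x).symm ?_)
    ext s
    change P ((x, 0), s) = _
    simp only [P, Set.Icc.coe_zero, add_zero, mul_one, s.2.2, if_true, Set.projIcc_val]

theorem surjective_proj [PathConnectedSpace K] (g : C(Y, K)) (k₀ : K) :
    Function.Surjective (HomotopyFiber.proj g k₀) := fun y => by
  let γ := PathConnectedSpace.somePath k₀ (g y)
  exact ⟨⟨(y, γ.toContinuousMap), γ.source, γ.target⟩, rfl⟩

theorem exists_lift_of_paths {M : Type*} [TopologicalSpace M] (g : C(Y, K)) (k₀ : K) (f : C(M, Y))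
    (Γ : C(M, C(I, K))) (h0 : ∀ x, Γ x 0 = k₀) (h1 : ∀ x, Γ x 1 = g (f x)) :
    ∃ F : C(M, HomotopyFiber g k₀), (HomotopyFiber.proj g k₀).comp F = f :=
  ⟨⟨fun x => ⟨(f x, Γ x), h0 x, h1 x⟩, by fun_prop⟩, rfl⟩

theorem exists_lift_of_nullhomotopic [PathConnectedSpace K] {M : Type*} [TopologicalSpace M]
    (g : C(Y, K)) (k₀ : K) (f : C(M, Y)) (h : (g.comp f).Nullhomotopic) :
    ∃ F : C(M, HomotopyFiber g k₀), (HomotopyFiber.proj g k₀).comp F = f := by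
  obtain ⟨c, hc⟩ := h
  let γ := PathConnectedSpace.somePath k₀ c
  have h1 : (ContinuousMap.const M k₀).Homotopic (ContinuousMap.const M c) :=
    ⟨⟨⟨fun p => γ p.1, by fun_prop⟩, fun x => γ.source, fun x => γ.target⟩⟩
  obtain ⟨H⟩ := h1.trans hc.symm
  exact exists_lift_of_paths g k₀ f
    (ContinuousMap.curry ⟨fun p => H (p.2, p.1), by fun_prop⟩)
    (fun x => H.apply_zero x) (fun x => H.apply_one x)

variable {g : C(Y, K)} {k₀ : K} {e₀ : HomotopyFiber g k₀} {y₀ : Y}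

/-- The family of paths prescribed on the boundary of a cylinder by two loops in the homotopy
fiber. -/
def loopPaths {k : ℕ} (p p' : GenLoop (Fin k) (HomotopyFiber g k₀) e₀) (t : Fin (k + 1) → I) :
    C(I, K) :=
  open Classical in
  if t 0 = 0 then (p fun i => t i.succ).1.2 else (p' fun i => t i.succ).1.2

theorem loopPaths_eq {k : ℕ} (p p' : GenLoop (Fin k) (HomotopyFiber g k₀) e₀)
    {t : Fin (k + 1) → I}
    (ht : t 0 = 1 ∨ (fun i => t (Fin.succ i)) ∈ Cube.boundary (Fin k)) :
    loopPaths p p' t = (p' fun i => t i.succ).1.2 := by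
  by_cases h : t 0 = 0
  · rcases ht with ht | ht
    · rw [h] at ht; exact absurd ht zero_ne_one
    · simp only [loopPaths, h, if_true]
      rw [GenLoop.boundary p _ ht, GenLoop.boundary p' _ ht]
  · simp only [loopPaths, h, if_false]

theorem continuous_genLoop {N X : Type*} [TopologicalSpace X] {x : X} (p : GenLoop N X x) :
    Continuous p := p.1.continuous

theorem continuousOn_loopPaths {k : ℕ} (p p' : GenLoop (Fin k) (HomotopyFiber g k₀) e₀) :
    ContinuousOn (loopPaths p p') (Cube.boundary (Fin (k + 1))) := by
  have hset : Cube.boundary (Fin (k + 1)) = {t | t 0 = 0} ∪ ({t | t 0 = 1}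
      ∪ {t | (fun i => t (Fin.succ i)) ∈ Cube.boundary (Fin k)}) := by
    ext t; exact mem_boundary_succ
  have hc : ∀ ε : I, IsClosed {t : Fin (k + 1) → I | t 0 = ε} := fun ε =>
    isClosed_eq (continuous_apply 0) continuous_const
  have hp : ∀ p : GenLoop (Fin k) (HomotopyFiber g k₀) e₀,
      Continuous fun t : Fin (k + 1) → I => (p fun i => t (Fin.succ i)).1.2 := fun p =>
    continuous_snd.comp (continuous_subtype_val.comp
      ((continuous_genLoop p).comp continuous_tail))
  rw [hset]
  refine ContinuousOn.union_of_isClosed ?_ ?_ (hc 0) ((hc 1).union isClosed_tail_mem)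
  · exact (hp p).continuousOn.congr fun t ht => if_pos ht
  · exact (hp p').continuousOn.congr fun t ht => loopPaths_eq p p' ht

/-- A homotopy in the fiber is a cube in Y with a family of paths over it. The cube may be replaced
by `G'` with the same boundary; this freedom is needed in degree n - 1, where the given homotopy
need not lift. -/
theorem homotopic_of_paths {k : ℕ} {p p' : GenLoop (Fin k) (HomotopyFiber g k₀) e₀}
    (G : C(Fin (k + 1) → I, Y))
    (hG0 : ∀ t, t 0 = 0 → G t = (p fun i => t (Fin.succ i)).1.1)
    (hG1 : ∀ t, t 0 = 1 → G t = (p' fun i => t (Fin.succ i)).1.1)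
    (hGs : ∀ t, (fun i => t (Fin.succ i)) ∈ Cube.boundary (Fin k) → G t = e₀.1.1)
    (hlift : ∀ _ : ContinuousOn (loopPaths p p') (Cube.boundary (Fin (k + 1))),
      (∀ t ∈ Cube.boundary (Fin (k + 1)), loopPaths p p' t 0 = k₀) →
      (∀ t ∈ Cube.boundary (Fin (k + 1)), loopPaths p p' t 1 = g (G t)) →
      ∃ (G' : C(Fin (k + 1) → I, Y)) (Γ : C(Fin (k + 1) → I, C(I, K))),
        (∀ t ∈ Cube.boundary (Fin (k + 1)), G' t = G t) ∧
        (∀ t ∈ Cube.boundary (Fin (k + 1)), Γ t = loopPaths p p' t) ∧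
        (∀ t, Γ t 0 = k₀) ∧ (∀ t, Γ t 1 = g (G' t))) :
    GenLoop.Homotopic p p' := by
  have hbd : ∀ t ∈ Cube.boundary (Fin (k + 1)), ∃ e : HomotopyFiber g k₀,
      loopPaths p p' t = e.1.2 ∧ G t = e.1.1 := by
    intro t ht
    rcases mem_boundary_succ.1 ht with h | h | h
    · exact ⟨_, if_pos h, hG0 t h⟩
    · exact ⟨_, loopPaths_eq p p' (Or.inl h), hG1 t h⟩
    · refine ⟨_, loopPaths_eq p p' (Or.inr h), ?_⟩
      rw [hGs t h, GenLoop.boundary p' _ h]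
  obtain ⟨G', Γ, hG', hΓ, hΓ0, hΓ1⟩ := hlift (continuousOn_loopPaths p p')
    (fun t ht => by
      obtain ⟨e, h, -⟩ := hbd t ht
      rw [h, e.2.1])
    (fun t ht => by
      obtain ⟨e, h, h'⟩ := hbd t ht
      rw [h, h', e.2.2])
  let H : C(I × (Fin k → I), HomotopyFiber g k₀) :=
    ⟨fun r => ⟨(G' (Fin.cons r.1 r.2), Γ (Fin.cons r.1 r.2)), hΓ0 _, hΓ1 _⟩, by
      have := continuous_cons (Z := I × (Fin k → I)) (k := k) (continuous_fst) continuous_snd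
      exact ((G'.continuous.comp this).prodMk (Γ.continuous.comp this)).subtype_mk _⟩
  have hH0 : ∀ x, H (0, x) = p x := by
    intro x
    have hm : (Fin.cons 0 x : Fin (k + 1) → I) ∈ Cube.boundary (Fin (k + 1)) :=
      mem_boundary_succ.2 (Or.inl rfl)
    refine Subtype.ext (Prod.ext ?_ ?_)
    · exact (hG' _ hm).trans (hG0 _ rfl)
    · exact (hΓ _ hm).trans (if_pos rfl)
  have hH1 : ∀ x, H (1, x) = p' x := by
    intro x
    have hm : (Fin.cons 1 x : Fin (k + 1) → I) ∈ Cube.boundary (Fin (k + 1)) :=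
      mem_boundary_succ.2 (Or.inr (Or.inl rfl))
    refine Subtype.ext (Prod.ext ?_ ?_)
    · exact (hG' _ hm).trans (hG1 _ rfl)
    · exact (hΓ _ hm).trans (loopPaths_eq p p' (Or.inl rfl))
  refine ⟨⟨⟨H, hH0, hH1⟩, fun s x hx => ?_⟩⟩
  have hm : (Fin.cons s x : Fin (k + 1) → I) ∈ Cube.boundary (Fin (k + 1)) :=
    mem_boundary_succ.2 (Or.inr (Or.inr hx))
  change H (s, x) = p x
  rw [GenLoop.boundary p x hx]
  refine Subtype.ext (Prod.ext ?_ ?_)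
  · exact (hG' _ hm).trans (hGs _ hx)
  · refine (hΓ _ hm).trans ((loopPaths_eq p p' (Or.inr hx)).trans ?_)
    exact congrArg (fun e => e.1.2) (GenLoop.boundary p' x hx)

end Fiber

/-! ### Homotopy groups of the homotopy fiber -/

section FiberHomotopy

variable {Y K A : Type*} [TopologicalSpace Y] [TopologicalSpace K] [AddCommGroup A]
variable {g : C(Y, K)} {k₀ : K} {e₀ : HomotopyFiber g k₀} {y₀ : Y}

/-- The cube adjoint to a homotopy of generalized loops. -/
def homotopyCube {X : Type*} [TopologicalSpace X] {k : ℕ} {x : X} {p q : GenLoop (Fin k) X x}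
    (H : p.1.HomotopyRel q.1 (Cube.boundary (Fin k))) : C(Fin (k + 1) → I, X) :=
  ⟨fun t => H (t 0, fun i => t i.succ), by fun_prop⟩

theorem homotopic_of_lift_homotopy {k : ℕ} {p p' : GenLoop (Fin k) (HomotopyFiber g k₀) e₀}
    (he : HomotopyFiber.proj g k₀ e₀ = y₀)
    (H : (genLoopMap (HomotopyFiber.proj g k₀) he p).1.HomotopyRel
      (genLoopMap (HomotopyFiber.proj g k₀) he p').1 (Cube.boundary (Fin k)))
    (hlift : ∀ _ : ContinuousOn (loopPaths p p') (Cube.boundary (Fin (k + 1))),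
      (∀ t ∈ Cube.boundary (Fin (k + 1)), loopPaths p p' t 0 = k₀) →
      (∀ t ∈ Cube.boundary (Fin (k + 1)), loopPaths p p' t 1 = g (homotopyCube H t)) →
      ∃ (G' : C(Fin (k + 1) → I, Y)) (Γ : C(Fin (k + 1) → I, C(I, K))),
        (∀ t ∈ Cube.boundary (Fin (k + 1)), G' t = homotopyCube H t) ∧
        (∀ t ∈ Cube.boundary (Fin (k + 1)), Γ t = loopPaths p p' t) ∧
        (∀ t, Γ t 0 = k₀) ∧ (∀ t, Γ t 1 = g (G' t))) :
    GenLoop.Homotopic p p' := by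
  refine homotopic_of_paths (homotopyCube H) (fun t ht => ?_) (fun t ht => ?_) (fun t ht => ?_)
    hlift
  · change H (t 0, _) = _
    rw [ht]
    exact H.apply_zero _
  · change H (t 0, _) = _
    rw [ht]
    exact H.apply_one _
  · refine (H.eq_fst _ ht).trans ?_
    exact ((genLoopMap (HomotopyFiber.proj g k₀) he p).2 _ ht).trans he.symm

theorem homotopic_of_homotopic_proj {k : ℕ} (h : ∀ x : K, Subsingleton (π_ (k + 1) K x))
    {p p' : GenLoop (Fin k) (HomotopyFiber g k₀) e₀}
    (he : HomotopyFiber.proj g k₀ e₀ = y₀)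
    (hpp : GenLoop.Homotopic (genLoopMap (HomotopyFiber.proj g k₀) he p)
      (genLoopMap (HomotopyFiber.proj g k₀) he p')) :
    GenLoop.Homotopic p p' := by
  obtain ⟨H⟩ := hpp
  refine homotopic_of_lift_homotopy he H fun hf h0 h1 => ?_
  obtain ⟨Γ, a, b, c⟩ := exists_paths (G := g.comp (homotopyCube H)) h hf h0 h1
  exact ⟨homotopyCube H, Γ, fun _ _ => rfl, a, b, c⟩

theorem exists_genLoop_proj_eq {k : ℕ} (h : ∀ x : K, Subsingleton (π_ k K x))
    (he : HomotopyFiber.proj g k₀ e₀ = y₀) (q : GenLoop (Fin k) Y y₀) :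
    ∃ p : GenLoop (Fin k) (HomotopyFiber g k₀) e₀,
      genLoopMap (HomotopyFiber.proj g k₀) he p = q := by
  obtain ⟨Γ, a, b, c⟩ := exists_paths (k₀ := k₀) (G := g.comp q.1) (f := fun _ => e₀.1.2) h
    continuousOn_const (fun _ _ => e₀.2.1) (fun x hx => by
      rw [e₀.2.2, ContinuousMap.comp_apply, q.2 x hx, ← he]
      rfl)
  refine ⟨⟨⟨fun x => ⟨(q.1 x, Γ x), b x, c x⟩, by fun_prop⟩, fun x hx => ?_⟩, rfl⟩
  refine Subtype.ext (Prod.ext ?_ (a x hx))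
  exact (q.2 x hx).trans he.symm

theorem bijective_piMap_proj {k : ℕ} (h : ∀ x : K, Subsingleton (π_ k K x))
    (h' : ∀ x : K, Subsingleton (π_ (k + 1) K x)) (he : HomotopyFiber.proj g k₀ e₀ = y₀) :
    Function.Bijective (piMap k (HomotopyFiber.proj g k₀) he) := by
  refine ⟨fun a b => ?_, fun c => ?_⟩
  · refine Quotient.inductionOn₂ a b fun p q hpq => ?_
    exact Quotient.sound (homotopic_of_homotopic_proj h' he (Quotient.exact hpq))
  · refine Quotient.inductionOn c fun q => ?_
    obtain ⟨p, hp⟩ := exists_genLoop_proj_eq h he q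
    exact ⟨Quotient.mk _ p, congrArg (Quotient.mk _) hp⟩

/-- The paths of p form a homotopy from the constant `k₀` to the projected loop. On the sides it
agrees with the homotopy that follows the path of `e₀` everywhere, and the latter has constant ends.
-/
theorem value_proj_eq_zero {m : ℕ} {ζ : Cochain (m + 1) K A}
    (hζ : coboundary (m + 1) K A ζ = 0)
    (p : GenLoop (Fin (m + 1)) (HomotopyFiber g k₀) e₀) :
    ζ.1 (g.comp ((HomotopyFiber.proj g k₀).comp p.1)) = 0 := by
  have := endMap_sub_endMap_of_sides hζ
    (⟨fun r => (p.1 r.1).1.2 r.2, by fun_prop⟩ : C((Fin (m + 1) → I) × I, K))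
    (⟨fun r => e₀.1.2 r.2, by fun_prop⟩ : C((Fin (m + 1) → I) × I, K)) (fun x hx t => by
      change (p.1 x).1.2 t = e₀.1.2 t
      rw [p.2 x hx])
  have e1 : endMap (⟨fun r => (p.1 r.1).1.2 r.2, by fun_prop⟩ : C((Fin (m + 1) → I) × I, K)) 1
      = g.comp ((HomotopyFiber.proj g k₀).comp p.1) := by
    ext x; exact (p.1 x).2.2
  have e0 : endMap (⟨fun r => (p.1 r.1).1.2 r.2, by fun_prop⟩ : C((Fin (m + 1) → I) × I, K)) 0
      = ContinuousMap.const _ k₀ := by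
    ext x; exact (p.1 x).2.1
  have e2 : ∀ ε, endMap (⟨fun r => e₀.1.2 r.2, by fun_prop⟩ : C((Fin (m + 1) → I) × I, K)) ε
      = ContinuousMap.const _ (e₀.1.2 ε) := fun ε => rfl
  rw [e1, e0, e2, e2, cochain_const, cochain_const, cochain_const] at this
  simpa using this

theorem subsingleton_pi_fiber {m : ℕ} {ζ : Cochain (m + 1) K A}
    (hζ : coboundary (m + 1) K A ζ = 0) (h : ∀ x : K, Subsingleton (π_ (m + 2) K x))
    (he : HomotopyFiber.proj g k₀ e₀ = y₀)
    (hinj : ∀ u u' : GenLoop (Fin (m + 1)) Y y₀, ζ.1 (g.comp u.1) = ζ.1 (g.comp u'.1) →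
      GenLoop.Homotopic u u') :
    Subsingleton (π_ (m + 1) (HomotopyFiber g k₀) e₀) := by
  refine ⟨fun a b => ?_⟩
  refine Quotient.inductionOn₂ a b fun p q => ?_
  refine Quotient.sound (homotopic_of_homotopic_proj h he (hinj _ _ ?_))
  exact (value_proj_eq_zero hζ p).trans (value_proj_eq_zero hζ q).symm

/-- The projections of two loops are homotopic since π_m(Y) is trivial. The value of ζ that the
homotopy must have in order to lift is forced by the paths on its boundary, and is achieved by
altering the homotopy in the interior. -/
theorem subsingleton_pi_fiber_pred {m : ℕ} {ζ : Cochain (m + 1) K A}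
    (hζ : coboundary (m + 1) K A ζ = 0) (hd : Detects ζ)
    (he : HomotopyFiber.proj g k₀ e₀ = y₀) (hA : m = 0 → Subsingleton A)
    (hY : Subsingleton (π_ m Y y₀))
    (hsurj : ∀ α : A, ∃ u : GenLoop (Fin (m + 1)) Y y₀, ζ.1 (g.comp u.1) = α) :
    Subsingleton (π_ m (HomotopyFiber g k₀) e₀) := by
  refine ⟨fun a b => ?_⟩
  refine Quotient.inductionOn₂ a b fun p p' => Quotient.sound ?_
  obtain ⟨H⟩ : GenLoop.Homotopic (genLoopMap (HomotopyFiber.proj g k₀) he p)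
      (genLoopMap (HomotopyFiber.proj g k₀) he p') :=
    Quotient.exact (Subsingleton.elim (h := hY) (Quotient.mk _ _) (Quotient.mk _ _))
  refine homotopic_of_lift_homotopy he H fun hf h0 h1 => ?_
  let d : Fin (m + 1) → Bool → C(Fin m → I, C(I, K)) := fun i ε =>
    ⟨fun t => loopPaths p p' (i.insertNth (endpoint ε) t),
      hf.comp_continuous (by fun_prop) fun t => ⟨i, by
        rw [Fin.insertNth_apply_same]; cases ε <;> simp [endpoint]⟩⟩
  obtain ⟨G', hG', hα⟩ := exists_map_with_value
    (ζ := cochainPullback (m + 1) A g ζ) (by rw [coboundary_pullback, hζ, map_zero])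
    (homotopyCube H) (fun α => by
      -- For m = 0 the cube has no sides, so its corner need not be `y₀`, where surjectivity is
      -- known; but then the coefficients are trivial.
      rcases Nat.eq_zero_or_pos m with hm | hm
      · exact ⟨GenLoop.const, Subsingleton.elim (h := hA hm) _ _⟩
      · have : homotopyCube H 0 = y₀ := by
          have hb : (0 : Fin m → I) ∈ Cube.boundary (Fin m) := ⟨⟨0, hm⟩, Or.inl rfl⟩
          exact (H.eq_fst _ hb).trans ((genLoopMap (HomotopyFiber.proj g k₀) he p).2 _ hb)
        rw [this]
        exact hsurj α)
    (∑ i : Fin (m + 1), (-1 : ℤ) ^ (i : ℕ) •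
      (ζ.1 (pathCube (d i true)) - ζ.1 (pathCube (d i false))))
  obtain ⟨Γ, a, b, c⟩ := exists_paths_of_sum_eq hζ hd (G := g.comp G') hf h0
    (fun t ht => by rw [h1 t ht, ContinuousMap.comp_apply, hG' t ht]) d (fun _ _ _ => rfl) hα
  exact ⟨G', Γ, hG', a, b, c⟩

theorem piMap_mul {X : Type*} [TopologicalSpace X] {k : ℕ} [Nonempty (Fin k)] (f : C(X, Y)) {x : X}
    (h : f x = y₀) (a b : π_ k X x) :
    piMap k f h (a * b) = piMap k f h a * piMap k f h b := by
  let i : Fin k := Classical.arbitrary _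
  refine Quotient.inductionOn₂ a b fun p q => ?_
  have e1 := HomotopyGroup.mul_spec (i := i) (p := p) (q := q)
  have e2 := HomotopyGroup.mul_spec (i := i) (p := genLoopMap f h p) (q := genLoopMap f h q)
  refine (congrArg (piMap k f h) e1).trans (Eq.trans ?_ e2.symm)
  change (Quotient.mk _ (genLoopMap f h (GenLoop.transAt i q p)) : π_ k Y y₀) = Quotient.mk _ _
  congr 1
  ext t
  change f (ite _ _ _) = ite _ _ _
  split_ifs <;> rfl

end FiberHomotopy

/-! ### Attaching cells -/

section CubePoint

/-- The point of the cube with the given centered coordinates. -/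
def cubePoint {k : ℕ} (x : Fin k → ℝ) : Fin k → I :=
  fun i => Set.projIcc 0 1 zero_le_one ((x i + 1) / 2)

theorem continuous_cubePoint {k : ℕ} : Continuous (cubePoint (k := k)) :=
  continuous_pi fun i => continuous_projIcc.comp (by fun_prop)

theorem centered_cubePoint {k : ℕ} {x : Fin k → ℝ} (hx : ‖x‖ ≤ 1) :
    centered (cubePoint x) = x := by
  funext i
  have := abs_le.1 ((norm_le_pi_norm x i).trans hx)
  rw [centered, cubePoint, Set.projIcc_of_mem zero_le_one ⟨by linarith, by linarith⟩]
  simp only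
  ring

theorem cubePoint_centered {k : ℕ} (t : Fin k → I) : cubePoint (centered t) = t := by
  funext i
  rw [cubePoint, centered]
  conv_rhs => rw [← Set.projIcc_val zero_le_one (t i)]
  congr 1
  ring

/-- Cells are balls of the sup norm, so an affine change of coordinates turns them into cubes and
their spheres into cube boundaries. -/
theorem mem_boundary_iff_norm {k : ℕ} {t : Fin k → I} :
    t ∈ Cube.boundary (Fin k) ↔ ‖centered t‖ = 1 := by
  refine ⟨norm_centered_eq_one, fun h => ?_⟩
  obtain ⟨i, hi⟩ := exists_abs_eq_norm (centered t) (by rw [h]; exact one_pos)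
  refine ⟨i, ?_⟩
  rw [h, centered] at hi
  rcases (abs_eq zero_le_one).1 hi with hi | hi
  · right; ext; rw [Set.Icc.coe_one]; linarith
  · left; ext; rw [Set.Icc.coe_zero]; linarith

theorem cubePoint_not_mem_boundary {k : ℕ} {x : Fin k → ℝ} (hx : ‖x‖ < 1) :
    cubePoint x ∉ Cube.boundary (Fin k) := by
  rw [mem_boundary_iff_norm, centered_cubePoint hx.le]
  exact hx.ne

theorem norm_centered_lt_one {k : ℕ} {t : Fin k → I} (ht : t ∉ Cube.boundary (Fin k)) :
    ‖centered t‖ < 1 :=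
  (norm_centered_le_one t).lt_of_ne fun h => ht (mem_boundary_iff_norm.2 h)

end CubePoint

/-- `X` is obtained from `A` by attaching `k`-cells, with characteristic maps defined on cubes. -/
structure IsCellAttachment {k : ℕ} {A X E : Type*} [TopologicalSpace A] [TopologicalSpace X]
    (i : C(A, X)) (Φ : E → C(Fin k → I, X)) : Prop where
  isClosedEmbedding : IsClosedEmbedding i
  mem_range : ∀ e, ∀ t ∈ Cube.boundary (Fin k), Φ e t ∈ Set.range i
  not_mem_range : ∀ e, ∀ t ∉ Cube.boundary (Fin k), Φ e t ∉ Set.range i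
  injective : ∀ e e' t t', t ∉ Cube.boundary (Fin k) → t' ∉ Cube.boundary (Fin k) →
    Φ e t = Φ e' t' → e = e' ∧ t = t'
  cover : ∀ x, x ∈ Set.range i ∨ ∃ e, ∃ t ∉ Cube.boundary (Fin k), Φ e t = x
  isClosed : ∀ C : Set X, IsClosed (i ⁻¹' C) → (∀ e, IsClosed (Φ e ⁻¹' C)) → IsClosed C

namespace IsCellAttachment

variable {k : ℕ} {A X E B : Type*} [TopologicalSpace A] [TopologicalSpace X] [AddCommGroup B]
  {i : C(A, X)} {Φ : E → C(Fin k → I, X)}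

theorem isOpen (h : IsCellAttachment i Φ) {O : Set X} (hi : IsOpen (i ⁻¹' O))
    (hΦ : ∀ e, IsOpen (Φ e ⁻¹' O)) : IsOpen O := by
  rw [← isClosed_compl_iff]
  exact h.isClosed _ (isClosed_compl_iff.2 hi) fun e => isClosed_compl_iff.2 (hΦ e)

theorem mem_boundary_of_eq (h : IsCellAttachment i Φ) {e : E} {t : Fin k → I} {a : A}
    (hta : Φ e t = i a) : t ∈ Cube.boundary (Fin k) := by
  by_contra ht
  exact h.not_mem_range e t ht ⟨a, hta.symm⟩

theorem eq_of_eq (h : IsCellAttachment i Φ) {e e' : E} {t t' : Fin k → I}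
    (ht : t ∉ Cube.boundary (Fin k)) (heq : Φ e t = Φ e' t') : e = e' ∧ t = t' := by
  by_cases ht' : t' ∈ Cube.boundary (Fin k)
  · exact absurd (heq ▸ h.mem_range e' t' ht') (h.not_mem_range e t ht)
  · exact h.injective _ _ _ _ ht ht' heq

theorem exists_glue {W : Type*} (h : IsCellAttachment i Φ) (s : A → W)
    (f : E → (Fin k → I) → W) (hf : ∀ e t a, Φ e t = i a → f e t = s a) :
    ∃ F : X → W, (∀ a, F (i a) = s a) ∧ ∀ e t, F (Φ e t) = f e t := by
  have key : ∀ x, ∃ w, (∀ a, i a = x → w = s a) ∧ ∀ e t, Φ e t = x → w = f e t := by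
    intro x
    rcases h.cover x with ⟨a, rfl⟩ | ⟨e, t, ht, rfl⟩
    · exact ⟨s a, fun a' ha' => by rw [h.isClosedEmbedding.injective ha'],
        fun e t het => (hf e t a het).symm⟩
    · refine ⟨f e t, fun a ha => hf e t a ha.symm, fun e' t' het => ?_⟩
      obtain ⟨rfl, rfl⟩ := h.eq_of_eq ht het.symm
      rfl
  choose F hF using key
  exact ⟨F, fun a => (hF _).1 a rfl, fun e t => (hF _).2 e t rfl⟩

theorem continuousOn {W : Type*} [TopologicalSpace W] (h : IsCellAttachment i Φ) {F : X → W}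
    {U : Set X} (hU : IsOpen U) (hi : ContinuousOn (F ∘ i) (i ⁻¹' U))
    (hΦ : ∀ e, ContinuousOn (F ∘ Φ e) (Φ e ⁻¹' U)) : ContinuousOn F U := by
  rw [continuousOn_open_iff hU]
  intro O hO
  refine h.isOpen ?_ fun e => ?_
  · exact (continuousOn_open_iff (hU.preimage i.continuous)).1 hi O hO
  · exact (continuousOn_open_iff (hU.preimage (Φ e).continuous)).1 (hΦ e) O hO

/-- The attaching map followed by s. It is continuous because i is an embedding; w is a default
value where the cell leaves A. -/
theorem exists_boundary_family {W : Type*} [TopologicalSpace W] (h : IsCellAttachment i Φ)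
    (s : C(A, W)) (w : W) (e : E) : ∃ f : (Fin k → I) → W,
      ContinuousOn f (Cube.boundary (Fin k)) ∧ ∀ t a, i a = Φ e t → f t = s a := by
  classical
  let f : (Fin k → I) → W := fun t => if ht : Φ e t ∈ Set.range i then s ht.choose else w
  have hf : ∀ t a, i a = Φ e t → f t = s a := fun t a hta => by
    have ht : Φ e t ∈ Set.range i := ⟨a, hta⟩
    have : ht.choose = a := h.isClosedEmbedding.injective (ht.choose_spec.trans hta.symm)
    simp only [f, dif_pos ht, this]
  refine ⟨f, ?_, hf⟩
  rw [continuousOn_iff_continuous_domRestrict]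
  have hr : ∀ t : Cube.boundary (Fin k), ∃ a, i a = Φ e t := fun t => h.mem_range e t t.2
  choose φ hφ using hr
  have hc : Continuous φ := by
    rw [h.isClosedEmbedding.isEmbedding.continuous_iff]
    have : i ∘ φ = fun t => Φ e t.1 := funext hφ
    rw [this]
    fun_prop
  have : Set.domRestrict (Cube.boundary (Fin k)) f = s ∘ φ := funext fun t => hf _ _ (hφ t)
  rw [this]
  exact s.continuous.comp hc

theorem exists_extension {W : Type*} [TopologicalSpace W] (h : IsCellAttachment i Φ)
    (s : C(A, W)) (Γ : E → C(Fin k → I, W)) (hΓ : ∀ e t a, i a = Φ e t → Γ e t = s a) :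
    ∃ S : C(X, W), (∀ a, S (i a) = s a) ∧ ∀ e t, S (Φ e t) = Γ e t := by
  obtain ⟨F, hF, hF'⟩ := h.exists_glue s (fun e => Γ e) fun e t a hta => hΓ e t a hta.symm
  have hc : Continuous F := by
    rw [← continuousOn_univ]
    refine h.continuousOn isOpen_univ ?_ fun e => ?_
    · have : F ∘ i = s := funext hF
      rw [this]; exact s.continuous.continuousOn
    · have : F ∘ Φ e = Γ e := funext (hF' e)
      rw [this]; exact (Γ e).continuous.continuousOn
  exact ⟨⟨F, hc⟩, hF, hF'⟩

/-- Extension of a family of paths over cells, one cell at a time. -/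
theorem exists_paths_extension {K : Type*} [TopologicalSpace K] (h : IsCellAttachment i Φ)
    {g : C(X, K)} {k₀ : K} (s : C(A, C(I, K))) (h0 : ∀ a, s a 0 = k₀)
    (h1 : ∀ a, s a 1 = g (i a)) (R : E → C(Fin k → I, C(I, K)) → Prop)
    (hcell : ∀ e (f : (Fin k → I) → C(I, K)), ContinuousOn f (Cube.boundary (Fin k)) →
      (∀ t ∈ Cube.boundary (Fin k), f t 0 = k₀) →
      (∀ t ∈ Cube.boundary (Fin k), f t 1 = g (Φ e t)) → (∀ t a, i a = Φ e t → f t = s a) →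
      ∃ Γ : C(Fin k → I, C(I, K)), (∀ t ∈ Cube.boundary (Fin k), Γ t = f t) ∧
        (∀ t, Γ t 0 = k₀) ∧ (∀ t, Γ t 1 = g (Φ e t)) ∧ R e Γ) :
    ∃ S : C(X, C(I, K)), (∀ a, S (i a) = s a) ∧ (∀ x, S x 0 = k₀) ∧ (∀ x, S x 1 = g x) ∧
      ∀ e, R e (S.comp (Φ e)) := by
  have key : ∀ e, ∃ Γ : C(Fin k → I, C(I, K)), (∀ t a, i a = Φ e t → Γ t = s a) ∧
      (∀ t, Γ t 0 = k₀) ∧ (∀ t, Γ t 1 = g (Φ e t)) ∧ R e Γ := by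
    intro e
    obtain ⟨f, hf, hfs⟩ := h.exists_boundary_family s (ContinuousMap.const _ k₀) e
    obtain ⟨Γ, hΓ, hΓ'⟩ := hcell e f hf
      (fun t ht => by
        obtain ⟨a, ha⟩ := h.mem_range e t ht
        rw [hfs t a ha, h0])
      (fun t ht => by
        obtain ⟨a, ha⟩ := h.mem_range e t ht
        rw [hfs t a ha, h1, ha]) hfs
    exact ⟨Γ, fun t a hta => (hΓ t (h.mem_boundary_of_eq hta.symm)).trans (hfs t a hta), hΓ'⟩
  choose Γ hΓ hΓ0 hΓ1 hR using key
  obtain ⟨S, hS, hS'⟩ := h.exists_extension s Γ hΓ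
  refine ⟨S, hS, fun x => ?_, fun x => ?_, fun e => ?_⟩
  · rcases h.cover x with ⟨a, rfl⟩ | ⟨e, t, -, rfl⟩
    · rw [hS, h0]
    · rw [hS', hΓ0]
  · rcases h.cover x with ⟨a, rfl⟩ | ⟨e, t, -, rfl⟩
    · rw [hS, h1]
    · rw [hS', hΓ1]
  · have : S.comp (Φ e) = Γ e := ContinuousMap.ext (hS' e)
    rw [this]
    exact hR e

/-- The complement of the centers of the cells. -/
abbrev Punctured (Φ : E → C(Fin k → I, X)) := {x : X // ∀ e, x ≠ Φ e (cubePoint 0)}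

theorem isOpen_punctured (h : IsCellAttachment i Φ) :
    IsOpen {x : X | ∀ e, x ≠ Φ e (cubePoint 0)} := by
  have h0 : cubePoint (0 : Fin k → ℝ) ∉ Cube.boundary (Fin k) :=
    cubePoint_not_mem_boundary (by simp)
  refine h.isOpen ?_ fun e => ?_
  · convert isOpen_univ
    ext a
    simp only [Set.mem_preimage, Set.mem_ofPred_eq, Set.mem_univ, iff_true]
    intro e he
    exact h0 (h.mem_boundary_of_eq he.symm)
  · convert (isClosed_singleton (x := cubePoint (0 : Fin k → ℝ))).isOpen_compl
    ext t
    simp only [Set.mem_preimage, Set.mem_ofPred_eq, Set.mem_compl_iff, Set.mem_singleton_iff]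
    refine ⟨fun H ht => H e (by rw [ht]), fun H e' he' => H ?_⟩
    exact (h.eq_of_eq h0 he'.symm).2.symm

/-- Radial deformation of the complement of the centers of the cells. -/
theorem exists_radial_homotopy (h : IsCellAttachment i Φ) :
    ∃ H : C(Punctured Φ × I, X), (∀ x, H (x, 0) = x.1) ∧ (∀ x, H (x, 1) ∈ Set.range i) ∧
      ∀ (x : Punctured Φ) e (y : Fin k → ℝ) (s : I), ‖y‖ ≤ 1 → x.1 = Φ e (cubePoint y) →
        H (x, s) = Φ e (cubePoint (((1 - s) + s / ‖y‖ : ℝ) • y)) := by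
  -- The factor moves from 1 to 1 / ‖y‖, which pushes y radially to the sphere. On the sphere it is
  -- always 1, so the homotopy glues with the constant one on A.
  let f : E → (Fin k → I) → C(I, X) := fun e t =>
    ⟨fun s => Φ e (cubePoint (((1 - s) + s / ‖centered t‖ : ℝ) • centered t)),
      (Φ e).continuous.comp (continuous_cubePoint.comp (by fun_prop))⟩
  obtain ⟨F, hF, hF'⟩ := h.exists_glue (fun a => ContinuousMap.const I (i a)) f (by
    intro e t a hta
    ext s
    change Φ e (cubePoint _) = i a
    rw [norm_centered_eq_one (h.mem_boundary_of_eq hta), div_one, sub_add_cancel, one_smul,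
      cubePoint_centered, hta])
  have hc : ContinuousOn F {x : X | ∀ e, x ≠ Φ e (cubePoint 0)} := by
    refine h.continuousOn h.isOpen_punctured ?_ fun e => ?_
    · have : F ∘ i = fun a => ContinuousMap.const I (i a) := funext hF
      rw [this]
      exact (ContinuousMap.continuous_const'.comp i.continuous).continuousOn
    · have : F ∘ Φ e = f e := funext (hF' e)
      rw [this, continuousOn_iff_continuous_domRestrict]
      refine ContinuousMap.continuous_of_continuous_uncurry _ ?_
      refine (Φ e).continuous.comp (continuous_cubePoint.comp ?_)
      have hcc : Continuous fun p : (Φ e ⁻¹' {x : X | ∀ e, x ≠ Φ e (cubePoint 0)}) × I =>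
          centered p.1.1 := continuous_centered.comp (by fun_prop)
      refine Continuous.smul (Continuous.add (by fun_prop)
        (Continuous.div (by fun_prop) hcc.norm fun p => ?_)) hcc
      rw [norm_ne_zero_iff]
      intro hp
      exact p.1.2 e ((congrArg (Φ e) (cubePoint_centered p.1.1)).symm.trans
        (congrArg (fun y => Φ e (cubePoint y)) hp))
  have hc' : Continuous fun x : Punctured Φ => F x.1 :=
    continuousOn_iff_continuous_domRestrict.1 hc
  refine ⟨⟨fun p => F p.1.1 p.2, ContinuousEval.continuous_eval.comp
    ((hc'.comp continuous_fst).prodMk continuous_snd)⟩, fun x => ?_, fun x => ?_, ?_⟩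
  · change F x.1 0 = x.1
    rcases h.cover x.1 with ⟨a, ha⟩ | ⟨e, t, -, ht⟩
    · rw [← ha, hF]; rfl
    · rw [← ht, hF']
      change Φ e (cubePoint _) = _
      simp [cubePoint_centered]
  · change F x.1 1 ∈ _
    rcases h.cover x.1 with ⟨a, ha⟩ | ⟨e, t, -, ht⟩
    · rw [← ha, hF]; exact ⟨a, rfl⟩
    · rw [← ht, hF']
      refine h.mem_range e _ ?_
      have hne : ‖centered t‖ ≠ 0 := by
        rw [norm_ne_zero_iff]
        intro hp
        exact x.2 e (by rw [← ht, ← hp, cubePoint_centered])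
      rw [mem_boundary_iff_norm]
      have hn : ‖((1 - ((1 : I) : ℝ)) + ((1 : I) : ℝ) / ‖centered t‖ : ℝ) • centered t‖ = 1 := by
        rw [norm_smul]
        simp [hne]
      rw [centered_cubePoint hn.le, hn]
  · intro x e y s hy hx
    change F x.1 s = _
    rw [hx, hF']
    change Φ e (cubePoint _) = _
    rw [centered_cubePoint hy]

end IsCellAttachment

/-! ### Cohomology of a space with cells attached -/

namespace IsCellAttachment

variable {k : ℕ} {A X E B : Type*} [TopologicalSpace A] [TopologicalSpace X] [AddCommGroup B]
  {i : C(A, X)} {Φ : E → C(Fin k → I, X)}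

/-- The open unit ball. -/
abbrev OpenBall (k : ℕ) := {x : Fin k → ℝ // ‖x‖ < 1}

/-- The characteristic map of an open cell. -/
def openCell (Φ : E → C(Fin k → I, X)) (e : E) : C(OpenBall k, X) :=
  ⟨fun x => Φ e (cubePoint x.1), (Φ e).continuous.comp
    (continuous_cubePoint.comp continuous_subtype_val)⟩

theorem eq_of_openCell_eq (h : IsCellAttachment i Φ) {e e' : E} {x y : OpenBall k}
    (hxy : openCell Φ e x = openCell Φ e' y) : e = e' ∧ x = y := by
  obtain ⟨h1, h2⟩ := h.eq_of_eq (cubePoint_not_mem_boundary x.2) hxy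
  refine ⟨h1, Subtype.ext ?_⟩
  rw [← centered_cubePoint x.2.le, h2, centered_cubePoint y.2.le]

theorem isOpenEmbedding_openCell (h : IsCellAttachment i Φ) (e : E) :
    IsOpenEmbedding (openCell Φ e) := by
  refine .of_continuous_injective_isOpenMap (openCell Φ e).continuous
    (fun x y hxy => (h.eq_of_openCell_eq hxy).2) fun O hO => ?_
  refine h.isOpen ?_ fun e' => ?_
  · convert isOpen_empty
    refine Set.eq_empty_iff_forall_notMem.2 fun a ha => ?_
    obtain ⟨x, -, hx⟩ := ha
    exact cubePoint_not_mem_boundary x.2 (h.mem_boundary_of_eq hx)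
  · by_cases he : e = e'
    · subst he
      obtain ⟨O', hO', rfl⟩ := isOpen_induced_iff.1 hO
      have : Φ e ⁻¹' (openCell Φ e '' (Subtype.val ⁻¹' O'))
          = (Cube.boundary (Fin k))ᶜ ∩ centered ⁻¹' O' := by
        ext t
        constructor
        · rintro ⟨x, hx, hxt⟩
          have hx' := (h.eq_of_eq (cubePoint_not_mem_boundary x.2) hxt).2
          rw [← hx']
          refine ⟨cubePoint_not_mem_boundary x.2, ?_⟩
          rw [Set.mem_preimage, centered_cubePoint x.2.le]
          exact hx
        · rintro ⟨ht, ht'⟩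
          exact ⟨⟨centered t, norm_centered_lt_one ht⟩, ht', congrArg (Φ e) (cubePoint_centered t)⟩
      rw [this]
      exact (isClosed_boundary k).isOpen_compl.inter (hO'.preimage continuous_centered)
    · convert isOpen_empty
      refine Set.eq_empty_iff_forall_notMem.2 fun t ht => ?_
      obtain ⟨x, -, hx⟩ := ht
      exact he (h.eq_of_eq (cubePoint_not_mem_boundary x.2) hx).1

theorem isCob_openBall {n : ℕ} {ω : Cochain n (OpenBall k) B}
    (hω : coboundary n _ B ω = 0) : IsCob n ω := by
  have hm : ∀ p : OpenBall k × I, ‖(p.2 : ℝ) • p.1.1‖ < 1 := fun p => by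
    rw [norm_smul, Real.norm_eq_abs, abs_of_nonneg p.2.2.1]
    exact lt_of_le_of_lt (mul_le_of_le_one_left (norm_nonneg _) p.2.2.2) p.1.2
  exact isCob_of_contraction hω ⟨fun p => ⟨(p.2 : ℝ) • p.1.1, hm p⟩, by fun_prop⟩ ⟨0, by simp⟩
    (fun x => Subtype.ext (by simp)) (fun x => Subtype.ext (by simp))

/-- The punctured open cell. -/
def puncturedCell (h : IsCellAttachment i Φ) (e : E) : C(PuncturedBall k, Punctured Φ) :=
  ⟨fun x => ⟨Φ e (cubePoint x.1), fun e' he' => x.2.2 (by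
      have := (h.eq_of_eq (cubePoint_not_mem_boundary x.2.1) he').2
      rw [← centered_cubePoint x.2.1.le, this, centered_cubePoint (by simp)])⟩,
    ((Φ e).continuous.comp (continuous_cubePoint.comp continuous_subtype_val)).subtype_mk _⟩

/-- The inclusion of the punctured ball in the ball. -/
def ballInclusion (k : ℕ) : C(PuncturedBall k, OpenBall k) :=
  ⟨fun x => ⟨x.1, x.2.1⟩, by fun_prop⟩

theorem isEmbedding_ballInclusion (k : ℕ) : IsEmbedding (ballInclusion k) :=
  IsEmbedding.of_comp (ballInclusion k).continuous continuous_subtype_val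
    IsEmbedding.subtypeVal

theorem cochainPullback_eq_zero_of_mem_range (h : IsCellAttachment i Φ) {n : ℕ} {ω : Cochain n X B}
    (hi : cochainPullback n B i ω = 0) {V : Type*} [TopologicalSpace V] {f : C(V, X)}
    (hf : ∀ x, f x ∈ Set.range i) : cochainPullback n B f ω = 0 := by
  ext τ
  obtain ⟨ρ, hρ⟩ := exists_lift_cube h.isClosedEmbedding.isEmbedding (f.comp τ) fun t => hf (τ t)
  change ω.1 (f.comp τ) = 0
  rw [← hρ]
  exact congrArg (fun φ : Cochain n A B => φ.1 ρ) hi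

/-- The scaled cube in a cell. -/
def cellScaling (Φ : E → C(Fin k → I, X)) (e : E) : C((Fin k → I) × I, X) :=
  ⟨fun p => Φ e (cubePoint (((1 + p.2) / 2 : ℝ) • centered p.1)),
    (Φ e).continuous.comp (continuous_cubePoint.comp
      (Continuous.smul (f := fun p : (Fin k → I) × I => (1 + (p.2 : ℝ)) / 2) (by fun_prop)
        (continuous_centered.comp continuous_fst)))⟩

/-- Mayer–Vietoris for the complement of the centers, which deforms into A, and the disjoint open
cells. The overlaps are punctured balls, whose cohomology in degree n vanishes for k ≤ n; for k = n
+ 1 the only condition is the value of ω on the characteristic cube. -/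
theorem exists_coboundary (h : IsCellAttachment i Φ) {n : ℕ} (hk : k ≤ n + 1)
    (ω : Cochain (n + 1) X B) (hω : coboundary (n + 1) X B ω = 0)
    (hi : cochainPullback (n + 1) B i ω = 0)
    (hc : ∀ (hkn : k = n + 1) (e : E), ω.1 ((Φ e).comp ⟨fun t j => t (Fin.cast hkn j), by
      fun_prop⟩) = 0) :
    ∃ c, coboundary n X B c = ω := by
  obtain ⟨H, H0, H1, HΦ⟩ := h.exists_radial_homotopy
  let u : C(Punctured Φ, X) := ⟨Subtype.val, by fun_prop⟩
  have hu : IsOpenEmbedding u := h.isOpen_punctured.isOpenEmbedding_subtypeVal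
  have hv := h.isOpenEmbedding_openCell
  have hb : ∀ e, ∃ b : Cochain n (OpenBall k) B,
      coboundary n _ B b = cochainPullback (n + 1) B (openCell Φ e) ω := fun e =>
    isCob_openBall (n := n + 1) (by rw [coboundary_pullback, hω, map_zero])
  choose b hb using hb
  -- ω vanishes at the end of the radial deformation, which lies in A, so minus its prism is a
  -- primitive on the complement of the centers.
  have ha : coboundary n _ B (-(prism H ω)) = cochainPullback (n + 1) B u ω := by
    have h1 := prism_coboundary_succ H ω
    have e0 : endMap H 0 = u := ContinuousMap.ext H0
    rw [hω, map_zero, h.cochainPullback_eq_zero_of_mem_range hi (f := endMap H 1) H1, e0] at h1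
    rw [map_neg]
    have h2 := eq_add_of_sub_eq h1.symm
    rw [zero_sub, zero_add] at h2
    rw [← h2, neg_neg]
  have hpq : ∀ e x, u (h.puncturedCell e x) = openCell Φ e (ballInclusion k x) := fun _ _ => rfl
  refine exists_coboundary_of_cover u hu (openCell Φ) hv h.puncturedCell
    (fun _ => ballInclusion k) (fun e => ?_) hpq ?_
    (fun e e' x y hxy => (h.eq_of_openCell_eq hxy).1) ?_ ω hω (-(prism H ω)) ha b hb ?_
  · exact IsEmbedding.of_comp (h.puncturedCell e).continuous u.continuous
      ((hv e).isEmbedding.comp (isEmbedding_ballInclusion k))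
  · intro e x y hxy
    refine ⟨⟨y.1, y.2, fun hy => x.2 e ?_⟩, Subtype.ext hxy.symm⟩
    change x.1 = _ at hxy
    rw [hxy, ← hy]
    rfl
  · intro x
    by_cases hx : ∀ e, x ≠ Φ e (cubePoint 0)
    · exact Or.inl ⟨⟨x, hx⟩, rfl⟩
    · push Not at hx
      obtain ⟨e, he⟩ := hx
      exact Or.inr ⟨e, ⟨0, by simp⟩, he.symm⟩
  · intro e
    have hcocycle : coboundary n _ B (cochainPullback n B (h.puncturedCell e) (-(prism H ω))
        - cochainPullback n B (ballInclusion k) (b e)) = 0 := by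
      rw [map_sub, coboundary_pullback, coboundary_pullback, ha, hb, sub_eq_zero]
      rfl
    rcases hk.lt_or_eq with hk | rfl
    · exact isCob_puncturedBall (Nat.lt_succ_iff.1 hk) _ hcocycle
    refine isCob_puncturedBall_of_sum_eq_zero _ hcocycle ?_
    -- The cell is cut into a concentric cube of half the size and the shells over its faces. The
    -- difference of the primitives, summed over the faces of the inner cube, is up to sign the sum
    -- of ω over these pieces, that is, ω on the cell.
    have hin := coboundary_cubeOf_succ ω (cellScaling Φ e)
    have e1 : endMap (cellScaling Φ e) 1 = Φ e := by
      ext t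
      change Φ e (cubePoint _) = _
      norm_num [cubePoint_centered]
    let inner : SingularCube (n + 1) (OpenBall (n + 1)) :=
      ⟨fun t => ⟨fun j => (t j : ℝ) - 1 / 2, by
        rw [pi_norm_lt_iff one_pos]
        intro j
        have := (t j).2
        rw [Real.norm_eq_abs, abs_lt]
        constructor <;> linarith [this.1, this.2]⟩, by fun_prop⟩
    have e0 : endMap (cellScaling Φ e) 0 = (openCell Φ e).comp inner := by
      ext t
      change Φ e (cubePoint _) = Φ e (cubePoint _)
      congr 2
      ext j
      simp [centered, inner]
      ring
    have hinner := congrArg (fun φ : Cochain (n + 1) _ B => φ.1 inner) (hb e)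
    have hcω : ω.1 (Φ e) = 0 := hc rfl e
    rw [hω, e1, e0, hcω] at hin
    have hfaceb : ∀ j (ε : Bool), (ballInclusion (n + 1)).comp (boundaryFace n j ε)
        = cubeFace j (endpoint ε) inner := fun j ε => rfl
    -- On the inner faces the norm is 1 / 2, so the radial factor is 1 + s and the deformation
    -- sweeps out exactly the shells of the scaling.
    have hfacea : ∀ j (ε : Bool),
        H.comp (((h.puncturedCell e).comp (boundaryFace n j ε)).prodMap (ContinuousMap.id I))
          = ⟨fun p => cellScaling Φ e (j.insertNth (endpoint ε) p.1, p.2), by fun_prop⟩ := by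
      intro j ε
      ext p
      refine (HΦ _ e (boundaryFace n j ε p.1).1 p.2 (boundaryFace n j ε p.1).2.1.le rfl).trans ?_
      change _ = Φ e (cubePoint _)
      have hcen : centered (j.insertNth (endpoint ε) p.1 : Fin (n + 1) → I)
          = (2 : ℝ) • (boundaryFace n j ε p.1).1 := by
        ext l
        simp only [centered, Pi.smul_apply, smul_eq_mul, boundaryFace_apply]
        ring
      have hnorm : ‖(boundaryFace n j ε p.1).1‖ = 1 / 2 := by
        have h1 : ‖centered (j.insertNth (endpoint ε) p.1 : Fin (n + 1) → I)‖ = 1 :=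
          norm_centered_eq_one ⟨j, by rw [Fin.insertNth_apply_same]; cases ε <;> simp [endpoint]⟩
        rw [hcen, norm_smul] at h1
        norm_num at h1
        linarith
      rw [hcen, hnorm, smul_smul]
      congr 3
      ring
    have hS : ∀ j (ε : Bool), (cochainPullback n B (h.puncturedCell e) (-(prism H ω))
        - cochainPullback n B (ballInclusion (n + 1)) (b e)).1 (boundaryFace n j ε)
        = -ω.1 (cubeOf ⟨fun p => cellScaling Φ e (j.insertNth (endpoint ε) p.1, p.2),
            by fun_prop⟩) - (b e).1 (cubeFace j (endpoint ε) inner) := by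
      intro j ε
      rw [← hfacea, ← hfaceb]
      rfl
    simp only [hS]
    have hb1 : ∑ j : Fin (n + 1), (-1 : ℤ) ^ (j : ℕ) • ((b e).1 (cubeFace j (endpoint true) inner)
        - (b e).1 (cubeFace j (endpoint false) inner)) = ω.1 ((openCell Φ e).comp inner) := hinner
    have ha1 : 0 = 0 - ω.1 ((openCell Φ e).comp inner) - ∑ j : Fin (n + 1), (-1 : ℤ) ^ (j : ℕ) •
        (ω.1 (cubeOf ⟨fun p => cellScaling Φ e (j.insertNth (endpoint true) p.1, p.2),
            by fun_prop⟩)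
          - ω.1 (cubeOf ⟨fun p => cellScaling Φ e (j.insertNth (endpoint false) p.1, p.2),
            by fun_prop⟩)) := hin
    rw [← hb1, zero_sub, ← neg_add', eq_comm, neg_eq_zero, ← Finset.sum_add_distrib] at ha1
    rw [← neg_eq_zero, ← ha1, ← Finset.sum_neg_distrib]
    refine Finset.sum_congr rfl fun j _ => ?_
    rw [← smul_neg, ← smul_add]
    congr 1
    abel

end IsCellAttachment

/-! ### Skeleta of CW complexes -/

section Skeleta

variable (Z : Type*) [TopologicalSpace Z] [T2Space Z] [CWComplex (Set.univ : Set Z)]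

/-- The union of the cells of dimension less than `k`. -/
def stage (k : ℕ) : Set Z := RelCWComplex.skeletonLT (Set.univ : Set Z) (k : ℕ∞)

theorem isClosed_stage (k : ℕ) : IsClosed (stage Z k) :=
  RelCWComplex.Subcomplex.closed _

theorem stage_zero : stage Z 0 = ∅ := by
  rw [stage, Nat.cast_zero]
  exact CWComplex.skeletonLT_zero_eq_empty

theorem stage_mono {k l : ℕ} (h : k ≤ l) : stage Z k ⊆ stage Z l :=
  RelCWComplex.skeletonLT_mono (by exact_mod_cast h)

theorem iUnion_stage : ⋃ k, stage Z k = Set.univ :=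
  RelCWComplex.iUnion_skeletonLT_eq_complex

/-- The inclusion of a stage in a later one. -/
def stageInclusion {k l : ℕ} (h : k ≤ l) : C(stage Z k, stage Z l) :=
  ⟨Set.inclusion (stage_mono Z h), by fun_prop⟩

/-- The inclusion of a stage in the whole complex. -/
def stageVal (k : ℕ) : C(stage Z k, Z) := ⟨Subtype.val, by fun_prop⟩

variable {Z}

theorem mem_stage_iff {k : ℕ} {x : Z} : x ∈ stage Z k ↔
    ∃ m, ∃ (_ : m < k) (j : RelCWComplex.cell (Set.univ : Set Z) m),
      x ∈ RelCWComplex.openCell m j := by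
  refine (CWComplex.mem_skeletonLT_iff (C := (Set.univ : Set Z))).trans ?_
  simp only [Nat.cast_lt]

theorem closedCell_subset_stage {k : ℕ} (e : RelCWComplex.cell (Set.univ : Set Z) k) :
    RelCWComplex.closedCell k e ⊆ stage Z (k + 1) := by
  have := RelCWComplex.closedCell_subset_skeletonLT k e
  exact_mod_cast this

/-- The characteristic map of a cell, defined on a cube. -/
def cellMap (k : ℕ) (e : RelCWComplex.cell (Set.univ : Set Z) k) : C(Fin k → I, stage Z (k + 1)) :=
  ⟨fun t => ⟨RelCWComplex.map k e (centered t), closedCell_subset_stage e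
      ⟨centered t, by simpa using norm_centered_le_one t, rfl⟩⟩, by
    refine Continuous.subtype_mk ?_ _
    exact (RelCWComplex.continuousOn k e).comp_continuous continuous_centered fun t => by
      simpa using norm_centered_le_one t⟩

theorem cellMap_apply {k : ℕ} (e : RelCWComplex.cell (Set.univ : Set Z) k) (t : Fin k → I) :
    (cellMap k e t : Z) = RelCWComplex.map k e (centered t) := rfl

theorem closedCell_eq_range {k : ℕ} (e : RelCWComplex.cell (Set.univ : Set Z) k) :
    RelCWComplex.closedCell k e = Set.range fun t => (cellMap k e t : Z) := by
  ext x
  constructor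
  · rintro ⟨y, hy, rfl⟩
    exact ⟨cubePoint y, congrArg (RelCWComplex.map k e) (centered_cubePoint (by simpa using hy))⟩
  · rintro ⟨t, rfl⟩
    exact ⟨centered t, by simpa using norm_centered_le_one t, rfl⟩

theorem cellMap_mem_openCell {k : ℕ} (e : RelCWComplex.cell (Set.univ : Set Z) k) {t : Fin k → I}
    (ht : t ∉ Cube.boundary (Fin k)) : (cellMap k e t : Z) ∈ RelCWComplex.openCell k e :=
  ⟨centered t, by simpa using norm_centered_lt_one ht, rfl⟩

theorem cellMap_mem_stage {k : ℕ} (e : RelCWComplex.cell (Set.univ : Set Z) k) {t : Fin k → I}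
    (ht : t ∈ Cube.boundary (Fin k)) : (cellMap k e t : Z) ∈ stage Z k :=
  RelCWComplex.cellFrontier_subset_skeletonLT k e
    ⟨centered t, by simpa using norm_centered_eq_one ht, rfl⟩

theorem isCellAttachment_stage (k : ℕ) :
    IsCellAttachment (stageInclusion Z k.le_succ) (cellMap (Z := Z) k) where
  isClosedEmbedding := by
    refine IsClosedEmbedding.inclusion (stage_mono Z k.le_succ) ?_
    exact (isClosed_stage Z k).preimage continuous_subtype_val
  mem_range e t ht := ⟨⟨_, cellMap_mem_stage e ht⟩, rfl⟩
  not_mem_range e t ht := by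
    rintro ⟨a, ha⟩
    refine Set.disjoint_left.1 (RelCWComplex.disjoint_skeletonLT_openCell (n := (k : ℕ∞))
      (j := e) le_rfl) a.2 ?_
    have : (a : Z) = cellMap k e t := congrArg Subtype.val ha
    rw [this]
    exact cellMap_mem_openCell e ht
  injective e e' t t' ht ht' heq := by
    have heq' : (cellMap k e t : Z) = cellMap k e' t' := congrArg Subtype.val heq
    have he : e = e' := by
      by_contra hne
      refine Set.disjoint_left.1 (RelCWComplex.disjoint_openCell_of_ne (i := e) (j := e') ?_)
        (cellMap_mem_openCell e ht) (heq' ▸ cellMap_mem_openCell e' ht')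
      simpa using hne
    subst he
    refine ⟨rfl, ?_⟩
    have := (RelCWComplex.map k e).injOn (by
      rw [RelCWComplex.source_eq]; simpa using norm_centered_lt_one ht) (by
      rw [RelCWComplex.source_eq]; simpa using norm_centered_lt_one ht') heq'
    rw [← cubePoint_centered t, this, cubePoint_centered]
  cover x := by
    obtain ⟨m, hm, j, hx⟩ := mem_stage_iff.1 x.2
    rcases (Nat.lt_succ_iff.1 hm).lt_or_eq with hm | rfl
    · exact Or.inl ⟨⟨x, mem_stage_iff.2 ⟨m, hm, j, hx⟩⟩, rfl⟩
    · obtain ⟨y, hy, hyx⟩ := hx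
      have hy' : ‖y‖ < 1 := by simpa using hy
      refine Or.inr ⟨j, cubePoint y, cubePoint_not_mem_boundary hy', Subtype.ext ?_⟩
      rw [cellMap_apply, centered_cubePoint hy'.le, hyx]
  isClosed C hi hΦ := by
    -- Closedness is tested on closed cells: those of dimension below k lie in the smaller stage, a
    -- k-cell is the compact image of a cube, and the open cells of higher dimension do not meet the
    -- stage.
    have hcl : IsClosed (Subtype.val '' C : Set Z) := by
      refine CWComplex.isClosed_of_disjoint_openCell_or_isClosed_inter_closedCell
        (C := (Set.univ : Set Z)) (Set.subset_univ _) fun m _ j => ?_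
      rcases lt_trichotomy m k with hm | rfl | hm
      · right
        have h1 : IsClosed (Subtype.val '' (stageInclusion Z k.le_succ ⁻¹' C) : Set Z) :=
          (isClosed_stage Z k).isClosedEmbedding_subtypeVal.isClosedMap _ hi
        convert h1.inter (RelCWComplex.isClosed_closedCell (n := m) (i := j)) using 1
        ext x
        constructor
        · rintro ⟨⟨y, hy, rfl⟩, hx⟩
          exact ⟨⟨⟨y, stage_mono Z hm (closedCell_subset_stage j hx)⟩, hy, rfl⟩, hx⟩
        · rintro ⟨⟨y, hy, rfl⟩, hx⟩
          exact ⟨⟨_, hy, rfl⟩, hx⟩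
      · right
        have h1 : IsCompact (cellMap m j ⁻¹' C) := (hΦ j).isCompact
        convert (h1.image (f := fun t => (cellMap m j t : Z))
          (continuous_subtype_val.comp (cellMap m j).continuous)).isClosed using 1
        rw [closedCell_eq_range]
        ext x
        constructor
        · rintro ⟨⟨y, hy, rfl⟩, t, ht⟩
          refine ⟨t, ?_, ht⟩
          rw [Set.mem_preimage, Subtype.ext ht]
          exact hy
        · rintro ⟨t, ht, rfl⟩
          exact ⟨⟨_, ht, rfl⟩, t, rfl⟩
      · left
        refine Set.disjoint_left.2 ?_
        rintro x ⟨y, -, rfl⟩ hx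
        exact Set.disjoint_left.1 (RelCWComplex.disjoint_skeletonLT_openCell
          (n := ((k + 1 : ℕ) : ℕ∞)) (j := j) (by exact_mod_cast hm)) y.2 hx
    have := hcl.preimage (continuous_subtype_val (p := fun x => x ∈ stage Z (k + 1)))
    rwa [Set.preimage_image_eq _ Subtype.val_injective] at this

theorem continuous_of_stages {W : Type*} [TopologicalSpace W] {F : Z → W}
    (h : ∀ k, Continuous fun x : stage Z k => F x) : Continuous F := by
  rw [continuous_iff_isClosed]
  intro O hO
  rw [CWComplex.closed (Set.univ : Set Z) _ (Set.subset_univ _)]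
  intro n j
  have h1 : IsClosed (Subtype.val '' ((fun x : stage Z (n + 1) => F x) ⁻¹' O) : Set Z) :=
    (isClosed_stage Z (n + 1)).isClosedEmbedding_subtypeVal.isClosedMap _ (hO.preimage (h _))
  convert h1.inter (RelCWComplex.isClosed_closedCell (n := n) (i := j)) using 1
  ext x
  constructor
  · rintro ⟨hx, hx'⟩
    exact ⟨⟨⟨x, closedCell_subset_stage j hx'⟩, hx, rfl⟩, hx'⟩
  · rintro ⟨⟨y, hy, rfl⟩, hx⟩
    exact ⟨hy, hx⟩

/-- Extension of a map from a stage to the whole complex. -/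
theorem exists_extension_of_step {W : Type*} [TopologicalSpace W] {N : ℕ}
    (P : ∀ k, C(stage Z k, W) → Prop) (s : C(stage Z N, W)) (hs : P N s)
    (hstep : ∀ k, N ≤ k → ∀ s : C(stage Z k, W), P k s → ∃ s' : C(stage Z (k + 1), W),
      P (k + 1) s' ∧ s'.comp (stageInclusion Z k.le_succ) = s) :
    ∃ S : C(Z, W), ∀ k, N ≤ k → P k (S.comp (stageVal Z k)) := by
  choose next hnext hnext' using hstep
  -- The index is shifted by N so that the recursion starts from the given map; compatibility makes
  -- the union well defined, and it is continuous since each closed cell lies in some stage.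
  let T : ∀ j, {s : C(stage Z (N + j), W) // P (N + j) s} := fun j =>
    Nat.rec ⟨s, hs⟩ (fun j t => ⟨next (N + j) (Nat.le_add_right _ _) t.1 t.2,
      hnext _ _ _ _⟩) j
  have hT : ∀ j (x : Z) (hx : x ∈ stage Z (N + j)) (hx' : x ∈ stage Z (N + (j + 1))),
      (T (j + 1)).1 ⟨x, hx'⟩ = (T j).1 ⟨x, hx⟩ := fun j x hx hx' =>
    DFunLike.congr_fun (hnext' (N + j) (Nat.le_add_right _ _) (T j).1 (T j).2) ⟨x, hx⟩
  have hT' : ∀ j l (x : Z) (hx : x ∈ stage Z (N + j)) (hx' : x ∈ stage Z (N + (j + l))),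
      (T (j + l)).1 ⟨x, hx'⟩ = (T j).1 ⟨x, hx⟩ := by
    intro j l x hx
    induction l with
    | zero => exact fun _ => rfl
    | succ l ih =>
      intro hx'
      have hm : x ∈ stage Z (N + (j + l)) := stage_mono Z (by omega) hx
      exact (hT (j + l) x hm hx').trans (ih hm)
  have hmem : ∀ x : Z, ∃ j, x ∈ stage Z (N + j) := fun x => by
    have : x ∈ ⋃ k, stage Z k := by rw [iUnion_stage]; trivial
    obtain ⟨k, hk⟩ := Set.mem_iUnion.1 this
    exact ⟨k, stage_mono Z (by omega) hk⟩
  choose J hJ using hmem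
  let F : Z → W := fun x => (T (J x)).1 ⟨x, hJ x⟩
  have hF : ∀ j (x : Z) (hx : x ∈ stage Z (N + j)), F x = (T j).1 ⟨x, hx⟩ := by
    intro j x hx
    rcases le_total (J x) j with h | h
    · obtain ⟨l, rfl⟩ := Nat.exists_eq_add_of_le h
      exact (hT' (J x) l x (hJ x) hx).symm
    · obtain ⟨l, hl⟩ := Nat.exists_eq_add_of_le h
      have : ∀ j' (hj : x ∈ stage Z (N + j')), j' = j + l →
          (T j').1 ⟨x, hj⟩ = (T j).1 ⟨x, hx⟩ := by
        rintro _ hj rfl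
        exact hT' j l x hx hj
      exact this _ (hJ x) hl
  have hc : Continuous F := continuous_of_stages fun k => by
    have h1 : (fun x : stage Z k => F x)
        = fun x => (T k).1 (stageInclusion Z (Nat.le_add_left k N) x) :=
      funext fun x => hF k x _
    rw [h1]
    fun_prop
  refine ⟨⟨F, hc⟩, fun k hk => ?_⟩
  obtain ⟨j, rfl⟩ := Nat.exists_eq_add_of_le hk
  have : (⟨F, hc⟩ : C(Z, W)).comp (stageVal Z (N + j)) = (T j).1 :=
    ContinuousMap.ext fun x => hF j x x.2
  rw [this]
  exact (T j).2

end Skeleta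

/-! ### Lifting maps from CW complexes to spaces of paths -/

section PathCochain

variable {V K B : Type*} [TopologicalSpace V] [TopologicalSpace K] [AddCommGroup B]

/-- The cochain whose value on a cube is the value of `ζ` on the adjoint of the cube of paths. -/
def pathCochain {n : ℕ} (ζ : Cochain (n + 1) K B) (s : C(V, C(I, K))) : Cochain n V B :=
  prism ⟨fun p => s p.1 p.2, by fun_prop⟩ ζ

theorem cochainPullback_pathCochain {V' : Type*} [TopologicalSpace V'] {n : ℕ}
    (ζ : Cochain (n + 1) K B) (s : C(V, C(I, K))) (f : C(V', V)) :
    cochainPullback n B f (pathCochain ζ s) = pathCochain ζ (s.comp f) := rfl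

/-- The prism formula for the evaluation homotopy from the constant map to h; the constant end
contributes 0 as the degree is positive. -/
theorem coboundary_pathCochain {n : ℕ} {ζ : Cochain (n + 1) K B}
    (hζ : coboundary (n + 1) K B ζ = 0) {k₀ : K} {h : C(V, K)} {s : C(V, C(I, K))}
    (h0 : ∀ x, s x 0 = k₀) (h1 : ∀ x, s x 1 = h x) :
    coboundary n V B (pathCochain ζ s) = cochainPullback (n + 1) B h ζ := by
  have key := prism_coboundary_succ (⟨fun p => s p.1 p.2, by fun_prop⟩ : C(V × I, K)) ζ
  have e0 : endMap (⟨fun p => s p.1 p.2, by fun_prop⟩ : C(V × I, K)) 0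
      = ContinuousMap.const V k₀ := ContinuousMap.ext h0
  have e1 : endMap (⟨fun p => s p.1 p.2, by fun_prop⟩ : C(V × I, K)) 1 = h :=
    ContinuousMap.ext h1
  have hz : cochainPullback (n + 1) B (ContinuousMap.const V k₀) ζ = 0 := by
    ext τ
    exact cochain_const ζ k₀
  rw [e0, e1, hζ, hz, map_zero, sub_zero, eq_comm, sub_eq_zero] at key
  exact key.symm

end PathCochain

/-! ### Primitives and path cochains over attached cells -/

namespace IsCellAttachment

variable {k : ℕ} {A X E B K : Type*} [TopologicalSpace A] [TopologicalSpace X] [AddCommGroup B]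
  [TopologicalSpace K] {i : C(A, X)}

/-- Subtracting the coboundary of the extension by zero of a primitive on A reduces to a cocycle
that vanishes on A. -/
theorem exists_coboundary_of_pullback {Φ : E → C(Fin k → I, X)} (h : IsCellAttachment i Φ)
    {n : ℕ} (hk : k ≤ n + 1)
    (ω : Cochain (n + 1) X B) (hω : coboundary (n + 1) X B ω = 0) (c : Cochain n A B)
    (hi : coboundary n A B c = cochainPullback (n + 1) B i ω)
    (hc : ∀ (hkn : k = n + 1) (e : E),
      ω.1 ((Φ e).comp ⟨fun t j => t (Fin.cast hkn j), by fun_prop⟩)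
        = (coboundary n X B (extendZero i h.isClosedEmbedding.injective c)).1
          ((Φ e).comp ⟨fun t j => t (Fin.cast hkn j), by fun_prop⟩)) :
    ∃ c', coboundary n X B c' = ω := by
  obtain ⟨c', hc'⟩ := h.exists_coboundary hk
    (ω - coboundary n X B (extendZero i h.isClosedEmbedding.injective c))
    (by rw [map_sub, hω, coboundary_coboundary, sub_zero])
    (by rw [map_sub, ← coboundary_pullback, cochainPullback_extendZero, hi, sub_self])
    (fun hkn e => sub_eq_zero.2 (hc hkn e))
  exact ⟨c' + extendZero i h.isClosedEmbedding.injective c, by rw [map_add, hc', sub_add_cancel]⟩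

/-- On A, P differs from b by a coboundary. Adding the coboundary of an extension to b does not
change δb and makes its restriction to A equal to P. -/
theorem sum_pathCochain_faces {m : ℕ} {Φ : E → C(Fin (m + 2) → I, X)}
    (h : IsCellAttachment i Φ) (P : Cochain (m + 1) A B) (b : Cochain (m + 1) X B)
    (c : Cochain m A B) (hc : coboundary m A B c = P - cochainPullback (m + 1) B i b) (e : E)
    (χ : Fin (m + 2) → Bool → C(Fin (m + 1) → I, A))
    (hχ : ∀ j ε, i.comp (χ j ε) = cubeFace j (endpoint ε) (Φ e)) :
    (coboundary (m + 1) X B b).1 (Φ e) = ∑ j : Fin (m + 2), (-1 : ℤ) ^ (j : ℕ) •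
      (P.1 (χ j true) - P.1 (χ j false)) := by
  let c' := extendZero i h.isClosedEmbedding.injective c
  have h1 : coboundary (m + 1) X B (b + coboundary m X B c') = coboundary (m + 1) X B b := by
    rw [map_add, coboundary_coboundary, add_zero]
  have h2 : cochainPullback (m + 1) B i (b + coboundary m X B c') = P := by
    rw [map_add, ← coboundary_pullback, cochainPullback_extendZero, hc, add_sub_cancel]
  rw [← h1, coboundary_apply]
  refine Finset.sum_congr rfl fun j _ => ?_
  have h3 : ∀ ε, (b + coboundary m X B c').1 (cubeFace j (endpoint ε) (Φ e)) = P.1 (χ j ε) := by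
    intro ε
    rw [← hχ, ← h2]
    rfl
  rw [← h3 true, ← h3 false]
  rfl

end IsCellAttachment

/-! ### Null-homotopies of maps on CW complexes, one skeleton at a time -/

section CWLift

variable {Z K B : Type*} [TopologicalSpace Z] [T2Space Z] [CWComplex (Set.univ : Set Z)]
  [TopologicalSpace K] [AddCommGroup B] {k₀ : K} {h : C(Z, K)}

/-- A family of paths over a stage from the base point to the values of a map. -/
def IsPathLift (k₀ : K) (h : C(Z, K)) (k : ℕ) (s : C(stage Z k, C(I, K))) : Prop :=
  (∀ x, s x 0 = k₀) ∧ ∀ x, s x 1 = h x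

theorem exists_isPathLift_succ {k : ℕ} (hk : ∀ x : K, Subsingleton (π_ k K x))
    (s : C(stage Z k, C(I, K))) (hs : IsPathLift k₀ h k s) :
    ∃ s' : C(stage Z (k + 1), C(I, K)), IsPathLift k₀ h (k + 1) s' ∧
      s'.comp (stageInclusion Z k.le_succ) = s := by
  obtain ⟨S, h1, h2, h3, -⟩ := (isCellAttachment_stage (Z := Z) k).exists_paths_extension
    (g := h.comp (stageVal Z (k + 1))) s hs.1 hs.2 (fun _ _ => True) (by
      intro e f hf h0 h1 _
      obtain ⟨Γ, a, b, c⟩ := exists_paths hk (G := (h.comp (stageVal Z (k + 1))).comp (cellMap k e))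
        hf h0 h1
      exact ⟨Γ, a, b, c, trivial⟩)
  exact ⟨S, ⟨h2, h3⟩, ContinuousMap.ext h1⟩

theorem isEmpty_stage_zero : IsEmpty (stage Z 0) := by
  rw [stage_zero]
  infer_instance

theorem exists_isPathLift (k : ℕ) (hk : ∀ j < k, ∀ x : K, Subsingleton (π_ j K x)) :
    ∃ s, IsPathLift k₀ h k s := by
  induction k with
  | zero =>
    have := isEmpty_stage_zero (Z := Z)
    exact ⟨ContinuousMap.const _ (ContinuousMap.const _ k₀), fun x => isEmptyElim x,
      fun x => isEmptyElim x⟩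
  | succ k ih =>
    obtain ⟨s, hs⟩ := ih fun j hj => hk j (hj.trans k.lt_succ_self)
    obtain ⟨s', hs', -⟩ := exists_isPathLift_succ (hk k k.lt_succ_self) s hs
    exact ⟨s', hs'⟩

theorem exists_paths_of_isPathLift {N : ℕ} (hN : ∀ j, N ≤ j → ∀ x : K, Subsingleton (π_ j K x))
    (s : C(stage Z N, C(I, K))) (hs : IsPathLift k₀ h N s) :
    ∃ S : C(Z, C(I, K)), (∀ x, S x 0 = k₀) ∧ ∀ x, S x 1 = h x := by
  obtain ⟨S, hS⟩ := exists_extension_of_step (fun k s => IsPathLift k₀ h k s) s hs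
    fun k hk s hs => exists_isPathLift_succ (hN k hk) s hs
  have key : ∀ x, ∃ k, N ≤ k ∧ x ∈ stage Z k := fun x => by
    have : x ∈ ⋃ k, stage Z k := by rw [iUnion_stage]; trivial
    obtain ⟨k, hk⟩ := Set.mem_iUnion.1 this
    exact ⟨k + N, Nat.le_add_left _ _, stage_mono Z (Nat.le_add_right _ _) hk⟩
  refine ⟨S, fun x => ?_, fun x => ?_⟩ <;> obtain ⟨k, hk, hx⟩ := key x
  · exact (hS k hk).1 ⟨x, hx⟩
  · exact (hS k hk).2 ⟨x, hx⟩

/-- The stage has cells of dimension at most n only, so degree n + 1 exceeds its dimension and the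
condition on top cells never arises. -/
theorem exists_coboundary_stage {n k : ℕ} (hk : k ≤ n + 1) (ω : Cochain (n + 1) (stage Z k) B)
    (hω : coboundary (n + 1) _ B ω = 0) : ∃ c, coboundary n _ B c = ω := by
  induction k with
  | zero =>
    have := isEmpty_stage_zero (Z := Z)
    exact isCob_of_isEmpty ω
  | succ k ih =>
    obtain ⟨c, hc⟩ := ih (by omega)
      (cochainPullback (n + 1) B (stageInclusion Z k.le_succ) ω)
      (by rw [coboundary_pullback, hω, map_zero])
    exact (isCellAttachment_stage (Z := Z) k).exists_coboundary_of_pullback (by omega) ω hω c hc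
      (fun hkn => by omega)

theorem exists_paths_of_pullback_eq_coboundary {m : ℕ} {ζ : Cochain (m + 2) K B}
    (hζ : coboundary (m + 2) K B ζ = 0) (hd : Detects ζ)
    (hs : ∀ (x : K) (α : B), ∃ q : GenLoop (Fin (m + 2)) K x, ζ.1 q.1 = α)
    (hπ : ∀ k, k ≠ m + 2 → ∀ x : K, Subsingleton (π_ k K x))
    (b : Cochain (m + 1) Z B)
    (hb : coboundary (m + 1) Z B b = cochainPullback (m + 2) B h ζ) :
    ∃ S : C(Z, C(I, K)), (∀ x, S x 0 = k₀) ∧ ∀ x, S x 1 = h x := by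
  have hω : ∀ k (s : C(stage Z k, C(I, K))), IsPathLift k₀ h k s → coboundary (m + 1) _ B
      (pathCochain ζ s - cochainPullback (m + 1) B (stageVal Z k) b) = 0 := by
    intro k s hs
    rw [map_sub, coboundary_pathCochain hζ hs.1 (h := h.comp (stageVal Z k)) hs.2,
      coboundary_pullback, hb, sub_eq_zero]
    rfl
  -- Over cells of dimension at most m there is no obstruction, and P - b is a cocycle of degree m +
  -- 1 there, hence a coboundary δc for dimension reasons.
  obtain ⟨s, hs₁⟩ := exists_isPathLift (Z := Z) (k₀ := k₀) (h := h) (m + 1)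
    fun j hj => hπ j (by omega)
  obtain ⟨c, hc⟩ := exists_coboundary_stage le_rfl _ (hω _ s hs₁)
  have hA₁ := isCellAttachment_stage (Z := Z) (m + 1)
  -- Paths over the (m+1)-cells are chosen with P = b + δc on each cell, c being extended by zero;
  -- then P - b remains a coboundary on the next stage.
  obtain ⟨s', hs', hs'0, hs'1, hR⟩ := hA₁.exists_paths_extension
    (g := h.comp (stageVal Z (m + 2))) s hs₁.1 hs₁.2
    (fun e Γ => ζ.1 (pathCube Γ) = b.1 ((stageVal Z (m + 2)).comp (cellMap (m + 1) e))
      + (coboundary m _ B (extendZero _ hA₁.isClosedEmbedding.injective c)).1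
        (cellMap (m + 1) e)) (by
      intro e f hf h0 h1 _
      exact exists_paths_with_value (hπ (m + 1) (by omega)) hζ hs
        (G := (h.comp (stageVal Z (m + 2))).comp (cellMap (m + 1) e)) hf h0 h1 _)
  have hs₂ : IsPathLift k₀ h (m + 2) s' := ⟨hs'0, hs'1⟩
  obtain ⟨c', hc'⟩ := hA₁.exists_coboundary_of_pullback le_rfl _ (hω _ s' hs₂) c
    (by
      rw [hc, map_sub, cochainPullback_pathCochain]
      have : s'.comp (stageInclusion Z (m + 1).le_succ) = s := ContinuousMap.ext hs'
      rw [this]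
      rfl)
    (fun _ e => sub_eq_iff_eq_add'.2 (hR e))
  have hA₂ := isCellAttachment_stage (Z := Z) (m + 2)
  obtain ⟨s'', -, hs''0, hs''1, -⟩ := hA₂.exists_paths_extension
    (g := h.comp (stageVal Z (m + 3))) s' hs₂.1 hs₂.2 (fun _ _ => True) (by
      intro e f hf h0 h1 hfs
      have hχ : ∀ j ε, ∃ χ : C(Fin (m + 1) → I, stage Z (m + 2)),
          (stageInclusion Z (m + 2).le_succ).comp χ
            = cubeFace j (endpoint ε) (cellMap (m + 2) e) := fun j ε =>
        exists_lift_cube hA₂.isClosedEmbedding.isEmbedding _ fun t => hA₂.mem_range e _ ⟨j, by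
          change (j.insertNth (endpoint ε) t : Fin (m + 2) → I) j = 0 ∨
            (j.insertNth (endpoint ε) t : Fin (m + 2) → I) j = 1
          rw [Fin.insertNth_apply_same]; cases ε <;> simp [endpoint]⟩
      choose χ hχ using hχ
      -- The obstruction over an (m+2)-cell vanishes: ζ on the image of the cell is δb, and this is
      -- the alternating sum of P over the faces.
      have hsum := hA₂.sum_pathCochain_faces (pathCochain ζ s')
        (cochainPullback (m + 1) B (stageVal Z (m + 3)) b) c' hc' e χ hχ
      rw [coboundary_pullback, hb] at hsum
      obtain ⟨Γ, a, b, c⟩ := exists_paths_of_sum_eq hζ hd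
        (G := (h.comp (stageVal Z (m + 3))).comp (cellMap (m + 2) e)) hf h0 h1
        (fun j ε => s'.comp (χ j ε)) (fun j ε t => (hfs _ _ (DFunLike.congr_fun (hχ j ε) t)).symm)
        hsum
      exact ⟨Γ, a, b, c, trivial⟩)
  exact exists_paths_of_isPathLift (fun j hj => hπ j (by omega)) s'' ⟨hs''0, hs''1⟩

end CWLift

/-! ### Fundamental classes -/

section FundamentalClass

variable {n : ℕ} {K A : Type*} [TopologicalSpace K] [AddCommGroup A]

theorem homotopic_of_injective_evalPi [NeZero n] {z : Cocycle n K A} {x : K}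
    (h : Function.Injective (evalPi (QuotientAddGroup.mk z) x)) {p q : GenLoop (Fin n) K x}
    (hpq : z.1.1 p.1 = z.1.1 q.1) : GenLoop.Homotopic p q :=
  Quotient.exact (h (a₁ := Quotient.mk _ p) (a₂ := Quotient.mk _ q) hpq)

theorem exists_genLoop_of_surjective_evalPi [NeZero n] {z : Cocycle n K A} {x : K}
    (h : Function.Surjective (evalPi (QuotientAddGroup.mk z) x)) (α : A) :
    ∃ q : GenLoop (Fin n) K x, z.1.1 q.1 = α := by
  obtain ⟨c, hc⟩ := h α
  obtain ⟨q, rfl⟩ := Quotient.exists_rep c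
  exact ⟨q, hc⟩

theorem detects_of_injective_evalPi [NeZero n] {z : Cocycle n K A}
    (h : ∀ x, Function.Injective (evalPi (QuotientAddGroup.mk z) x)) : Detects z.1 :=
  fun x _ hq => homotopic_of_injective_evalPi (q := GenLoop.const) (h x) hq

theorem subsingleton_piCoeff_one (X : Type*) [TopologicalSpace X] [SimplyConnectedSpace X]
    (x : X) : Subsingleton (PiCoeff 1 X x) :=
  (HomotopyGroup.pi1EquivFundamentalGroup (X := X) (x := x)).subsingleton

theorem exists_coboundary_of_pullback_eq_zero {m : ℕ} {V : Type*} [TopologicalSpace V]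
    {f : C(V, K)} {z : Cocycle (m + 1) K A}
    (h : pullback (m + 1) f (QuotientAddGroup.mk z : Cohomology (m + 1) K A) = 0) :
    ∃ b, coboundary m V A b = cochainPullback (m + 1) A f z.1 := by
  have h1 : (QuotientAddGroup.mk (cocyclePullback (m + 1) A f z) : Cohomology (m + 1) V A) = 0 := h
  rw [QuotientAddGroup.eq_zero_iff, AddSubgroup.mem_addSubgroupOf] at h1
  exact h1

/-- A map from a CW complex to an Eilenberg–MacLane space that pulls the fundamental class back to
zero is null-homotopic. -/
theorem nullhomotopic_of_pullback_eq_zero [NeZero n] {Z : Type*} [TopologicalSpace Z] [T2Space Z]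
    [CWComplex (Set.univ : Set Z)] (k₀ : K) {ι : Cohomology n K A}
    (hK : IsEilenbergMacLane n K ι) (hA : n = 1 → Subsingleton A) (h : C(Z, K))
    (hι : pullback n h ι = 0) : h.Nullhomotopic := by
  suffices H : ∃ S : C(Z, C(I, K)), (∀ x, S x 0 = k₀) ∧ ∀ x, S x 1 = h x by
    obtain ⟨S, h0, h1⟩ := H
    exact ⟨k₀, .symm ⟨⟨⟨fun p => S p.2 p.1, by fun_prop⟩, h0, h1⟩⟩⟩
  obtain ⟨m, rfl⟩ : ∃ m, n = m + 1 := ⟨n - 1, by have := NeZero.ne n; omega⟩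
  induction ι using QuotientAddGroup.induction_on with | H z => ?_
  rcases m with _ | m
  -- For n = 1 the coefficients are trivial, so all homotopy groups of K vanish and the paths can be
  -- built from the empty stage on.
  · have hA' := hA rfl
    have hπ : ∀ (j : ℕ) (x : K), Subsingleton (π_ j K x) := fun j x => by
      rcases eq_or_ne j (0 + 1) with rfl | hj
      · exact (hK.bijective_eval x).injective.subsingleton
      · exact hK.trivial_pi j hj x
    obtain ⟨s, hs⟩ := exists_isPathLift (Z := Z) (k₀ := k₀) (h := h) 0 fun j _ => hπ j
    exact exists_paths_of_isPathLift (fun j _ => hπ j) s hs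
  · obtain ⟨b, hb⟩ := exists_coboundary_of_pullback_eq_zero hι
    exact exists_paths_of_pullback_eq_coboundary z.2
      (detects_of_injective_evalPi fun x => (hK.bijective_eval x).injective)
      (fun x => exists_genLoop_of_surjective_evalPi (hK.bijective_eval x).surjective)
      hK.trivial_pi b hb

theorem pullback_comp {U V : Type*} [TopologicalSpace U] [TopologicalSpace V] (f : C(V, K))
    (g : C(U, V)) (c : Cohomology n K A) : pullback n g (pullback n f c)
      = pullback n (f.comp g) c := by
  induction c using QuotientAddGroup.induction_on with | H z => rfl

end FundamentalClass

end KillPi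

end

theorem mainTheorem8
    (n : ℕ) [NeZero n]
    (X : Type uX) [TopologicalSpace X] [SimplyConnectedSpace X] (x₀ : X)
    (Y : Type uY) [TopologicalSpace Y] (y₀ : Y)
    (hY : Subsingleton (π_ (n - 1) Y y₀))
    (lam : KillPi.Cohomology n Y (KillPi.PiCoeff n X x₀))
    (hlam : Function.Bijective (KillPi.evalPi lam y₀))
    (K : Type uK) [TopologicalSpace K] (k₀ : K)
    (ι : KillPi.Cohomology n K (KillPi.PiCoeff n X x₀))
    (hK : KillPi.IsEilenbergMacLane n K ι)
    (g : C(Y, K)) (hg : KillPi.pullback n g ι = lam) :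
    KillPi.IsFibration.{uW} (KillPi.HomotopyFiber.proj g k₀) ∧
    Function.Surjective (KillPi.HomotopyFiber.proj g k₀) ∧
    (∀ (e₀ : KillPi.HomotopyFiber g k₀) (he : KillPi.HomotopyFiber.proj g k₀ e₀ = y₀),
      Subsingleton (π_ n (KillPi.HomotopyFiber g k₀) e₀) ∧
      (∀ k : ℕ, k ≠ n →
        Function.Bijective (KillPi.piMap k (KillPi.HomotopyFiber.proj g k₀) he)) ∧
      (∀ (k : ℕ) [NeZero k], k ≠ n →
        ∃ e : π_ k (KillPi.HomotopyFiber g k₀) e₀ ≃* π_ k Y y₀,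
          ∀ a, e a = KillPi.piMap k (KillPi.HomotopyFiber.proj g k₀) he a)) ∧
    (∀ (M : Type uM) [TopologicalSpace M] (f : C(M, Y)),
      (g.comp f).Nullhomotopic →
        ∃ F : C(M, KillPi.HomotopyFiber g k₀), (KillPi.HomotopyFiber.proj g k₀).comp F = f) ∧
    (∀ (M : Type uM) [TopologicalSpace M] (f : C(M, Y)),
      KillPi.HasCWHomotopyType M → KillPi.pullback n f lam = 0 →
        ∃ F : C(M, KillPi.HomotopyFiber g k₀), (KillPi.HomotopyFiber.proj g k₀).comp F = f) := by
  have := hK.pathConnected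
  refine ⟨KillPi.isFibration_proj g k₀, KillPi.surjective_proj g k₀, ?_,
    fun M _ f => KillPi.exists_lift_of_nullhomotopic g k₀ f, ?_⟩
  · intro e₀ he
    obtain ⟨m, rfl⟩ : ∃ m, n = m + 1 := ⟨n - 1, by have := NeZero.ne n; omega⟩
    induction ι using QuotientAddGroup.induction_on with | H z => ?_
    -- With λ replaced by the class of the pulled-back cocycle, its value on a loop u is by
    -- definition that of `z` on g ∘ u.
    subst hg
    have hd : KillPi.Detects z.1 :=
      KillPi.detects_of_injective_evalPi fun x => (hK.bijective_eval x).injective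
    have hbij : ∀ k : ℕ, k ≠ m + 1 →
        Function.Bijective (KillPi.piMap k (KillPi.HomotopyFiber.proj g k₀) he) := by
      intro k hk
      rcases eq_or_ne (k + 1) (m + 1) with hkm | hkm
      -- The exceptional degree n - 1, where π_n(K) obstructs injectivity: here source and target
      -- are both trivial.
      · obtain rfl : k = m := Nat.succ_injective hkm
        have hF : Subsingleton (π_ k (KillPi.HomotopyFiber g k₀) e₀) :=
          KillPi.subsingleton_pi_fiber_pred z.2 hd he
            (fun h => by subst h; exact KillPi.subsingleton_piCoeff_one X x₀) hY
            (KillPi.exists_genLoop_of_surjective_evalPi hlam.surjective)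
        have hY' : Subsingleton (π_ k Y y₀) := hY
        exact ⟨fun a b _ => Subsingleton.elim a b,
          fun c => ⟨Quotient.mk _ GenLoop.const, Subsingleton.elim _ _⟩⟩
      · exact KillPi.bijective_piMap_proj (hK.trivial_pi k hk) (hK.trivial_pi (k + 1) hkm) he
    refine ⟨?_, hbij, fun k _ hk => ⟨MulEquiv.ofBijective
      (MulHom.mk (KillPi.piMap k (KillPi.HomotopyFiber.proj g k₀) he)
        (KillPi.piMap_mul _ he)) (hbij k hk), fun _ => rfl⟩⟩
    exact KillPi.subsingleton_pi_fiber z.2 (hK.trivial_pi (m + 2) (by omega)) he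
      fun u u' => KillPi.homotopic_of_injective_evalPi hlam.injective
  · rintro M _ f ⟨Z, _, _, ⟨_⟩, ⟨E⟩⟩ hf
    refine KillPi.exists_lift_of_nullhomotopic g k₀ f ?_
    -- The obstruction argument applies to the CW model; composing with the homotopy equivalence
    -- transports the null-homotopy back to M.
    have hnull : ((g.comp f).comp E.invFun).Nullhomotopic := by
      refine KillPi.nullhomotopic_of_pullback_eq_zero k₀ hK
        (fun h => by subst h; exact KillPi.subsingleton_piCoeff_one X x₀) _ ?_
      rw [← KillPi.pullback_comp, ← KillPi.pullback_comp, hg, hf, map_zero]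
    obtain ⟨c, hc⟩ := hnull
    refine ⟨c, ?_⟩
    have h1 := hc.comp (.refl E.toFun)
    have h2 : (((g.comp f).comp E.invFun).comp E.toFun).Homotopic (g.comp f) :=
      (ContinuousMap.Homotopic.refl (g.comp f)).comp E.left_inv
    exact h2.symm.trans h1
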